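/- **Setting.** Let $d\ge 1$, $\lambda\ge 1$, and put $\epsilon=\sqrt{d/\lambda}$. Write points of $\mathbb R^{d+1}$ as $(x,t)$, $x\in\mathbb R^d$, $t\in\mathbb R$. For a symmetric positive definite $H\in\mathbb R^{d\times d}$ let $\|x\|_H=\sqrt{x^\top Hx}$, $\|(x,t)\|_{H,1}=\sqrt{x^\top Hx+t^2}$, and for a $k$-linear form $T$ on $\mathbb R^d$, $k\ge1$, let $\|T\|_H=\sup_{\|u_1\|_H=\dots=\|u_k\|_H=1}T(u_1,\dots,u_k)$. Let $D\subset\mathbb R^{d+1}$ be closed and let $\mathcal U_H(r)=\{x\in\mathbb R^d:\|x\|_H\le r\}$ and $\mathcal U_{H,1}(r)=D\cap\{u:\|u\|_{H,1}\le r\}$. Assume that: 1. $z\in C^2(D)$ (that is, $z$ extends to a $C^2$ function on an open set containing $D$; derivatives at points of $D$ are those of the extension), $0\in\partial D$ is the unique minimizer of $z$ over $D$, and $\nabla z(0)=(0_d,1)$; 2. there are an open neighborhood $\Omega$ of $0_d$ and $\psi\in C^2(\Omega)$ with $\psi(0)=0$, $\nabla\psi(0)=0$ and $\partial D\cap(\Omega\times\mathbb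 R)=\{(x,\psi(x)):x\in\Omega\}$; 3. $H:=\nabla_x^2z(0)+\nabla^2\psi(0)$ is positive definite; 4. there is $\rho_0>0$ with $\mathcal U_H(\rho_0)\subseteq\Omega$ and, for $\Theta(x,y)=(x,\psi(x)+y)$, $$\Theta(\mathcal U_H(\rho_0)\times(0,\rho_0))\subseteq D\cap(\mathcal U_H(\rho_0)\times\mathbb R)\subseteq\Theta(\mathcal U_H(\rho_0)\times[0,\infty));$$ 5. $\partial_tz(u)>0$ for all $u\in\mathcal U_{H,1}(\rho_0)$; 6. (global growth) there are $\rho_1\in(0,\rho_0)$ and $s>0$ with $z(u)-z(0)\ge s\|u\|_{H,1}$ for all $u\in D\setminus\mathcal U_{H,1}(\rho_1)$. Let $w(x,y)=z(x,\psi(x)+y)$ and $$\omega_{0,j}(r,r')=\sup_{\mathcal U_H(r)\times[0,r']}|\partial_y^jw|,\qquad \omega_{\ell,j}(r,r')=\sup_{\mathcal U_H(r)\times[0,r']}\|\nabla_x^\ell\partial_y^jw\|_H\quad(\ell\ge1),$$ $\omega_{\ell,j}=\omega_{\ell,j}(0,0)$, $\delta_2(r)=\sup_{x\in\mathcal U_H(r)}\|\nabla^2\psi(x)\|_H$,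 and $$C_{\min}=\min\Big(\inf_{u\in\mathcal U_{H,1}(\rho_1)}\partial_tz(u),\ \inf_{0\ne x\in\mathcal U_H(\rho_1)}\frac{z(x,\psi(x))-z(0)}{\frac12\|x\|_H^2}\Big).$$ **Proposition.** There is a function $C(R,C_{34})>0$, nondecreasing in each argument and depending on nothing else, such that the following holds. Let $M\ge1$, and suppose that $R\ge 12/C_{\min}+2(1+2M)(\log\lambda)/d$ and $C_{34}$ are such that $w\in C^4(\mathcal U_H(R\epsilon)\times[0,(R\epsilon)^2])$ and $$\epsilon\le s,\qquad R\epsilon\le\min(1,\rho_0,2\rho_1),\qquad R\epsilon\,\delta_2(\rho_1)\le2,$$ $$R\epsilon\big(\omega_{1,1}+\omega_{0,2}(R\epsilon,R\epsilon)\big)+(R\epsilon)^2\omega_{2,1}(R\epsilon,0)\le\tfrac12,\qquad \big(\omega_{3,0}^2+\omega_{4,0}(R\epsilon,0)\big)\frac{d^2}{\lambda}\le C_{34}.$$ Then $e^{-\lambda z}$ is integrable on $D$ and $$\int_De^{-\lambda z(u)}\,du=\frac{(2\pi/\lambda)^{d/2}e^{-\lambda z(0)}}{\lambda\sqrt{\det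 H}}\,(1+\mathrm{Rem}_1),$$ where $$|\mathrm{Rem}_1|\le C(R,C_{34})\Big[\big(\omega_{3,0}^2+\omega_{4,0}(R\epsilon,0)\big)\frac{d^2}{\lambda}+\big(\omega_{1,1}^2+\omega_{2,1}(R\epsilon,0)\big)\frac d\lambda+\omega_{0,2}(R\epsilon,(R\epsilon)^2)\frac1\lambda+\frac1{\lambda^M}\Big].$$ -/

import Mathlib

open Set MeasureTheory

noncomputable section

namespace BoundaryLaplace

/-- `ℝ^d`. Only its linear structure, its topology and Lebesgue measure `volume` are used;
all lengths below are measured by `normH` and `normH1`. Points of `ℝ^{d+1}` are pairs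
`(x, t) : Vec d × ℝ`, and `volume` on the product is Lebesgue measure on `ℝ^{d+1}`. -/
abbrev Vec (d : ℕ) : Type := Fin d → ℝ

/-- `‖x‖_H = √(xᵀ H x)`. -/
def normH {d : ℕ} (H : Matrix (Fin d) (Fin d) ℝ) (x : Vec d) : ℝ :=
  Real.sqrt (x ⬝ᵥ H.mulVec x)

/-- `‖(x, t)‖_{H,1} = √(xᵀ H x + t²)`. -/
def normH1 {d : ℕ} (H : Matrix (Fin d) (Fin d) ℝ) (u : Vec d × ℝ) : ℝ :=
  Real.sqrt (u.1 ⬝ᵥ H.mulVec u.1 + u.2 ^ 2)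

/-- `U_H(r) = {x : ‖x‖_H ≤ r}`. -/
def UH {d : ℕ} (H : Matrix (Fin d) (Fin d) ℝ) (r : ℝ) : Set (Vec d) :=
  {x | normH H x ≤ r}

/-- `U_{H,1}(r) = D ∩ {u : ‖u‖_{H,1} ≤ r}`. -/
def UH1 {d : ℕ} (D : Set (Vec d × ℝ)) (H : Matrix (Fin d) (Fin d) ℝ) (r : ℝ) :
    Set (Vec d × ℝ) :=
  D ∩ {u | normH1 H u ≤ r}

/-- `Θ(x, y) = (x, ψ(x) + y)`. -/
def Theta {d : ℕ} (ψ : Vec d → ℝ) (p : Vec d × ℝ) : Vec d × ℝ :=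
  (p.1, ψ p.1 + p.2)

/-- `w(x, y) = z(x, ψ(x) + y)`. -/
def wFun {d : ℕ} (z : Vec d × ℝ → ℝ) (ψ : Vec d → ℝ) (p : Vec d × ℝ) : ℝ :=
  z (Theta ψ p)

/-- `∂_t z(u)`. -/
def dt {d : ℕ} (z : Vec d × ℝ → ℝ) (u : Vec d × ℝ) : ℝ :=
  fderiv ℝ z u (0, 1)

/-- The matrix `H = ∇ₓ² z(0) + ∇² ψ(0)`. -/
def hessH {d : ℕ} (z : Vec d × ℝ → ℝ) (ψ : Vec d → ℝ) : Matrix (Fin d) (Fin d) ℝ :=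
  Matrix.of fun i j =>
    iteratedFDeriv ℝ 2 z 0 ![(Pi.single i 1, 0), (Pi.single j 1, 0)]
      + iteratedFDeriv ℝ 2 ψ 0 ![Pi.single i 1, Pi.single j 1]

/-- The `H`-weighted operator norm of a `k`-linear form (used for `k ≥ 1`):
`‖T‖_H = sup {T(u₁, …, u_k) : ‖u₁‖_H = ⋯ = ‖u_k‖_H = 1}`. -/
def tensorNormH {d k : ℕ} (H : Matrix (Fin d) (Fin d) ℝ)
    (T : ContinuousMultilinearMap ℝ (fun _ : Fin k => Vec d) ℝ) : ℝ :=
  sSup {a : ℝ | ∃ u : Fin k → Vec d, (∀ i, normH H (u i) = 1) ∧ a = T u}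

/-- `∂_y^j f(x, y)` for a function `f` on `ℝ^d × [0, b]`, one-sided at the end points. -/
def partialY {d : ℕ} (f : Vec d × ℝ → ℝ) (b : ℝ) (j : ℕ) (x : Vec d) (y : ℝ) : ℝ :=
  iteratedDerivWithin j (fun t => f (x, t)) (Icc 0 b) y

/-- `∇ₓ^ℓ ∂_y^j f(x, y)` for a function `f` on `U_H(a) × [0, b]`, as an `ℓ`-linear form.
Derivatives at the boundary of this set are taken from within the set. -/
def mixedDeriv {d : ℕ} (H : Matrix (Fin d) (Fin d) ℝ) (f : Vec d × ℝ → ℝ) (a b : ℝ)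
    (ℓ j : ℕ) (x : Vec d) (y : ℝ) :
    ContinuousMultilinearMap ℝ (fun _ : Fin ℓ => Vec d) ℝ :=
  iteratedFDerivWithin ℝ ℓ (fun x' => partialY f b j x' y) (UH H a) x

/-- The size of `∇ₓ^ℓ ∂_y^j f(x, y)`: the absolute value for `ℓ = 0`, and the `H`-weighted
operator norm for `ℓ ≥ 1`. -/
def derivSize {d : ℕ} (H : Matrix (Fin d) (Fin d) ℝ) (f : Vec d × ℝ → ℝ) (a b : ℝ)
    (ℓ j : ℕ) (x : Vec d) (y : ℝ) : ℝ :=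
  if ℓ = 0 then |partialY f b j x y| else tensorNormH H (mixedDeriv H f a b ℓ j x y)

/-- `ω_{ℓ,j}(r, r') = sup {‖∇ₓ^ℓ ∂_y^j w(x, y)‖_H : (x, y) ∈ U_H(r) × [0, r']}`, where `w` is
regarded as a function on `U_H(a) × [0, b]`, with `0 ≤ r ≤ a`, `0 ≤ r' ≤ b`, `0 < a`, `0 < b`.
If `w` is of class `C^{ℓ+j}` there, then the value does not depend on the choice of `a, b`.
The set of differentiation has to be kept apart from the set over which the supremum is taken,
because the latter is degenerate for `r = 0` or `r' = 0`. -/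
def omega {d : ℕ} (H : Matrix (Fin d) (Fin d) ℝ) (w : Vec d × ℝ → ℝ) (a b : ℝ)
    (ℓ j : ℕ) (r r' : ℝ) : ℝ :=
  sSup ((fun p : Vec d × ℝ => derivSize H w a b ℓ j p.1 p.2) '' (UH H r ×ˢ Icc 0 r'))

/-- `δ_ℓ(r) = sup {‖∇^ℓ ψ(x)‖_H : x ∈ U_H(r)}` for `ℓ ≥ 1`. -/
def delta {d : ℕ} (H : Matrix (Fin d) (Fin d) ℝ) (ψ : Vec d → ℝ) (ℓ : ℕ) (r : ℝ) : ℝ :=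
  sSup ((fun x => tensorNormH H (iteratedFDeriv ℝ ℓ ψ x)) '' UH H r)

/-- The standing assumptions on the set `D`, the function `z`, the local parametrization `ψ` of
`∂D` on `Ω`, and the radius `ρ₀`. That `z` is of class `C²` on the closed set `D` means that it
extends to a `C²` function on an open set containing `D`; here `z` stands for such an
extension, and its derivatives at points of `D` are computed from it. -/
structure Setting {d : ℕ} (D : Set (Vec d × ℝ)) (z : Vec d × ℝ → ℝ) (Ω : Set (Vec d))
    (ψ : Vec d → ℝ) (ρ₀ : ℝ) : Prop where
  isClosed : IsClosed D
  z_contDiff : ∃ D₁ : Set (Vec d × ℝ), IsOpen D₁ ∧ D ⊆ D₁ ∧ ContDiffOn ℝ 2 z D₁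
  zero_mem : (0 : Vec d × ℝ) ∈ frontier D
  argmin : ∀ u ∈ D, u ≠ 0 → z 0 < z u
  /-- `∇z(0) = (0, …, 0, 1)`. -/
  z_gradient : fderiv ℝ z 0 = ContinuousLinearMap.snd ℝ (Vec d) ℝ
  Ω_open : IsOpen Ω
  zero_mem_Ω : (0 : Vec d) ∈ Ω
  ψ_contDiff : ContDiffOn ℝ 2 ψ Ω
  ψ_zero : ψ 0 = 0
  ψ_gradient : fderiv ℝ ψ 0 = 0
  boundary : frontier D ∩ Ω ×ˢ univ = (fun x => (x, ψ x)) '' Ω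
  H_posDef : (hessH z ψ).PosDef
  ρ₀_pos : 0 < ρ₀
  UH_subset : UH (hessH z ψ) ρ₀ ⊆ Ω
  strip_subset : Theta ψ '' (UH (hessH z ψ) ρ₀ ×ˢ Ioo 0 ρ₀) ⊆ D ∩ UH (hessH z ψ) ρ₀ ×ˢ univ
  subset_above : D ∩ UH (hessH z ψ) ρ₀ ×ˢ univ ⊆ Theta ψ '' (UH (hessH z ψ) ρ₀ ×ˢ Ici 0)
  dt_pos : ∀ u ∈ UH1 D (hessH z ψ) ρ₀, 0 < dt z u

/-- The global growth condition: `ρ₁ ∈ (0, ρ₀)`, `s > 0`, and `z(u) - z(0) ≥ s ‖u‖_{H,1}` for all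
`u ∈ D ∖ U_{H,1}(ρ₁)`. -/
structure GlobalGrowth {d : ℕ} (D : Set (Vec d × ℝ)) (z : Vec d × ℝ → ℝ) (ψ : Vec d → ℝ)
    (ρ₀ ρ₁ s : ℝ) : Prop where
  ρ₁_pos : 0 < ρ₁
  ρ₁_lt : ρ₁ < ρ₀
  s_pos : 0 < s
  growth : ∀ u ∈ D \ UH1 D (hessH z ψ) ρ₁, s * normH1 (hessH z ψ) u ≤ z u - z 0

/-- `C_min`: the smaller of the infimum of `∂_t z` over `U_{H,1}(ρ₁)` and the infimum of
`(z(x, ψ(x)) - z(0)) / (‖x‖_H² / 2)` over `x ∈ U_H(ρ₁)`, `x ≠ 0`. -/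
def Cmin {d : ℕ} (D : Set (Vec d × ℝ)) (z : Vec d × ℝ → ℝ) (ψ : Vec d → ℝ) (ρ₁ : ℝ) : ℝ :=
  min (sInf (dt z '' UH1 D (hessH z ψ) ρ₁))
    (sInf ((fun x => (z (x, ψ x) - z 0) / (normH (hessH z ψ) x ^ 2 / 2)) ''
      (UH (hessH z ψ) ρ₁ \ {0})))

end BoundaryLaplace

end

open BoundaryLaplace

/-! This is Laplace's method at a boundary minimum, with constants that do not depend on the
dimension. Put `a = R * ε`, so that `λ a² = R² d`. The shear `Theta` straightens the boundary
without changing volume, and `D` splits into the image of the strip `U_H(a) × [0, a²]` and the rest.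

Off the strip, `Setting.growth_dichotomy` leaves two cases. Either global growth holds, or the
excess of `z` is at least `C_min` times the height above the boundary plus half the squared
horizontal length. Half of the exponent gives smallness and the other half integrability
(`Setting.exp_le_tails`, `Setting.far_estimate`). The lower bound on `R` turns the result into a
multiple of `λ^(-M)` (`exp_tails_le`).

On the strip, the vertical integral is a one-dimensional Watson integral
(`boundary_integral_estimate`). Up to the factor `1/λ` it is `1/p(x)` with small errors, where `p(x)
= ∂_y w(x, 0)`, and `1/p = 1 - ℓ(x) + O(ℓ² + e)` with `ℓ` linear and `e` bounding the Taylor error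
`p - 1 - ℓ`. In the horizontal variable, coordinates in which `λ‖·‖_H²` is the squared Euclidean
length turn the quadratic part of the phase into the standard Gaussian. What remains of the phase is
`V = T + O(κ)` with `T` a cubic form. Expanding `e^{-V} q` about `1 - T - ℓ`, the terms `T` and `ℓ`
are odd and vanish over a centred ball, so only second-order errors remain (`gauss_expansion`).

The delicate term is the Gaussian integral of `T² e^{2|T|}`. On the ball of squared radius `R² d`
the available pointwise bound on `T` has order `ω₃₀ d^{3/2} / √λ`, which the hypotheses do not
control. Its gradient has order `ω₃₀ d / √λ`, which they do. So `T` is replaced by an odd, globally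
Lipschitz function that dominates it on the ball (`dampedCubic`), and exponential moments come from
Gaussian concentration (`lintegral_exp_le_of_odd`). The latter is the Maurey–Pisier rotation
argument: an odd function is recovered from its derivative along the half-turn from `X` to `-X`
through an independent copy. -/

open ProbabilityTheory

/-! ### Standard Gaussian measure and concentration for odd functions. -/

namespace BoundaryLaplace

/-- The Euclidean length `√(v ⬝ v)`. -/
noncomputable def euc {d : ℕ} (v : Vec d) : ℝ := Real.sqrt (v ⬝ᵥ v)

/-- The standard Gaussian measure on `ℝ^d`. -/
noncomputable def gauss (d : ℕ) : Measure (Vec d) := Measure.pi fun _ => gaussianReal 0 1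

instance (d : ℕ) : IsProbabilityMeasure (gauss d) := by unfold gauss; infer_instance

/-- `Vec d` carries the sup norm, so the Gaussian theory of Euclidean space is carried over along
the coordinate equivalence; Gaussianity and centredness are read off from it. -/
lemma gauss_eq_map (d : ℕ) :
    gauss d = (stdGaussian (EuclideanSpace ℝ (Fin d))).map
      (PiLp.continuousLinearEquiv 2 ℝ (fun _ : Fin d => ℝ) : _ →L[ℝ] _) := by
  rw [← map_pi_eq_stdGaussian, Measure.map_map (by fun_prop) (by fun_prop)]
  have : ((PiLp.continuousLinearEquiv 2 ℝ (fun _ : Fin d => ℝ) : _ →L[ℝ] _) :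
      EuclideanSpace ℝ (Fin d) → _) ∘ (WithLp.toLp 2) = id := by
    ext x; rfl
  rw [this, Measure.map_id]; rfl

instance (d : ℕ) : IsGaussian (gauss d) := by
  rw [gauss_eq_map]; infer_instance

lemma integral_dual_gauss (d : ℕ) (L : StrongDual ℝ (Vec d)) : ∫ x, L x ∂gauss d = 0 := by
  rw [gauss_eq_map, integral_map (by fun_prop) (by fun_prop)]
  exact integral_strongDual_stdGaussian (L.comp
    (PiLp.continuousLinearEquiv 2 ℝ (fun _ : Fin d => ℝ) : EuclideanSpace ℝ (Fin d) →L[ℝ] Vec d))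

/-- A centred Gaussian pair of independent copies is invariant under rotations mixing the two
copies. This is the only symmetry that the concentration argument uses. -/
lemma gauss_rotation (d : ℕ) (θ : ℝ) :
    ((gauss d).prod (gauss d)).map (ContinuousLinearMap.rotation θ) = (gauss d).prod (gauss d) :=
  IsGaussian.map_rotation_eq_self_of_forall_strongDual_eq_zero (integral_dual_gauss d) θ

lemma integral_exp_dot_gauss {d : ℕ} (a : Vec d) :
    ∫ y, Real.exp (a ⬝ᵥ y) ∂gauss d = Real.exp (a ⬝ᵥ a / 2) := by
  have h : ∀ y : Vec d, Real.exp (a ⬝ᵥ y) = ∏ i, Real.exp (a i * y i) := fun y => by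
    rw [dotProduct, Real.exp_sum]
  simp_rw [h]
  rw [gauss, integral_fintype_prod_eq_prod (𝕜 := ℝ) (fun i (t : ℝ) => Real.exp (a i * t))]
  have h2 : ∀ i, ∫ t, Real.exp (a i * t) ∂gaussianReal 0 1 = Real.exp (a i * a i / 2) := fun i => by
    have := congrFun (mgf_id_gaussianReal (μ := 0) (v := 1)) (a i)
    simp only [mgf, id] at this
    rw [this]; congr 1; simp; ring
  simp_rw [h2]
  rw [← Real.exp_sum, dotProduct, Finset.sum_div]

lemma integrable_exp_dot_gauss {d : ℕ} (a : Vec d) :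
    Integrable (fun y => Real.exp (a ⬝ᵥ y)) (gauss d) := by
  have h : ∀ y : Vec d, Real.exp (a ⬝ᵥ y) = ∏ i, Real.exp (a i * y i) := fun y => by
    rw [dotProduct, Real.exp_sum]
  simp_rw [h]
  exact Integrable.fintype_prod (𝕜 := ℝ) (f := fun i (t : ℝ) => Real.exp (a i * t))
    fun i => integrable_exp_mul_gaussianReal (a i)

lemma lintegral_exp_dot_gauss {d : ℕ} (a : Vec d) :
    ∫⁻ y, ENNReal.ofReal (Real.exp (a ⬝ᵥ y)) ∂gauss d = ENNReal.ofReal (Real.exp (a ⬝ᵥ a / 2)) := by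
  rw [← integral_exp_dot_gauss, ofReal_integral_eq_lintegral_ofReal (integrable_exp_dot_gauss a)]
  exact Filter.Eventually.of_forall fun _ => (Real.exp_pos _).le

lemma lintegral_exp_linear_gauss_le {d : ℕ} (ℓ : Vec d →L[ℝ] ℝ) {L : ℝ}
    (hL : ∀ y, |ℓ y| ≤ L * euc y) :
    ∫⁻ y, ENNReal.ofReal (Real.exp (ℓ y)) ∂gauss d ≤ ENNReal.ofReal (Real.exp (L ^ 2 / 2)) := by
  set a : Vec d := fun i => ℓ (Pi.single i 1) with ha
  have hℓ : ∀ y, ℓ y = a ⬝ᵥ y := fun y => by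
    conv_lhs => rw [show y = ∑ i, y i • (Pi.single i (1:ℝ) : Vec d) by
      ext j; simp [Finset.sum_apply, Pi.single_apply]]
    rw [map_sum, dotProduct]
    simp [ha, mul_comm]
  simp_rw [hℓ]
  rw [lintegral_exp_dot_gauss]
  apply ENNReal.ofReal_le_ofReal
  apply Real.exp_le_exp.2
  have h0 : 0 ≤ a ⬝ᵥ a := Finset.sum_nonneg fun i _ => mul_self_nonneg (a i)
  -- Testing the bound on the representing vector itself gives `|a|² ≤ L |a|`. If `a = 0`, the sign
  -- of `L` is irrelevant, since only `L²` enters.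
  have h1 := hL a
  rw [hℓ, abs_of_nonneg h0, euc] at h1
  have h2 := Real.sq_sqrt h0
  have h3 := Real.sqrt_nonneg (a ⬝ᵥ a)
  set r := Real.sqrt (a ⬝ᵥ a)
  rw [← h2] at h1 ⊢
  rcases h3.eq_or_lt with h | h
  · rw [← h]; have := sq_nonneg L; nlinarith
  · have : r ≤ L := by nlinarith
    nlinarith

/-- Gaussian concentration for odd functions with bounded gradient. -/
theorem lintegral_exp_le_of_odd {d : ℕ} {f : Vec d → ℝ} {L : ℝ} (hf : ContDiff ℝ 1 f)
    (hodd : ∀ v, f (-v) = -f v) (hL : ∀ v y, |fderiv ℝ f v y| ≤ L * euc y) :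
    ∫⁻ v, ENNReal.ofReal (Real.exp (f v)) ∂gauss d
      ≤ ENNReal.ofReal (Real.exp (Real.pi ^ 2 * L ^ 2 / 8)) := by
  have hcd : Continuous (fun p : Vec d × Vec d => fderiv ℝ f p.1 p.2) := by
    exact (hf.continuous_fderiv (by norm_num)).fst'.clm_apply continuous_snd
  obtain ⟨h, hh⟩ : ∃ h : ℝ → Vec d × Vec d → ℝ, ∀ θ p, h θ p =
    fderiv ℝ f (Real.cos θ • p.1 + Real.sin θ • p.2) (-Real.sin θ • p.1 + Real.cos θ • p.2) :=
    ⟨_, fun _ _ => rfl⟩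
  have hhc : Continuous fun p : ℝ × (Vec d × Vec d) => h p.1 p.2 := by
    simp only [hh]
    exact hcd.comp (f := fun p : ℝ × (Vec d × Vec d) => (Real.cos p.1 • p.2.1 + Real.sin p.1 • p.2.2,
      -Real.sin p.1 • p.2.1 + Real.cos p.1 • p.2.2)) (by fun_prop)
  have hhp : ∀ p, Continuous fun θ => h θ p := fun p => hhc.comp (Continuous.prodMk_left p)
  have hd : ∀ p θ, HasDerivAt (fun θ => f (Real.cos θ • p.1 + Real.sin θ • p.2)) (h θ p) θ := by
    intro p θ
    have h1 : HasDerivAt (fun θ : ℝ => Real.cos θ • p.1 + Real.sin θ • p.2)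
        (-Real.sin θ • p.1 + Real.cos θ • p.2) θ :=
      ((Real.hasDerivAt_cos θ).smul_const p.1).add ((Real.hasDerivAt_sin θ).smul_const p.2)
    have h2 : HasFDerivAt f (fderiv ℝ f (Real.cos θ • p.1 + Real.sin θ • p.2))
        (Real.cos θ • p.1 + Real.sin θ • p.2) :=
      (hf.differentiable (by norm_num) _).hasFDerivAt
    rw [hh]
    exact h2.comp_hasDerivAt θ h1
  -- The path `cos θ X + sin θ Y` goes from `X` to `-X` as `θ` runs over `[0, π]`. By oddness the
  -- increment of `f` is `-2 f(X)`, so no mean has to be subtracted.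
  have hint : ∀ p, ∫ θ in (0:ℝ)..Real.pi, h θ p = -2 * f p.1 := by
    intro p
    rw [intervalIntegral.integral_eq_sub_of_hasDerivAt (fun θ _ => hd p θ)
      ((hhp p).intervalIntegrable _ _)]
    simp [hodd]; ring
  -- `f(X)` is the average over `[0, π]` of `-(π/2) h θ`; Jensen's inequality moves the exponential
  -- inside the average.
  have hpt : ∀ p : Vec d × Vec d, Real.exp (f p.1) ≤
      (1 / Real.pi) * ∫ θ in Icc 0 Real.pi, Real.exp (-(Real.pi / 2) * h θ p) := by
    intro p
    have hc : Continuous fun θ : ℝ => -(Real.pi / 2) * h θ p :=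
      continuous_const.mul (hhp p)
    have := convexOn_exp.map_set_average_le (μ := volume) (t := Icc 0 Real.pi)
      (f := fun θ : ℝ => -(Real.pi / 2) * h θ p) Real.continuous_exp.continuousOn isClosed_univ
      (by simp [Real.pi_pos]) (by simp) (by simp)
      hc.continuousOn.integrableOn_Icc
      (Real.continuous_exp.comp hc).continuousOn.integrableOn_Icc
    rw [setAverage_eq, setAverage_eq, integral_Icc_eq_integral_Ioc,
      ← intervalIntegral.integral_of_le Real.pi_pos.le, intervalIntegral.integral_const_mul, hint]
      at this
    simp only [Measure.real, Real.volume_Icc, sub_zero, ENNReal.toReal_ofReal Real.pi_pos.le,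
      smul_eq_mul] at this
    have hpi := Real.pi_pos.ne'
    calc Real.exp (f p.1) = Real.exp (Real.pi⁻¹ * (-(Real.pi / 2) * (-2 * f p.1))) := by
          congr 1; field_simp
      _ ≤ _ := by simpa [one_div] using this
  -- The position and the velocity on the path are again independent standard Gaussians. With the
  -- position fixed, `h θ` is linear in the velocity, with slope at most `L`, so the exponent is `(π
  -- L / 2)² / 2`.
  have hk : ∀ θ, ∫⁻ p, ENNReal.ofReal (Real.exp (-(Real.pi / 2) * h θ p)) ∂((gauss d).prod (gauss d))
      ≤ ENNReal.ofReal (Real.exp (Real.pi ^ 2 * L ^ 2 / 8)) := by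
    intro θ
    have hm : Measurable fun p : Vec d × Vec d =>
        ENNReal.ofReal (Real.exp (-(Real.pi / 2) * fderiv ℝ f p.1 p.2)) :=
      (ENNReal.continuous_ofReal.comp (Real.continuous_exp.comp (continuous_const.mul hcd))).measurable
    have e1 : ∫⁻ p, ENNReal.ofReal (Real.exp (-(Real.pi / 2) * h θ p)) ∂((gauss d).prod (gauss d))
        = ∫⁻ p, ENNReal.ofReal (Real.exp (-(Real.pi / 2) * fderiv ℝ f p.1 p.2))
          ∂((gauss d).prod (gauss d)) := by
      conv_rhs => rw [← gauss_rotation d θ]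
      rw [lintegral_map hm (by fun_prop)]
      simp only [hh, ContinuousLinearMap.rotation_apply]
    rw [e1, lintegral_prod _ hm.aemeasurable]
    calc _ ≤ ∫⁻ x, ENNReal.ofReal (Real.exp (Real.pi ^ 2 * L ^ 2 / 8)) ∂gauss d := by
          apply lintegral_mono
          intro x
          have := lintegral_exp_linear_gauss_le ((-(Real.pi / 2)) • fderiv ℝ f x)
            (L := Real.pi / 2 * L) (fun y => by
              simp only [smul_apply, smul_eq_mul, abs_mul, abs_neg,
                abs_of_pos (half_pos Real.pi_pos), mul_assoc]
              exact mul_le_mul_of_nonneg_left (hL x y) (half_pos Real.pi_pos).le)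
          refine this.trans_eq ?_
          congr 2; ring
      _ = _ := by simp
  calc ∫⁻ v, ENNReal.ofReal (Real.exp (f v)) ∂gauss d
      = ∫⁻ p : Vec d × Vec d, ENNReal.ofReal (Real.exp (f p.1)) ∂((gauss d).prod (gauss d)) := by
        rw [lintegral_prod _ (by
          exact (ENNReal.continuous_ofReal.comp (Real.continuous_exp.comp
            (hf.continuous.comp continuous_fst))).measurable.aemeasurable)]
        simp
    _ ≤ ∫⁻ p : Vec d × Vec d, (ENNReal.ofReal (1 / Real.pi) * ∫⁻ θ in Icc 0 Real.pi,
          ENNReal.ofReal (Real.exp (-(Real.pi / 2) * h θ p))) ∂((gauss d).prod (gauss d)) := by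
        apply lintegral_mono
        intro p
        have hc : Continuous fun θ : ℝ => Real.exp (-(Real.pi / 2) * h θ p) :=
          Real.continuous_exp.comp (continuous_const.mul
            (hhp p))
        beta_reduce
        rw [← ofReal_integral_eq_lintegral_ofReal hc.continuousOn.integrableOn_Icc
          (Filter.Eventually.of_forall fun _ => (Real.exp_pos _).le),
          ← ENNReal.ofReal_mul (by positivity)]
        exact ENNReal.ofReal_le_ofReal (hpt p)
    _ = ENNReal.ofReal (1 / Real.pi) * ∫⁻ θ in Icc 0 Real.pi, ∫⁻ p : Vec d × Vec d,
          ENNReal.ofReal (Real.exp (-(Real.pi / 2) * h θ p)) ∂((gauss d).prod (gauss d)) := by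
        have hm : Measurable fun q : (Vec d × Vec d) × ℝ =>
            ENNReal.ofReal (Real.exp (-(Real.pi / 2) * h q.2 q.1)) :=
          (ENNReal.continuous_ofReal.comp (Real.continuous_exp.comp (continuous_const.mul
            (hhc.comp continuous_swap)))).measurable
        rw [lintegral_const_mul _ (Measurable.lintegral_prod_right hm),
          lintegral_lintegral_swap hm.aemeasurable]
    _ ≤ ENNReal.ofReal (1 / Real.pi) * ∫⁻ θ in Icc 0 Real.pi,
          ENNReal.ofReal (Real.exp (Real.pi ^ 2 * L ^ 2 / 8)) := by
        gcongr with θ; exact hk θ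
    _ = _ := by
        rw [setLIntegral_const, Real.volume_Icc, sub_zero, mul_comm, mul_assoc,
          ← ENNReal.ofReal_mul Real.pi_pos.le, mul_one_div_cancel Real.pi_pos.ne']
        simp

/-- Integration against Lebesgue measure with a Gaussian weight. -/
lemma volume_withDensity_gauss (d : ℕ) :
    gauss d = (volume : Measure (Vec d)).withDensity fun v =>
      ENNReal.ofReal (((2 * Real.pi) ^ ((d:ℝ) / 2))⁻¹ * Real.exp (-(v ⬝ᵥ v) / 2)) := by
  have key : ∀ v : Vec d, ((2 * Real.pi) ^ ((d:ℝ) / 2))⁻¹ * Real.exp (-(v ⬝ᵥ v) / 2)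
      = ∏ i, gaussianPDFReal 0 1 (v i) := by
    intro v
    simp only [gaussianPDFReal_def]
    rw [Finset.prod_mul_distrib, ← Real.exp_sum]
    congr 1
    · have := Real.pi_pos
      simp only [NNReal.coe_one, mul_one, Finset.prod_const, Finset.card_univ, Fintype.card_fin]
      rw [inv_pow, Real.sqrt_eq_rpow, ← Real.rpow_natCast, ← Real.rpow_mul (by positivity)]
      congr 2; ring
    · rw [dotProduct, neg_div, Finset.sum_div, ← Finset.sum_neg_distrib]
      congr 1; refine Finset.sum_congr rfl fun i _ => ?_
      simp; ring
  rw [gauss]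
  symm
  refine (Measure.pi_eq (μ := fun _ : Fin d => gaussianReal 0 1) fun s hs => ?_).symm
  rw [withDensity_apply _ (MeasurableSet.univ_pi hs), ← lintegral_indicator (MeasurableSet.univ_pi hs)]
  have hi : ∀ i, Integrable ((s i).indicator (gaussianPDFReal 0 1)) := fun i =>
    (integrable_gaussianPDFReal 0 1).indicator (hs i)
  have h1 : ∀ v : Vec d, (univ.pi s).indicator (fun v => ENNReal.ofReal
      (((2 * Real.pi) ^ ((d:ℝ) / 2))⁻¹ * Real.exp (-(v ⬝ᵥ v) / 2))) v
      = ENNReal.ofReal (∏ i, (s i).indicator (gaussianPDFReal 0 1) (v i)) := by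
    intro v
    by_cases hv : v ∈ univ.pi s
    · rw [indicator_of_mem hv, key]
      congr 1; refine Finset.prod_congr rfl fun i _ => ?_
      rw [indicator_of_mem (hv i (mem_univ i))]
    · rw [indicator_of_notMem hv]
      simp only [mem_pi, mem_univ, true_imp_iff, not_forall] at hv
      obtain ⟨i, hi⟩ := hv
      rw [Finset.prod_eq_zero (Finset.mem_univ i) (indicator_of_notMem hi _)]; simp
  have hnn : ∀ i x, 0 ≤ (s i).indicator (gaussianPDFReal 0 1) x := fun i x =>
    indicator_nonneg (fun _ _ => gaussianPDFReal_nonneg _ _ _) _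
  simp_rw [h1]
  rw [← ofReal_integral_eq_lintegral_ofReal (by exact Integrable.fintype_prod hi)
    (Filter.Eventually.of_forall fun v => Finset.prod_nonneg fun i _ => hnn i _),
    integral_fintype_prod_volume_eq_prod (𝕜 := ℝ), ENNReal.ofReal_prod_of_nonneg
      (fun i _ => integral_nonneg (hnn i))]
  refine Finset.prod_congr rfl fun i _ => ?_
  rw [gaussianReal_apply_eq_integral 0 one_ne_zero, integral_indicator (hs i)]

/-- The density is positive and finite, so the identity needs no integrability of `F`. -/
lemma integral_gauss {d : ℕ} (F : Vec d → ℝ) :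
    ∫ v, F v * Real.exp (-(v ⬝ᵥ v) / 2) = (2 * Real.pi) ^ ((d:ℝ) / 2) * ∫ v, F v ∂gauss d := by
  have hp : 0 < (2 * Real.pi) ^ ((d:ℝ) / 2) := by have := Real.pi_pos; positivity
  rw [volume_withDensity_gauss, integral_withDensity_eq_integral_toReal_smul
    (by unfold dotProduct; fun_prop) (Filter.Eventually.of_forall fun _ => ENNReal.ofReal_lt_top),
    ← integral_const_mul]
  congr 1; ext v
  rw [ENNReal.toReal_ofReal (by positivity), smul_eq_mul]
  field_simp

end BoundaryLaplace

/-! ### Cubic forms: a Lipschitz damping and exponential moments. -/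

namespace BoundaryLaplace

lemma dotProduct_self_nonneg' {d : ℕ} (v : Vec d) : 0 ≤ v ⬝ᵥ v :=
  Finset.sum_nonneg fun i _ => mul_self_nonneg (v i)

lemma euc_nonneg {d : ℕ} (v : Vec d) : 0 ≤ euc v := Real.sqrt_nonneg _

lemma euc_sq {d : ℕ} (v : Vec d) : euc v ^ 2 = v ⬝ᵥ v := Real.sq_sqrt (dotProduct_self_nonneg' v)

lemma abs_dot_le {d : ℕ} (u v : Vec d) : |u ⬝ᵥ v| ≤ euc u * euc v := by
  rw [euc, euc, ← Real.sqrt_mul (dotProduct_self_nonneg' u)]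
  apply Real.abs_le_sqrt
  have := Finset.sum_mul_sq_le_sq_mul_sq Finset.univ u v
  simpa [dotProduct, sq] using this

lemma continuous_dot_self (d : ℕ) : Continuous fun v : Vec d => v ⬝ᵥ v := by
  unfold dotProduct; fun_prop

lemma hasDerivAt_dot_self_line {d : ℕ} (v y : Vec d) :
    HasDerivAt (fun t : ℝ => (v + t • y) ⬝ᵥ (v + t • y)) (2 * (v ⬝ᵥ y)) 0 := by
  have h : (fun t : ℝ => (v + t • y) ⬝ᵥ (v + t • y))
      = fun t => v ⬝ᵥ v + t * (2 * (v ⬝ᵥ y)) + t ^ 2 * (y ⬝ᵥ y) := by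
    ext t
    simp only [add_dotProduct, dotProduct_add, smul_dotProduct, dotProduct_smul, smul_eq_mul]
    rw [dotProduct_comm y v]; ring
  rw [h]
  have := ((hasDerivAt_id (0:ℝ)).mul_const (2 * (v ⬝ᵥ y))).const_add (v ⬝ᵥ v) |>.add
    (((hasDerivAt_id (0:ℝ)).pow 2).mul_const (y ⬝ᵥ y))
  refine this.congr_deriv ?_
  simp

section Cubic

variable {d : ℕ} (T : ContinuousMultilinearMap ℝ (fun _ : Fin 3 => Vec d) ℝ)

lemma hasDerivAt_cubic_line (v y : Vec d) :
    HasDerivAt (fun t : ℝ => T fun _ => v + t • y)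
      (∑ i, T (Function.update (fun _ => v) i y)) 0 := by
  have h1 : HasDerivAt (fun t : ℝ => (fun _ : Fin 3 => v + t • y)) (fun _ => y) 0 := by
    rw [hasDerivAt_pi]
    intro _
    simpa using ((hasDerivAt_id (0:ℝ)).smul_const y).const_add v
  have h2 : HasDerivAt (fun t : ℝ => T fun _ => v + t • y) _ 0 :=
    (T.hasFDerivAt (fun _ => v + (0:ℝ) • y)).comp_hasDerivAt 0 h1
  refine h2.congr_deriv ?_
  simp [ContinuousMultilinearMap.linearDeriv_apply]

lemma abs_deriv_cubic_le {τ : ℝ} (hT : ∀ u, |T u| ≤ τ * ∏ i, euc (u i)) (v y : Vec d) :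
    |∑ i, T (Function.update (fun _ => v) i y)| ≤ 3 * τ * euc v ^ 2 * euc y := by
  refine (Finset.abs_sum_le_sum_abs _ _).trans ?_
  have : ∀ i, |T (Function.update (fun _ => v) i y)| ≤ τ * euc v ^ 2 * euc y := by
    intro i
    refine (hT _).trans_eq ?_
    fin_cases i <;> simp [Fin.prod_univ_three, Function.update] <;> ring
  refine (Finset.sum_le_sum fun i _ => this i).trans_eq ?_
  simp; ring

/-- A globally Lipschitz odd function which dominates a cubic form on a ball. -/
noncomputable def dampedCubic (m : ℝ) (v : Vec d) : ℝ :=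
  4 * (T fun _ => v) / (1 + v ⬝ᵥ v / m) ^ 2

variable {T}

lemma contDiff_dampedCubic {m : ℝ} (hm : 0 < m) : ContDiff ℝ 1 (dampedCubic T m) := by
  unfold dampedCubic
  have h1 : ContDiff ℝ 1 fun v : Vec d => T fun _ => v :=
    T.contDiff.comp (contDiff_pi.2 fun _ => contDiff_id)
  have h2 : ContDiff ℝ 1 fun v : Vec d => v ⬝ᵥ v := by unfold dotProduct; fun_prop
  refine ContDiff.div (contDiff_const.mul h1) (by fun_prop) fun v => ?_
  have := dotProduct_self_nonneg' v
  positivity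

lemma dampedCubic_neg (m : ℝ) (v : Vec d) : dampedCubic T m (-v) = -dampedCubic T m v := by
  have : (T fun _ => -v) = - T fun _ => v := by
    have := T.map_smul_univ (fun _ => (-1 : ℝ)) (fun _ => v)
    simpa [show ((-1 : ℝ)) ^ 3 = -1 by norm_num] using this
  simp [dampedCubic, this, neg_div]

/-- With `q = 1 + |v|²/m` one has `|v|² ≤ m q`, so the powers of `|v|` in the quotient rule are
absorbed by the denominator. The numerator's derivative contributes `4 · 3` and the denominator's
`16`, in total `28`. -/
lemma abs_fderiv_dampedCubic_le {m τ : ℝ} (hm : 0 < m)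
    (hT : ∀ u, |T u| ≤ τ * ∏ i, euc (u i)) (hτ : 0 ≤ τ) (v y : Vec d) :
    |fderiv ℝ (dampedCubic T m) v y| ≤ 28 * τ * m * euc y := by
  have hdiff : DifferentiableAt ℝ (dampedCubic T m) v :=
    (contDiff_dampedCubic hm).differentiable (by norm_num) v
  have h1 := hdiff.hasFDerivAt.hasLineDerivAt y
  set q := 1 + v ⬝ᵥ v / m with hq
  have hvv := dotProduct_self_nonneg' v
  have hq1 : 1 ≤ q := by rw [hq]; have : 0 ≤ v ⬝ᵥ v / m := by positivity
                         linarith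
  have hq0 : 0 < q := by linarith
  set P := T fun _ => v
  set P' := ∑ i, T (Function.update (fun _ => v) i y)
  have h2 : HasDerivAt (fun t : ℝ => dampedCubic T m (v + t • y))
      ((4 * P' * q ^ 2 - 4 * P * (2 * q * (2 * (v ⬝ᵥ y) / m))) / (q ^ 2) ^ 2) 0 := by
    have ha := (hasDerivAt_cubic_line T v y).const_mul 4
    have hb := (((hasDerivAt_dot_self_line v y).div_const m).const_add 1).pow 2
    have := ha.div hb (by simp [← hq]; positivity)
    refine this.congr_deriv ?_
    simp [← hq, P, P']
  have h3 : fderiv ℝ (dampedCubic T m) v y = _ := h1.unique h2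
  rw [h3]
  have e : (4 * P' * q ^ 2 - 4 * P * (2 * q * (2 * (v ⬝ᵥ y) / m))) / (q ^ 2) ^ 2
      = 4 * (P' / q ^ 2) - 16 * (P * (v ⬝ᵥ y) / (m * q ^ 3)) := by field_simp; ring
  have hP : |P| ≤ τ * euc v ^ 3 := (hT _).trans_eq (by simp)
  have hP' := abs_deriv_cubic_le T hT v y
  have hvy := abs_dot_le v y
  have hv0 := euc_nonneg v
  have hy0 := euc_nonneg y
  have hv2 : euc v ^ 2 ≤ m * q := by
    rw [euc_sq, hq]; field_simp; linarith
  have b1 : |P' / q ^ 2| ≤ 3 * τ * m * euc y := by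
    rw [abs_div, abs_of_pos (pow_pos hq0 2), div_le_iff₀ (by positivity)]
    calc |P'| ≤ 3 * τ * euc v ^ 2 * euc y := hP'
      _ ≤ 3 * τ * (m * q) * euc y := by gcongr
      _ = 3 * τ * m * euc y * q := by ring
      _ ≤ 3 * τ * m * euc y * q ^ 2 := by
        gcongr; nlinarith
  have b2 : |P * (v ⬝ᵥ y) / (m * q ^ 3)| ≤ τ * m * euc y := by
    rw [abs_div, abs_mul, abs_of_pos (mul_pos hm (pow_pos hq0 3)), div_le_iff₀ (by positivity)]
    calc |P| * |v ⬝ᵥ y| ≤ (τ * euc v ^ 3) * (euc v * euc y) := by gcongr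
      _ = τ * (euc v ^ 2) ^ 2 * euc y := by ring
      _ ≤ τ * (m * q) ^ 2 * euc y := by gcongr
      _ = τ * m * euc y * (m * q ^ 2) := by ring
      _ ≤ τ * m * euc y * (m * q ^ 3) := by
        gcongr
        · norm_num
  rw [e]
  calc _ ≤ |4 * (P' / q ^ 2)| + |16 * (P * (v ⬝ᵥ y) / (m * q ^ 3))| := abs_sub _ _
    _ = 4 * |P' / q ^ 2| + 16 * |P * (v ⬝ᵥ y) / (m * q ^ 3)| := by
      rw [abs_mul, abs_mul]; norm_num
    _ ≤ 4 * (3 * τ * m * euc y) + 16 * (τ * m * euc y) := by gcongr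
    _ = _ := by ring

/-- On the ball the damping factor `(1 + |v|²/m)²` is at most `4`, which is the prefactor in
`dampedCubic`. -/
lemma abs_cubic_le_dampedCubic {m : ℝ} (hm : 0 < m) {v : Vec d} (hv : v ⬝ᵥ v ≤ m) :
    |T fun _ => v| ≤ |dampedCubic T m v| := by
  have hvv := dotProduct_self_nonneg' v
  have h0 : 0 ≤ v ⬝ᵥ v / m := by positivity
  have h1 : v ⬝ᵥ v / m ≤ 1 := (div_le_one hm).2 hv
  rw [dampedCubic, abs_div, abs_mul, abs_of_pos (by positivity : 0 < (1 + v ⬝ᵥ v / m) ^ 2),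
    le_div_iff₀ (by positivity), mul_comm]
  norm_num
  apply mul_le_mul_of_nonneg_right _ (abs_nonneg _)
  nlinarith

end Cubic

/-- Exponential second moment of an odd function with bounded gradient. -/
lemma lintegral_sq_mul_exp_le_of_odd {d : ℕ} {f : Vec d → ℝ} {L : ℝ} (hL0 : 0 < L)
    (hf : ContDiff ℝ 1 f) (hodd : ∀ v, f (-v) = -f v)
    (hL : ∀ v y, |fderiv ℝ f v y| ≤ L * euc y) :
    ∫⁻ v, ENNReal.ofReal (f v ^ 2 * Real.exp (2 * |f v|)) ∂gauss d
      ≤ ENNReal.ofReal (4 * L ^ 2 * Real.exp (Real.pi ^ 2 * (2 * L + 1) ^ 2 / 8)) := by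
  -- With `s = |f|/L` the integrand is `L² s² e^{2Ls}`, and `s² ≤ 2 e^s` costs one extra unit in the
  -- exponent: `a |f| = (2L + 1) s`. Then `a f` has gradient bound exactly `2L + 1`.
  set a := (2 * L + 1) / L with ha
  have ha0 : 0 < a := by positivity
  have key : ∀ σ : ℝ, |σ| = 1 → ∫⁻ v, ENNReal.ofReal (Real.exp (σ * a * f v)) ∂gauss d
      ≤ ENNReal.ofReal (Real.exp (Real.pi ^ 2 * (2 * L + 1) ^ 2 / 8)) := by
    intro σ hσ
    refine lintegral_exp_le_of_odd (contDiff_const.mul hf) (fun v => by rw [hodd]; ring) ?_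
    intro v y
    have : fderiv ℝ (fun v => σ * a * f v) v = (σ * a) • fderiv ℝ f v :=
      fderiv_const_mul (hf.differentiable (by norm_num) v) _
    rw [this, smul_apply, smul_eq_mul, abs_mul, abs_mul, hσ, one_mul, abs_of_pos ha0]
    calc a * |fderiv ℝ f v y| ≤ a * (L * euc y) := by gcongr; exact hL v y
      _ = _ := by rw [ha]; field_simp
  have pt : ∀ v, f v ^ 2 * Real.exp (2 * |f v|)
      ≤ 2 * L ^ 2 * (Real.exp (1 * a * f v) + Real.exp (-1 * a * f v)) := by
    intro v
    set s := |f v| / L with hs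
    have hs0 : 0 ≤ s := by positivity
    have e1 : |f v| = L * s := by rw [hs]; field_simp
    have e2 : a * |f v| = s + 2 * (L * s) := by rw [e1, ha]; field_simp; ring
    have e3 : Real.exp (a * |f v|) ≤ Real.exp (1 * a * f v) + Real.exp (-1 * a * f v) := by
      rcases abs_cases (f v) with ⟨h, _⟩ | ⟨h, _⟩ <;> rw [h]
      · have := Real.exp_pos (-1 * a * f v); rw [one_mul]; linarith
      · have := Real.exp_pos (1 * a * f v)
        rw [show a * -f v = -1 * a * f v by ring]; linarith
    have e4 := Real.quadratic_le_exp_of_nonneg hs0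
    calc f v ^ 2 * Real.exp (2 * |f v|) = L ^ 2 * (s ^ 2 * Real.exp (2 * (L * s))) := by
          rw [← sq_abs, e1]; ring
      _ ≤ L ^ 2 * (2 * Real.exp s * Real.exp (2 * (L * s))) := by
          gcongr; nlinarith
      _ = 2 * L ^ 2 * Real.exp (a * |f v|) := by rw [e2, Real.exp_add]; ring
      _ ≤ _ := by gcongr
  have hm : ∀ σ : ℝ, Measurable fun v => ENNReal.ofReal (Real.exp (σ * a * f v)) := fun σ =>
    (ENNReal.continuous_ofReal.comp (Real.continuous_exp.comp
      (continuous_const.mul hf.continuous))).measurable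
  calc _ ≤ ∫⁻ v, ENNReal.ofReal (2 * L ^ 2) * (ENNReal.ofReal (Real.exp (1 * a * f v))
          + ENNReal.ofReal (Real.exp (-1 * a * f v))) ∂gauss d := by
        apply lintegral_mono
        intro v
        beta_reduce
        rw [← ENNReal.ofReal_add (Real.exp_pos _).le (Real.exp_pos _).le,
          ← ENNReal.ofReal_mul (by positivity)]
        exact ENNReal.ofReal_le_ofReal (pt v)
    _ = ENNReal.ofReal (2 * L ^ 2) * (∫⁻ v, ENNReal.ofReal (Real.exp (1 * a * f v)) ∂gauss d
          + ∫⁻ v, ENNReal.ofReal (Real.exp (-1 * a * f v)) ∂gauss d) := by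
        rw [lintegral_const_mul _ (by exact (hm 1).add (hm (-1))), lintegral_add_left (hm 1)]
    _ ≤ ENNReal.ofReal (2 * L ^ 2) * (ENNReal.ofReal (Real.exp (Real.pi ^ 2 * (2 * L + 1) ^ 2 / 8))
          + ENNReal.ofReal (Real.exp (Real.pi ^ 2 * (2 * L + 1) ^ 2 / 8))) := by
        gcongr
        · exact key 1 (by simp)
        · exact key (-1) (by simp)
    _ = _ := by
        rw [← ENNReal.ofReal_add (Real.exp_pos _).le (Real.exp_pos _).le,
          ← ENNReal.ofReal_mul (by positivity)]
        congr 1; ring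

/-- The closed Euclidean ball of squared radius `m`. -/
def eball (d : ℕ) (m : ℝ) : Set (Vec d) := {v | v ⬝ᵥ v ≤ m}

lemma isClosed_eball (d : ℕ) (m : ℝ) : IsClosed (eball d m) :=
  isClosed_le (continuous_dot_self d) continuous_const

lemma isCompact_eball (d : ℕ) (m : ℝ) : IsCompact (eball d m) := by
  refine Metric.isCompact_of_isClosed_isBounded (isClosed_eball d m) ?_
  refine (Metric.isBounded_iff_subset_closedBall 0).2 ⟨Real.sqrt m, fun v hv => ?_⟩
  rw [mem_closedBall_zero_iff, pi_norm_le_iff_of_nonneg (Real.sqrt_nonneg _)]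
  intro i
  apply Real.abs_le_sqrt
  refine le_trans ?_ (hv : v ⬝ᵥ v ≤ m)
  rw [sq]
  exact Finset.single_le_sum (f := fun i => v i * v i) (fun i _ => mul_self_nonneg (v i))
    (Finset.mem_univ i)

/-- The damped form dominates `T` on the ball and has gradient at most `28 τ m` everywhere, so the
bound involves `τ m` and not the maximum `τ m^{3/2}`. This gain of `√m` makes the final error of
order `d²/λ`. The degenerate case `τ = 0` is separate because the moment bound divides by the
Lipschitz constant. -/
lemma setIntegral_cubic_le {d : ℕ} {T : ContinuousMultilinearMap ℝ (fun _ : Fin 3 => Vec d) ℝ}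
    {m τ : ℝ} (hm : 0 < m) (hT : ∀ u, |T u| ≤ τ * ∏ i, euc (u i)) (hτ : 0 ≤ τ) :
    ∫ v in eball d m, (T fun _ => v) ^ 2 * Real.exp (2 * |T fun _ => v|) ∂gauss d
      ≤ 4 * (28 * τ * m) ^ 2 * Real.exp (Real.pi ^ 2 * (2 * (28 * τ * m) + 1) ^ 2 / 8) := by
  rcases hτ.eq_or_lt with h | h
  · have h0 : ∀ u, T u = 0 := fun u => by
      have := hT u
      rw [← h, zero_mul] at this
      exact abs_nonpos_iff.1 this
    simp [h0, ← h]
  · have h1 := lintegral_sq_mul_exp_le_of_odd (L := 28 * τ * m) (by positivity)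
      (contDiff_dampedCubic (T := T) hm) (dampedCubic_neg m) (abs_fderiv_dampedCubic_le hm hT hτ)
    rw [integral_eq_lintegral_of_nonneg_ae (Filter.Eventually.of_forall fun v => by positivity)]
    · refine ENNReal.toReal_le_of_le_ofReal (by positivity) (le_trans ?_ h1)
      refine le_trans ?_ (setLIntegral_le_lintegral (eball d m) _)
      refine setLIntegral_mono' (isClosed_eball d m).measurableSet fun v hv => ?_
      apply ENNReal.ofReal_le_ofReal
      have h2 := abs_cubic_le_dampedCubic (T := T) hm hv
      have h3 := abs_nonneg (T fun _ => v)
      rw [← sq_abs, ← sq_abs (dampedCubic T m v)]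
      gcongr
    · have h1 : Continuous fun v : Vec d => T fun _ => v :=
        T.cont.comp (continuous_pi fun _ => continuous_id)
      exact (by fun_prop : Continuous fun v : Vec d =>
        (T fun _ => v) ^ 2 * Real.exp (2 * |T fun _ => v|)).aestronglyMeasurable

end BoundaryLaplace

/-! ### Second-order expansion of a Gaussian integral over a ball. -/

namespace BoundaryLaplace

/-- The ball and the Gaussian weight are invariant under `v ↦ -v`. The substitution is valid for
every function, so integrability is not needed. -/
lemma setIntegral_odd_gauss {d : ℕ} {F : Vec d → ℝ} (m : ℝ) (hF : ∀ v, F (-v) = -F v) :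
    ∫ v in eball d m, F v ∂gauss d = 0 := by
  have hp : 0 < (2 * Real.pi) ^ ((d:ℝ) / 2) := by have := Real.pi_pos; positivity
  rw [← integral_indicator (isClosed_eball d m).measurableSet]
  have h1 := integral_gauss ((eball d m).indicator F)
  have h2 : ∀ v, (eball d m).indicator F (-v) = -(eball d m).indicator F v := by
    intro v
    by_cases hv : v ∈ eball d m
    · rw [indicator_of_mem hv, indicator_of_mem (by simpa [eball] using hv), hF]
    · rw [indicator_of_notMem hv, indicator_of_notMem (by simpa [eball] using hv), neg_zero]
  have h3 := integral_neg_eq_self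
    (fun v : Vec d => (eball d m).indicator F v * Real.exp (-(v ⬝ᵥ v) / 2)) volume
  have h4 : (∫ v : Vec d, (eball d m).indicator F v * Real.exp (-(v ⬝ᵥ v) / 2)) = 0 := by
    simp only [h2, neg_dotProduct_neg, neg_mul, integral_neg] at h3
    linarith
  rw [h4] at h1
  exact (mul_eq_zero.1 h1.symm).resolve_left hp.ne'

lemma abs_exp_sub_one_sub_id_le (x : ℝ) : |Real.exp x - 1 - x| ≤ x ^ 2 / 2 * Real.exp |x| := by
  rcases le_total 0 x with hx | hx
  · rw [abs_of_nonneg hx, abs_of_nonneg (by linarith [Real.add_one_le_exp x])]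
    have hmono : MonotoneOn (fun x => x ^ 2 / 2 * Real.exp x - (Real.exp x - 1 - x)) (Ici 0) := by
      apply monotoneOn_of_deriv_nonneg (convex_Ici 0) (by fun_prop) (by fun_prop)
      intro t ht
      rw [interior_Ici] at ht
      have ht0 : 0 < t := ht
      have hd : HasDerivAt (fun x => x ^ 2 / 2 * Real.exp x - (Real.exp x - 1 - x))
          ((2 * t / 2) * Real.exp t + t ^ 2 / 2 * Real.exp t - (Real.exp t - 1)) t := by
        have h1 := (((hasDerivAt_id t).pow 2).div_const 2).mul (Real.hasDerivAt_exp t)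
        have h2 := ((Real.hasDerivAt_exp t).sub_const 1).sub (hasDerivAt_id t)
        refine (h1.sub h2).congr_deriv ?_
        simp
      rw [hd.deriv]
      have h5 : (1 - t) * Real.exp t ≤ 1 := by
        have := Real.add_one_le_exp (-t)
        calc (1 - t) * Real.exp t ≤ Real.exp (-t) * Real.exp t := by gcongr; linarith
          _ = 1 := by rw [← Real.exp_add]; simp
      have := Real.exp_pos t
      nlinarith [mul_pos (mul_pos ht0 ht0) this]
    have := hmono (by simp : (0:ℝ) ∈ Ici 0) hx hx
    simp at this
    linarith
  · rw [abs_of_nonneg (by linarith [Real.add_one_le_exp x])]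
    have h1 : Real.exp x - 1 - x ≤ x ^ 2 / 2 := by
      have hmono : MonotoneOn (fun x => Real.exp x - 1 - x - x ^ 2 / 2) (Iic 0) := by
        apply monotoneOn_of_deriv_nonneg (convex_Iic 0) (by fun_prop) (by fun_prop)
        intro t ht
        have hd : HasDerivAt (fun x => Real.exp x - 1 - x - x ^ 2 / 2)
            (Real.exp t - 1 - (2 * t / 2)) t := by
          have h2 := ((Real.hasDerivAt_exp t).sub_const 1).sub (hasDerivAt_id t)
          refine (h2.sub (((hasDerivAt_id t).pow 2).div_const 2)).congr_deriv ?_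
          simp
        rw [hd.deriv]
        linarith [Real.add_one_le_exp t]
      have := hmono hx (by simp : (0:ℝ) ∈ Iic 0) hx
      simp at this
      linarith
    have h2 : 1 ≤ Real.exp |x| := Real.one_le_exp (abs_nonneg x)
    nlinarith [sq_nonneg x]

lemma abs_exp_sub_one_le (x : ℝ) : |Real.exp x - 1| ≤ |x| * Real.exp |x| := by
  have h : ∀ t : ℝ, Real.exp t - 1 ≤ t * Real.exp t := fun t => by
    have := Real.add_one_le_exp (-t)
    have h2 : (1 - t) * Real.exp t ≤ 1 := by
      calc (1 - t) * Real.exp t ≤ Real.exp (-t) * Real.exp t := by gcongr; linarith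
        _ = 1 := by rw [← Real.exp_add]; simp
    linarith
  rcases le_total 0 x with hx | hx
  · rw [abs_of_nonneg hx, abs_of_nonneg (by linarith [Real.add_one_le_exp x])]
    exact h x
  · have h1 : Real.exp x ≤ 1 := Real.exp_le_one_iff.2 hx
    rw [abs_of_nonpos (by linarith), abs_of_nonpos hx]
    have h2 : 1 ≤ Real.exp (-x) := Real.one_le_exp (by linarith)
    have := Real.add_one_le_exp x
    nlinarith

/-- Pointwise expansion of `e^{-V} q` around `1 - T - ℓ`. -/
lemma abs_exp_neg_mul_sub_le {V T q ℓ κ β η : ℝ} (hV : |V - T| ≤ κ) (hq : |q - 1 + ℓ| ≤ η)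
    (hℓ : |ℓ| ≤ β) :
    |Real.exp (-V) * q - 1 + T + ℓ|
      ≤ 2 * η + κ + β ^ 2 + (1 + η) * (V ^ 2 * Real.exp (2 * |V|)) := by
  set W := V ^ 2 * Real.exp (2 * |V|) with hW
  have hη : 0 ≤ η := (abs_nonneg _).trans hq
  have hexp : Real.exp |V| ≤ Real.exp (2 * |V|) := Real.exp_le_exp.2 (by linarith [abs_nonneg V])
  have h1 : |Real.exp (-V) - 1 + V| ≤ W / 2 := by
    have := abs_exp_sub_one_sub_id_le (-V)
    rw [abs_neg, neg_sq, sub_neg_eq_add] at this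
    calc _ ≤ _ := this
      _ ≤ V ^ 2 / 2 * Real.exp (2 * |V|) := by gcongr
      _ = _ := by rw [hW]; ring
  have h2 : (Real.exp (-V) - 1) ^ 2 ≤ W := by
    have := abs_exp_sub_one_le (-V)
    rw [abs_neg] at this
    calc (Real.exp (-V) - 1) ^ 2 = |Real.exp (-V) - 1| ^ 2 := (sq_abs _).symm
      _ ≤ (|V| * Real.exp |V|) ^ 2 := by gcongr
      _ = W := by rw [mul_pow, sq_abs, hW, ← Real.exp_nat_mul]; norm_num
  -- For real `t` one has `t ≤ 2 + (t - 1)²`, so `e^{-V}` itself is controlled by the same quantity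
  -- `W`.
  have h3 : |Real.exp (-V)| ≤ 2 + W := by
    rw [abs_of_pos (Real.exp_pos _)]
    nlinarith [sq_nonneg (Real.exp (-V) - 1 - 1), sq_nonneg (Real.exp (-V) - 1)]
  have h4 : |(Real.exp (-V) - 1) * ℓ| ≤ W / 2 + β ^ 2 := by
    have h5 : ℓ ^ 2 ≤ β ^ 2 := by rw [← sq_abs]; gcongr
    rw [abs_le]
    constructor <;> nlinarith [sq_nonneg (Real.exp (-V) - 1 - ℓ), sq_nonneg (Real.exp (-V) - 1 + ℓ), sq_nonneg ℓ]
  have h6 : |Real.exp (-V) * (q - 1 + ℓ)| ≤ (2 + W) * η := by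
    rw [abs_mul]; gcongr
  -- Four errors: that of `q`, the second-order remainder of the exponential, the non-cubic part of
  -- the phase, and the cross term. The cross term is split by `2|xy| ≤ x² + y²`.
  have e : Real.exp (-V) * q - 1 + T + ℓ = Real.exp (-V) * (q - 1 + ℓ)
      + (Real.exp (-V) - 1 + V) - (V - T) - (Real.exp (-V) - 1) * ℓ := by ring
  rw [e]
  rw [abs_le] at *
  constructor <;> nlinarith

/-- Reduces the error to `T² e^{2|T|}`, for which the moment bound is available. The term `κ²
e^{2|T|}` lacks the factor `T²`; it is split at `|T| = 1`, where `e² ≤ 8`. -/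
lemma sq_mul_exp_le {V T κ : ℝ} (hV : |V - T| ≤ κ) :
    V ^ 2 * Real.exp (2 * |V|) ≤ 2 * Real.exp (2 * κ) *
      ((1 + κ ^ 2) * (T ^ 2 * Real.exp (2 * |T|)) + 8 * κ ^ 2) := by
  have hκ : 0 ≤ κ := (abs_nonneg _).trans hV
  have h1 : |V| ≤ |T| + κ := by
    calc |V| = |T + (V - T)| := by ring_nf
      _ ≤ _ := (abs_add_le _ _).trans (by gcongr)
  have h2 : V ^ 2 ≤ 2 * T ^ 2 + 2 * κ ^ 2 := by
    have : V ^ 2 ≤ (|T| + κ) ^ 2 := by rw [← sq_abs]; gcongr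
    nlinarith [sq_nonneg (|T| - κ), sq_abs T]
  have h3 : Real.exp (2 * |V|) ≤ Real.exp (2 * κ) * Real.exp (2 * |T|) := by
    rw [← Real.exp_add]; apply Real.exp_le_exp.2; linarith
  have h4 : Real.exp (2 * |T|) ≤ 8 + T ^ 2 * Real.exp (2 * |T|) := by
    rcases le_total |T| 1 with h | h
    · have : Real.exp (2 * |T|) ≤ Real.exp 2 := Real.exp_le_exp.2 (by linarith)
      have h5 : Real.exp 2 ≤ 8 := by
        have := Real.exp_one_lt_d9
        rw [show (2:ℝ) = 1 + 1 by norm_num, Real.exp_add]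
        nlinarith [Real.exp_pos 1]
      have : 0 ≤ T ^ 2 * Real.exp (2 * |T|) := by positivity
      linarith
    · have : 1 ≤ T ^ 2 := by rw [← sq_abs]; nlinarith
      nlinarith [Real.exp_pos (2 * |T|)]
  calc _ ≤ (2 * T ^ 2 + 2 * κ ^ 2) * (Real.exp (2 * κ) * Real.exp (2 * |T|)) := by gcongr
    _ = 2 * Real.exp (2 * κ) * (T ^ 2 * Real.exp (2 * |T|) + κ ^ 2 * Real.exp (2 * |T|)) := by ring
    _ ≤ 2 * Real.exp (2 * κ) * (T ^ 2 * Real.exp (2 * |T|)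
          + κ ^ 2 * (8 + T ^ 2 * Real.exp (2 * |T|))) := by gcongr
    _ = _ := by ring

/-- Expansion of a Gaussian integral over a ball. -/
theorem gauss_expansion {d : ℕ} {T : ContinuousMultilinearMap ℝ (fun _ : Fin 3 => Vec d) ℝ}
    {m τ κ β η : ℝ} {V q : Vec d → ℝ} {ℓ : Vec d →L[ℝ] ℝ}
    (hm : 0 < m) (hT : ∀ u, |T u| ≤ τ * ∏ i, euc (u i)) (hτ : 0 ≤ τ) (hη : 0 ≤ η)
    (hV : ∀ v ∈ eball d m, |V v - T fun _ => v| ≤ κ)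
    (hq : ∀ v ∈ eball d m, |q v - 1 + ℓ v| ≤ η)
    (hℓ : ∀ v ∈ eball d m, |ℓ v| ≤ β)
    (hint : IntegrableOn (fun v => Real.exp (-V v) * q v) (eball d m) (gauss d)) :
    |(∫ v in eball d m, Real.exp (-V v) * q v ∂gauss d) - 1|
      ≤ (gauss d).real (eball d m)ᶜ + (2 * η + κ + β ^ 2 + (1 + η) * (2 * Real.exp (2 * κ) *
        ((1 + κ ^ 2) * (4 * (28 * τ * m) ^ 2 *
          Real.exp (Real.pi ^ 2 * (2 * (28 * τ * m) + 1) ^ 2 / 8)) + 8 * κ ^ 2))) := by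
  have hK := (isClosed_eball d m).measurableSet
  have hTc : Continuous fun v : Vec d => T fun _ => v :=
    T.cont.comp (continuous_pi fun _ => continuous_id)
  have hTodd : ∀ v : Vec d, (T fun _ => -v) = - T fun _ => v := fun v => by
    have := T.map_smul_univ (fun _ => (-1 : ℝ)) (fun _ => v)
    simpa [show ((-1 : ℝ)) ^ 3 = -1 by norm_num] using this
  have hci : ∀ F : Vec d → ℝ, Continuous F → IntegrableOn F (eball d m) (gauss d) := fun F hF =>
    hF.continuousOn.integrableOn_compact (isCompact_eball d m)
  have iT := hci _ hTc
  have iℓ := hci _ ℓ.continuous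
  have i1 := hci (fun _ => (1:ℝ)) continuous_const
  set S : Vec d → ℝ := fun v => (T fun _ => v) ^ 2 * Real.exp (2 * |T fun _ => v|) with hS
  have iS : IntegrableOn S (eball d m) (gauss d) := hci _ (by fun_prop)
  have hSI := setIntegral_cubic_le hm hT hτ
  have h0 : (0:Vec d) ∈ eball d m := by simp [eball, hm.le]
  have hκ : 0 ≤ κ := (abs_nonneg _).trans (hV 0 h0)
  -- The added first-order terms are odd and integrate to zero over the ball, so they are subtracted
  -- from the integrand for free.
  have e1 : ∫ v in eball d m, (Real.exp (-V v) * q v - 1 + (T fun _ => v) + ℓ v) ∂gauss d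
      = (∫ v in eball d m, Real.exp (-V v) * q v ∂gauss d) - (gauss d).real (eball d m) := by
    rw [integral_add (by exact (hint.sub i1).add iT) iℓ, integral_add (by exact hint.sub i1) iT,
      integral_sub hint i1, setIntegral_odd_gauss (F := fun v => T fun _ => v) m hTodd,
      setIntegral_odd_gauss (F := fun v => ℓ v) m (fun v => map_neg ℓ v)]
    simp
  set A := 2 * η + κ + β ^ 2 with hA
  have hA0 : 0 ≤ A := by positivity
  set B := 2 * Real.exp (2 * κ) with hB
  have iR : IntegrableOn (fun v => A + (1 + η) * (B * ((1 + κ ^ 2) * S v + 8 * κ ^ 2)))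
      (eball d m) (gauss d) := hci _ (by fun_prop)
  have e2 : |∫ v in eball d m, (Real.exp (-V v) * q v - 1 + (T fun _ => v) + ℓ v) ∂gauss d|
      ≤ ∫ v in eball d m, (A + (1 + η) * (B * ((1 + κ ^ 2) * S v + 8 * κ ^ 2))) ∂gauss d := by
    refine norm_integral_le_of_norm_le (f := fun v => Real.exp (-V v) * q v - 1 + (T fun _ => v) + ℓ v) iR ?_
    refine (ae_restrict_iff' hK).2 (Filter.Eventually.of_forall fun v hv => ?_)
    refine (abs_exp_neg_mul_sub_le (hV v hv) (hq v hv) (hℓ v hv)).trans ?_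
    have := sq_mul_exp_le (hV v hv)
    gcongr
  have hP : (gauss d).real (eball d m) ≤ 1 := by
    have := prob_le_one (μ := gauss d) (s := eball d m)
    exact measureReal_le_one
  have hP0 : 0 ≤ (gauss d).real (eball d m) := measureReal_nonneg
  have e3 : ∫ v in eball d m, (A + (1 + η) * (B * ((1 + κ ^ 2) * S v + 8 * κ ^ 2))) ∂gauss d
      = (A + (1 + η) * B * (8 * κ ^ 2)) * (gauss d).real (eball d m)
        + (1 + η) * B * (1 + κ ^ 2) * ∫ v in eball d m, S v ∂gauss d := by
    have : ∀ v, A + (1 + η) * (B * ((1 + κ ^ 2) * S v + 8 * κ ^ 2))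
      = (A + (1 + η) * B * (8 * κ ^ 2)) * 1 + (1 + η) * B * (1 + κ ^ 2) * S v := fun v => by ring
    simp_rw [this]
    rw [integral_add (i1.const_mul _) (iS.const_mul _), integral_const_mul, integral_const_mul]
    simp
  rw [e1] at e2
  rw [e3] at e2
  have e4 : (gauss d).real (eball d m)ᶜ = 1 - (gauss d).real (eball d m) := by
    rw [measureReal_compl hK]; simp
  rw [e4]
  set J := ∫ v in eball d m, Real.exp (-V v) * q v ∂gauss d
  set p := (gauss d).real (eball d m)
  have e5 : |J - 1| ≤ |J - p| + (1 - p) := by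
    rw [abs_le]; have := abs_le.1 (le_refl |J - p|); constructor <;> linarith
  have e6 : (A + (1 + η) * B * (8 * κ ^ 2)) * p ≤ A + (1 + η) * B * (8 * κ ^ 2) :=
    mul_le_of_le_one_right (by positivity) hP
  have e7 : (1 + η) * B * (1 + κ ^ 2) * ∫ v in eball d m, S v ∂gauss d ≤
      (1 + η) * B * (1 + κ ^ 2) * _ := mul_le_mul_of_nonneg_left hSI (by positivity)
  linarith

end BoundaryLaplace

/-! ### The norm `‖·‖_H` and coordinates that normalize it. -/

namespace BoundaryLaplace

open scoped MatrixOrder Matrix.Norms.L2Operator in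
-- A positive matrix is a star-square in the matrix C⋆-algebra. With this factor `‖x‖_H` is the
-- Euclidean length of `B x`, and the norm axioms are inherited.
lemma _root_.Matrix.PosDef.exists_factor {d : ℕ} {H : Matrix (Fin d) (Fin d) ℝ} (hH : H.PosDef) :
    ∃ B : Matrix (Fin d) (Fin d) ℝ, B.det ≠ 0 ∧ H = B.transpose * B := by
  obtain ⟨B, hB⟩ := CStarAlgebra.nonneg_iff_eq_star_mul_self.mp hH.posSemidef.nonneg
  rw [Matrix.star_eq_conjTranspose, Matrix.conjTranspose_eq_transpose_of_trivial] at hB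
  refine ⟨B, fun h => ?_, hB⟩
  have := hH.det_pos
  rw [hB, Matrix.det_mul, h, mul_zero] at this
  exact lt_irrefl _ this

lemma quad_eq_of_factor {d : ℕ} {H B : Matrix (Fin d) (Fin d) ℝ} (hB : H = B.transpose * B)
    (x : Vec d) : x ⬝ᵥ H.mulVec x = B.mulVec x ⬝ᵥ B.mulVec x := by
  rw [hB, ← Matrix.mulVec_mulVec, Matrix.dotProduct_mulVec, Matrix.vecMul_transpose]

lemma normH_eq_euc {d : ℕ} {H B : Matrix (Fin d) (Fin d) ℝ} (hB : H = B.transpose * B)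
    (x : Vec d) : normH H x = euc (B.mulVec x) := by
  rw [normH, quad_eq_of_factor hB, euc]

lemma euc_eq_norm {d : ℕ} (v : Vec d) : euc v = ‖WithLp.toLp 2 v‖ := by
  rw [euc, EuclideanSpace.norm_eq]
  congr 1
  simp [dotProduct, sq]

lemma euc_smul {d : ℕ} (c : ℝ) (v : Vec d) : euc (c • v) = |c| * euc v := by
  rw [euc_eq_norm, WithLp.toLp_smul, norm_smul, ← euc_eq_norm, Real.norm_eq_abs]

lemma euc_add_le {d : ℕ} (u v : Vec d) : euc (u + v) ≤ euc u + euc v := by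
  rw [euc_eq_norm, WithLp.toLp_add, euc_eq_norm, euc_eq_norm]; exact norm_add_le _ _

lemma continuous_euc (d : ℕ) : Continuous (euc : Vec d → ℝ) :=
  Real.continuous_sqrt.comp (continuous_dot_self d)

lemma norm_le_euc {d : ℕ} (v : Vec d) : ‖v‖ ≤ euc v := by
  rw [pi_norm_le_iff_of_nonneg (euc_nonneg v)]
  intro i
  apply Real.abs_le_sqrt
  rw [sq]
  exact Finset.single_le_sum (f := fun i => v i * v i) (fun i _ => mul_self_nonneg (v i))
    (Finset.mem_univ i)

section NormH

variable {d : ℕ} {H : Matrix (Fin d) (Fin d) ℝ}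

lemma normH_nonneg (x : Vec d) : 0 ≤ normH H x := Real.sqrt_nonneg _

lemma continuous_normH : Continuous (normH H) := by
  unfold normH dotProduct Matrix.mulVec dotProduct; fun_prop

lemma normH_sq (hH : H.PosDef) (x : Vec d) : normH H x ^ 2 = x ⬝ᵥ H.mulVec x := by
  obtain ⟨B, -, hB⟩ := hH.exists_factor
  rw [normH_eq_euc hB, quad_eq_of_factor hB, euc_sq]

lemma normH_smul (hH : H.PosDef) (c : ℝ) (x : Vec d) : normH H (c • x) = |c| * normH H x := by
  obtain ⟨B, -, hB⟩ := hH.exists_factor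
  rw [normH_eq_euc hB, Matrix.mulVec_smul, euc_smul, normH_eq_euc hB]

lemma normH_add_le (hH : H.PosDef) (x y : Vec d) : normH H (x + y) ≤ normH H x + normH H y := by
  obtain ⟨B, -, hB⟩ := hH.exists_factor
  rw [normH_eq_euc hB, Matrix.mulVec_add, normH_eq_euc hB, normH_eq_euc hB]
  exact euc_add_le _ _

lemma normH_zero : normH H 0 = 0 := by simp [normH]

lemma normH_pos (hH : H.PosDef) {x : Vec d} (hx : x ≠ 0) : 0 < normH H x := by
  have := hH.dotProduct_mulVec_pos hx
  simp only [star_trivial] at this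
  exact Real.sqrt_pos.2 this

/-- The sup norm is controlled by the norm `‖·‖_H`. -/
lemma exists_norm_le_normH (hH : H.PosDef) : ∃ K : ℝ, 0 < K ∧ ∀ x, ‖x‖ ≤ K * normH H x := by
  obtain ⟨B, hdet, hB⟩ := hH.exists_factor
  have hu : IsUnit B.det := isUnit_iff_ne_zero.2 hdet
  set A : Vec d →L[ℝ] Vec d := (Matrix.toLin' B⁻¹).toContinuousLinearMap
  refine ⟨‖A‖ + 1, by positivity, fun x => ?_⟩
  have : A (B.mulVec x) = x := by
    simp [A, Matrix.mulVec_mulVec, Matrix.nonsing_inv_mul _ hu]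
  calc ‖x‖ = ‖A (B.mulVec x)‖ := by rw [this]
    _ ≤ ‖A‖ * ‖B.mulVec x‖ := A.le_opNorm _
    _ ≤ (‖A‖ + 1) * euc (B.mulVec x) := by
      gcongr
      · linarith
      · exact norm_le_euc _
    _ = _ := by rw [normH_eq_euc hB]

lemma convex_UH (hH : H.PosDef) (a : ℝ) : Convex ℝ (UH H a) := by
  intro x hx y hy s t hs ht hst
  have h1 : normH H x ≤ a := hx
  have h2 : normH H y ≤ a := hy
  change normH H (s • x + t • y) ≤ a
  refine (normH_add_le hH _ _).trans ?_
  rw [normH_smul hH, normH_smul hH, abs_of_nonneg hs, abs_of_nonneg ht]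
  calc _ ≤ s * a + t * a := by gcongr
    _ = a := by rw [← add_mul, hst, one_mul]

lemma isClosed_UH (a : ℝ) : IsClosed (UH H a) := isClosed_le continuous_normH continuous_const

lemma isCompact_UH (hH : H.PosDef) (a : ℝ) : IsCompact (UH H a) := by
  refine Metric.isCompact_of_isClosed_isBounded (isClosed_UH a) ?_
  obtain ⟨K, hK, h⟩ := exists_norm_le_normH hH
  refine (Metric.isBounded_iff_subset_closedBall 0).2 ⟨K * a, fun x hx => ?_⟩
  rw [mem_closedBall_zero_iff]
  exact (h x).trans (by gcongr; exact hx)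

lemma zero_mem_UH {a : ℝ} (ha : 0 ≤ a) : (0 : Vec d) ∈ UH H a := by
  change normH H 0 ≤ a
  rwa [normH_zero]

lemma UH_mono {a b : ℝ} (h : a ≤ b) : UH H a ⊆ UH H b := fun _ hx => le_trans hx h

lemma uniqueDiffOn_UH (hH : H.PosDef) {a : ℝ} (ha : 0 < a) : UniqueDiffOn ℝ (UH H a) := by
  refine uniqueDiffOn_convex (convex_UH hH a) ⟨0, ?_⟩
  refine mem_interior.2 ⟨{x | normH H x < a}, fun x (hx : normH H x < a) => hx.le,
    isOpen_lt continuous_normH continuous_const, ?_⟩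
  change normH H 0 < a
  rwa [normH_zero]

lemma smul_mem_UH (hH : H.PosDef) {a : ℝ} {x : Vec d} (hx : x ∈ UH H a) {t : ℝ} (ht : t ∈ Icc (0:ℝ) 1) :
    t • x ∈ UH H a := by
  change normH H (t • x) ≤ a
  rw [normH_smul hH, abs_of_nonneg ht.1]
  have : normH H x ≤ a := hx
  nlinarith [normH_nonneg (H := H) x, ht.2, ht.1]

end NormH

/-- Linear coordinates in which `λ ‖·‖_H²` is the square of the Euclidean length. -/
theorem exists_normalizing_equiv {d : ℕ} {H : Matrix (Fin d) (Fin d) ℝ} (hH : H.PosDef) {lam : ℝ}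
    (hlam : 0 < lam) : ∃ A : Vec d ≃L[ℝ] Vec d, (∀ v, normH H (A v) = euc v / Real.sqrt lam) ∧
      (∀ f : Vec d → ℝ, ∫ x, f x = (lam ^ ((d:ℝ) / 2) * Real.sqrt H.det)⁻¹ * ∫ v, f (A v)) ∧
      ∀ f : Vec d → ℝ, Integrable (fun v => f (A v)) → Integrable f := by
  obtain ⟨B, hdet, hB⟩ := hH.exists_factor
  have hsl : 0 < Real.sqrt lam := Real.sqrt_pos.2 hlam
  -- The coordinate map is `C⁻¹`. Since `|C x|² = λ ‖x‖_H²` and `|det C| = λ^{d/2} √(det H)`, both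
  -- the length identity and the Jacobian are read off from `C`.
  set C : Matrix (Fin d) (Fin d) ℝ := (Real.sqrt lam) • B with hC
  have hCdet : C.det = Real.sqrt lam ^ d * B.det := by rw [hC, Matrix.det_smul]; simp
  have hCu : IsUnit C.det := by
    rw [hCdet]; exact isUnit_iff_ne_zero.2 (mul_ne_zero (by positivity) hdet)
  let A0 : Vec d ≃ₗ[ℝ] Vec d := (Matrix.toLinearEquiv' C (C.invertibleOfIsUnitDet hCu)).symm
  let A : Vec d ≃L[ℝ] Vec d := A0.toContinuousLinearEquiv
  have hAC : ∀ v, C.mulVec (A v) = v := fun v =>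
    (Matrix.toLinearEquiv' C (C.invertibleOfIsUnitDet hCu)).apply_symm_apply v
  have hdetA : |(LinearMap.det (A0 : Vec d →ₗ[ℝ] Vec d))⁻¹| = lam ^ ((d:ℝ) / 2) * Real.sqrt H.det := by
    have h1 : LinearMap.det (A0 : Vec d →ₗ[ℝ] Vec d) * C.det = 1 := by
      rw [← LinearMap.det_toLin' C, ← LinearMap.det_comp]
      have : (A0 : Vec d →ₗ[ℝ] Vec d) ∘ₗ Matrix.toLin' C = LinearMap.id := by
        refine LinearMap.ext fun x => ?_
        exact (Matrix.toLinearEquiv' C (C.invertibleOfIsUnitDet hCu)).symm_apply_apply x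
      rw [this, LinearMap.det_id]
    have h2 : (LinearMap.det (A0 : Vec d →ₗ[ℝ] Vec d))⁻¹ = C.det := by
      exact inv_eq_of_mul_eq_one_right h1
    rw [h2, hCdet, hB, Matrix.det_mul, Matrix.det_transpose, ← sq, Real.sqrt_sq_eq_abs, abs_mul,
      abs_of_pos (pow_pos hsl d), Real.sqrt_eq_rpow, ← Real.rpow_natCast, ← Real.rpow_mul hlam.le]
    congr 2; ring
  have hmap : Measure.map A (volume : Measure (Vec d))
      = ENNReal.ofReal (lam ^ ((d:ℝ) / 2) * Real.sqrt H.det) • volume := by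
    rw [← hdetA]
    refine Real.map_linearMap_volume_pi_eq_smul_volume_pi (f := (A0 : Vec d →ₗ[ℝ] Vec d)) ?_
    exact (LinearEquiv.isUnit_det' A0).ne_zero
  have hpos : 0 < lam ^ ((d:ℝ) / 2) * Real.sqrt H.det :=
    mul_pos (by positivity) (Real.sqrt_pos.2 hH.det_pos)
  have hemb : MeasurableEmbedding A := A.toHomeomorph.measurableEmbedding
  refine ⟨A, fun v => ?_, fun f => ?_, fun f hf => ?_⟩
  · have h1 : euc v = Real.sqrt lam * normH H (A v) := by
      conv_lhs => rw [← hAC v, hC]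
      rw [Matrix.smul_mulVec, euc_smul, abs_of_pos hsl, normH_eq_euc hB]
    rw [h1]; field_simp
  · have := hemb.integral_map (μ := volume) f
    rw [hmap, integral_smul_measure, ENNReal.toReal_ofReal hpos.le, smul_eq_mul] at this
    rw [← this, inv_mul_cancel_left₀ hpos.ne']
  · have := (hemb.integrable_map_iff (μ := volume) (g := f)).2 hf
    rw [hmap] at this
    rwa [integrable_smul_measure (by simpa using hpos) ENNReal.ofReal_ne_top] at this

/-! ### Gaussian and exponential integrals in normalized coordinates. -/

section EuclideanIntegrals

lemma exp_dot_eq_prod {d : ℕ} (c : ℝ) (v : Vec d) :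
    Real.exp (-c / 2 * (v ⬝ᵥ v)) = ∏ i, Real.exp (-(c / 2) * v i ^ 2) := by
  rw [← Real.exp_sum, dotProduct, Finset.mul_sum]
  congr 1; refine Finset.sum_congr rfl fun i _ => by ring

lemma integrable_exp_dot {d : ℕ} {c : ℝ} (hc : 0 < c) :
    Integrable fun v : Vec d => Real.exp (-c / 2 * (v ⬝ᵥ v)) := by
  simp_rw [exp_dot_eq_prod]
  exact Integrable.fintype_prod (𝕜 := ℝ) (f := fun _ (t : ℝ) => Real.exp (-(c / 2) * t ^ 2))
    fun i => integrable_exp_neg_mul_sq (by positivity)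

lemma integral_exp_dot {d : ℕ} {c : ℝ} (hc : 0 < c) :
    ∫ v : Vec d, Real.exp (-c / 2 * (v ⬝ᵥ v)) = (2 * Real.pi / c) ^ ((d:ℝ) / 2) := by
  simp_rw [exp_dot_eq_prod]
  rw [integral_fintype_prod_volume_eq_prod (𝕜 := ℝ) (fun _ (t : ℝ) => Real.exp (-(c / 2) * t ^ 2))]
  have hpi := Real.pi_pos
  simp only [integral_gaussian, Finset.prod_const, Finset.card_univ, Fintype.card_fin]
  rw [Real.sqrt_eq_rpow, ← Real.rpow_natCast, ← Real.rpow_mul (by positivity)]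
  congr 1
  · field_simp
  · ring

/-- Cauchy–Schwarz gives `∑ |v i| ≤ √d |v|`, so a decay rate proportional to `√d` in the Euclidean
length yields a product with one fixed rate per coordinate, and an integral that is only exponential
in `d`. -/
lemma exp_neg_euc_le {d : ℕ} (hd : 1 ≤ d) {c : ℝ} (hc : 0 ≤ c) (v : Vec d) :
    Real.exp (-(c * Real.sqrt d) * euc v) ≤ ∏ i, Real.exp (-c * |v i|) := by
  rw [← Real.exp_sum, ← Finset.mul_sum]
  apply Real.exp_le_exp.2
  have h1 : ∑ i, |v i| ≤ Real.sqrt d * euc v := by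
    rw [euc, ← Real.sqrt_mul (by positivity)]
    apply Real.le_sqrt_of_sq_le
    have := sq_sum_le_card_mul_sum_sq (s := Finset.univ) (f := fun i => |v i|)
    simpa [dotProduct, sq] using this
  nlinarith

lemma integral_exp_neg_mul_abs {c : ℝ} (hc : 0 < c) :
    ∫ t : ℝ, Real.exp (-c * |t|) = 2 / c := by
  rw [integral_comp_abs (f := fun t => Real.exp (-c * t)), integral_exp_mul_Ioi (by linarith)]
  simp; ring

lemma integrable_exp_neg_mul_abs {c : ℝ} (hc : 0 < c) :
    Integrable fun t : ℝ => Real.exp (-c * |t|) := by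
  -- The integral would be `0` by convention if the function were not integrable, but it equals `2 /
  -- c > 0`.
  by_contra h
  have h1 := integral_undef h
  rw [integral_exp_neg_mul_abs hc] at h1
  exact (div_pos two_pos hc).ne' h1

lemma integrable_exp_neg_euc {d : ℕ} (hd : 1 ≤ d) {c : ℝ} (hc : 0 < c) :
    Integrable fun v : Vec d => Real.exp (-(c * Real.sqrt d) * euc v) := by
  refine Integrable.mono' (Integrable.fintype_prod (𝕜 := ℝ)
    (f := fun _ (t : ℝ) => Real.exp (-c * |t|)) fun i => integrable_exp_neg_mul_abs hc)
    (by have := continuous_euc d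
        exact (by fun_prop : Continuous fun v : Vec d =>
          Real.exp (-(c * Real.sqrt d) * euc v)).aestronglyMeasurable) ?_
  refine Filter.Eventually.of_forall fun v => ?_
  rw [Real.norm_of_nonneg (Real.exp_pos _).le]
  exact exp_neg_euc_le hd hc.le v

lemma integral_exp_neg_euc_le {d : ℕ} (hd : 1 ≤ d) {c : ℝ} (hc : 0 < c) :
    ∫ v : Vec d, Real.exp (-(c * Real.sqrt d) * euc v) ≤ (2 / c) ^ d := by
  calc _ ≤ ∫ v : Vec d, ∏ i, Real.exp (-c * |v i|) :=
        integral_mono (integrable_exp_neg_euc hd hc) (Integrable.fintype_prod (𝕜 := ℝ)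
          (f := fun _ (t : ℝ) => Real.exp (-c * |t|)) fun i => integrable_exp_neg_mul_abs hc)
          fun v => exp_neg_euc_le hd hc.le v
    _ = _ := by
        rw [integral_fintype_prod_volume_eq_prod (𝕜 := ℝ) (fun _ (t : ℝ) => Real.exp (-c * |t|))]
        simp only [integral_exp_neg_mul_abs hc, Finset.prod_const, Finset.card_univ, Fintype.card_fin]

/-- Chernoff bound: outside the ball half of the Gaussian exponent is at most `-m/4`, and the other
half is a Gaussian of variance `2`, whose mass relative to the standard one is `2^{d/2}`. -/
lemma gauss_real_compl_eball_le (d : ℕ) (m : ℝ) :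
    (gauss d).real (eball d m)ᶜ ≤ Real.exp (-m / 4) * 2 ^ ((d:ℝ) / 2) := by
  have hK := (isClosed_eball d m).measurableSet.compl
  have h0 : (gauss d).real (eball d m)ᶜ = ∫ v, (eball d m)ᶜ.indicator (fun _ => (1:ℝ)) v ∂gauss d := by
    rw [integral_indicator hK]; simp
  have hpi := Real.pi_pos
  have h2 : 0 < (2 * Real.pi) ^ ((d:ℝ) / 2) := by positivity
  have h1 : (2 * Real.pi) ^ ((d:ℝ) / 2) * (gauss d).real (eball d m)ᶜ
      ≤ Real.exp (-m / 4) * (2 * Real.pi / (1 / 2)) ^ ((d:ℝ) / 2) := by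
    rw [h0, ← integral_gauss, ← integral_exp_dot (by norm_num : (0:ℝ) < 1 / 2), ← integral_const_mul]
    refine integral_mono_of_nonneg (Filter.Eventually.of_forall fun v => ?_)
      ((integrable_exp_dot (by norm_num)).const_mul _) (Filter.Eventually.of_forall fun v => ?_)
    · exact mul_nonneg (indicator_nonneg (fun _ _ => zero_le_one) _) (Real.exp_pos _).le
    · beta_reduce
      by_cases hv : v ∈ (eball d m)ᶜ
      · rw [indicator_of_mem hv, one_mul, ← Real.exp_add]
        apply Real.exp_le_exp.2
        have : m < v ⬝ᵥ v := not_le.1 hv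
        linarith
      · rw [indicator_of_notMem hv, zero_mul]; positivity
  rw [show 2 * Real.pi / (1 / 2) = 2 * Real.pi * 2 by ring,
    Real.mul_rpow (x := 2 * Real.pi) (by positivity) (by norm_num)] at h1
  refine le_of_mul_le_mul_left (h1.trans_eq ?_) h2
  ring

end EuclideanIntegrals

section WeightedIntegrals

variable {d : ℕ} {H : Matrix (Fin d) (Fin d) ℝ} {lam : ℝ}

lemma two_pi_div_rpow (hlam : 0 < lam) (a : ℝ) :
    (lam ^ a * Real.sqrt H.det)⁻¹ * (2 * Real.pi) ^ a = (2 * Real.pi / lam) ^ a / Real.sqrt H.det := by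
  have := Real.pi_pos
  rw [Real.div_rpow (by positivity) hlam.le, mul_inv]
  field_simp

lemma integrable_exp_normH_sq (hH : H.PosDef) (hlam : 0 < lam) {c : ℝ} (hc : 0 < c) :
    Integrable fun x : Vec d => Real.exp (-(c * lam / 2) * normH H x ^ 2) := by
  obtain ⟨A, hA, -, hi⟩ := exists_normalizing_equiv hH hlam
  refine hi _ ((integrable_exp_dot hc).congr (Filter.Eventually.of_forall fun v => ?_))
  beta_reduce
  rw [hA, div_pow, Real.sq_sqrt hlam.le, euc_sq]; congr 1; field_simp

lemma integral_exp_normH_sq (hH : H.PosDef) (hlam : 0 < lam) {c : ℝ} (hc : 0 < c) :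
    ∫ x : Vec d, Real.exp (-(c * lam / 2) * normH H x ^ 2)
      = (2 * Real.pi / lam) ^ ((d:ℝ) / 2) / Real.sqrt H.det * (1 / c) ^ ((d:ℝ) / 2) := by
  obtain ⟨A, hA, hf, -⟩ := exists_normalizing_equiv hH hlam
  have hpi := Real.pi_pos
  have e : ∀ v, Real.exp (-(c * lam / 2) * normH H (A v) ^ 2) = Real.exp (-c / 2 * (v ⬝ᵥ v)) := by
    intro v
    rw [hA, div_pow, Real.sq_sqrt hlam.le, euc_sq]; congr 1; field_simp
  rw [hf]
  simp_rw [e]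
  rw [integral_exp_dot hc, div_eq_mul_one_div _ c, Real.mul_rpow (by positivity) (by positivity),
    ← mul_assoc, two_pi_div_rpow hlam]

lemma integrable_exp_neg_normH (hH : H.PosDef) (hlam : 0 < lam) (hd : 1 ≤ d) :
    Integrable fun x : Vec d => Real.exp (-(Real.sqrt (d * lam) / 4) * normH H x) := by
  obtain ⟨A, hA, -, hi⟩ := exists_normalizing_equiv hH hlam
  have hs := Real.sqrt_pos.2 hlam
  refine hi _ ((integrable_exp_neg_euc hd (by norm_num : (0:ℝ) < 1 / 4)).congr
    (Filter.Eventually.of_forall fun v => ?_))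
  beta_reduce
  rw [hA, Real.sqrt_mul (by positivity)]; congr 1; field_simp

lemma integral_exp_neg_normH_le (hH : H.PosDef) (hlam : 0 < lam) (hd : 1 ≤ d) :
    ∫ x : Vec d, Real.exp (-(Real.sqrt (d * lam) / 4) * normH H x)
      ≤ (2 * Real.pi / lam) ^ ((d:ℝ) / 2) / Real.sqrt H.det * 4 ^ d := by
  obtain ⟨A, hA, hf, -⟩ := exists_normalizing_equiv hH hlam
  have hpi := Real.pi_pos
  have hs := Real.sqrt_pos.2 hlam
  have e : ∀ v, Real.exp (-(Real.sqrt (d * lam) / 4) * normH H (A v))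
      = Real.exp (-(1 / 4 * Real.sqrt d) * euc v) := by
    intro v
    rw [hA, Real.sqrt_mul (by positivity)]; congr 1; field_simp
  rw [hf]
  simp_rw [e]
  have hdet := Real.sqrt_pos.2 hH.det_pos
  have h1 := integral_exp_neg_euc_le hd (by norm_num : (0:ℝ) < 1 / 4)
  -- `8^d = 2^d 4^d` and `2^d = 4^{d/2} ≤ (2π)^{d/2}`: this brings in the Gaussian normalization
  -- common to all terms.
  have h2 : ((2:ℝ) / (1 / 4)) ^ d ≤ (2 * Real.pi) ^ ((d:ℝ) / 2) * 4 ^ d := by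
    have h3 : (2:ℝ) ^ d ≤ (2 * Real.pi) ^ ((d:ℝ) / 2) := by
      have : (2:ℝ) ^ d = (4:ℝ) ^ ((d:ℝ) / 2) := by
        rw [show (4:ℝ) = 2 ^ (2:ℝ) by norm_num, ← Real.rpow_mul (by norm_num), ← Real.rpow_natCast]
        congr 1; ring
      rw [this]
      apply Real.rpow_le_rpow (by norm_num) _ (by positivity)
      linarith [Real.pi_gt_three]
    calc ((2:ℝ) / (1 / 4)) ^ d = 2 ^ d * 4 ^ d := by rw [← mul_pow]; norm_num
      _ ≤ _ := by gcongr
  calc _ ≤ (lam ^ ((d:ℝ) / 2) * Real.sqrt H.det)⁻¹ * ((2 * Real.pi) ^ ((d:ℝ) / 2) * 4 ^ d) := by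
        gcongr; exact h1.trans h2
    _ = _ := by rw [← mul_assoc, two_pi_div_rpow hlam]

/-- A Gaussian-weighted integral over a ball of `‖·‖_H` in normalized coordinates. -/
theorem exists_gauss_coordinates (hH : H.PosDef) (hlam : 0 < lam) :
    ∃ A : Vec d ≃L[ℝ] Vec d, (∀ v, normH H (A v) = euc v / Real.sqrt lam) ∧
      ∀ (r : ℝ) (F : Vec d → ℝ), 0 ≤ r →
        (∫ x in UH H r, F x * Real.exp (-(lam / 2) * normH H x ^ 2)
          = (2 * Real.pi / lam) ^ ((d:ℝ) / 2) / Real.sqrt H.det *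
            ∫ v in eball d (lam * r ^ 2), F (A v) ∂gauss d) := by
  obtain ⟨A, hA, hf, -⟩ := exists_normalizing_equiv hH hlam
  refine ⟨A, hA, fun r F hr => ?_⟩
  have hs := Real.sqrt_pos.2 hlam
  have hmem : ∀ v, A v ∈ UH H r ↔ v ∈ eball d (lam * r ^ 2) := by
    intro v
    change normH H (A v) ≤ r ↔ v ⬝ᵥ v ≤ _
    rw [hA, div_le_iff₀ hs, ← euc_sq, ← abs_of_nonneg (euc_nonneg v),
      ← abs_of_nonneg (by positivity : 0 ≤ r * Real.sqrt lam), ← sq_le_sq, mul_pow,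
      Real.sq_sqrt hlam.le, sq_abs, mul_comm lam]
  rw [← integral_indicator (isClosed_UH r).measurableSet, hf]
  have e : ∀ v, (UH H r).indicator (fun x => F x * Real.exp (-(lam / 2) * normH H x ^ 2)) (A v)
      = (eball d (lam * r ^ 2)).indicator (fun v => F (A v)) v * Real.exp (-(v ⬝ᵥ v) / 2) := by
    intro v
    by_cases hv : v ∈ eball d (lam * r ^ 2)
    · rw [indicator_of_mem hv, indicator_of_mem ((hmem v).2 hv), hA, div_pow, Real.sq_sqrt hlam.le,
        euc_sq]
      congr 2; field_simp
    · rw [indicator_of_notMem hv, indicator_of_notMem (fun h => hv ((hmem v).1 h)), zero_mul]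
  simp_rw [e]
  rw [integral_gauss, ← mul_assoc, two_pi_div_rpow hlam,
    integral_indicator (isClosed_eball d _).measurableSet]

end WeightedIntegrals

end BoundaryLaplace

/-! ### Weighted operator norms, Taylor's formula along rays, and suprema of derivatives. -/

namespace BoundaryLaplace

section TensorNorm

variable {d k : ℕ} {H : Matrix (Fin d) (Fin d) ℝ}
  (T : ContinuousMultilinearMap ℝ (fun _ : Fin k => Vec d) ℝ)

/-- Flipping the sign of one argument flips the value, so the set of values is symmetric; this needs
at least one argument. Without unit vectors the supremum is `0` by convention. -/
lemma tensorNormH_nonneg (hk : k ≠ 0) : 0 ≤ tensorNormH H T := by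
  classical
  rw [tensorNormH]
  by_cases hne : {a : ℝ | ∃ u : Fin k → Vec d, (∀ i, normH H (u i) = 1) ∧ a = T u}.Nonempty
  · obtain ⟨a, u, hu, rfl⟩ := hne
    apply Real.sSup_nonneg'
    rcases le_total 0 (T u) with h | h
    · exact ⟨T u, ⟨u, hu, rfl⟩, h⟩
    · obtain ⟨i⟩ : Nonempty (Fin k) := Fin.pos_iff_nonempty.1 (Nat.pos_of_ne_zero hk)
      refine ⟨-T u, ⟨Function.update u i (-u i), fun j => ?_, ?_⟩, by linarith⟩
      · by_cases hj : j = i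
        · subst hj; simp [normH, Matrix.mulVec_neg, ← hu j]
        · simp [hj, hu]
      · have := T.map_update_smul u i (-1) (u i)
        simpa using this.symm
  · rw [not_nonempty_iff_eq_empty.1 hne, Real.sSup_empty]

variable {T}

lemma apply_le_of_normH_eq_one {K : ℝ} (hK : ∀ x, ‖x‖ ≤ K * normH H x) {u : Fin k → Vec d}
    (hu : ∀ i, normH H (u i) = 1) : T u ≤ ‖T‖ * K ^ k := by
  calc T u ≤ ‖T u‖ := le_abs_self _
    _ ≤ ‖T‖ * ∏ i, ‖u i‖ := T.le_opNorm u
    _ ≤ ‖T‖ * ∏ _i : Fin k, K := by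
      gcongr with i
      simpa [hu i] using hK (u i)
    _ = _ := by simp

lemma tensorNormH_le {K : ℝ} (hK0 : 0 ≤ K) (hK : ∀ x, ‖x‖ ≤ K * normH H x) :
    tensorNormH H T ≤ ‖T‖ * K ^ k := by
  refine Real.sSup_le ?_ (by positivity)
  rintro a ⟨u, hu, rfl⟩
  exact apply_le_of_normH_eq_one hK hu

/-- Homogeneity reduces to unit vectors. Equivalence with the sup norm makes the set of values
bounded, so that `sSup` is a genuine supremum. -/
lemma abs_apply_le_tensorNormH (hH : H.PosDef) (hk : k ≠ 0) (u : Fin k → Vec d) :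
    |T u| ≤ tensorNormH H T * ∏ i, normH H (u i) := by
  classical
  obtain ⟨K, -, hK⟩ := exists_norm_le_normH hH
  have hb : BddAbove {a : ℝ | ∃ u : Fin k → Vec d, (∀ i, normH H (u i) = 1) ∧ a = T u} := by
    refine ⟨‖T‖ * K ^ k, ?_⟩
    rintro a ⟨u, hu, rfl⟩
    exact apply_le_of_normH_eq_one hK hu
  by_cases h0 : ∃ i, u i = 0
  · obtain ⟨i, hi⟩ := h0
    rw [T.map_coord_zero i hi, abs_zero]
    exact mul_nonneg (tensorNormH_nonneg T hk) (Finset.prod_nonneg fun i _ => normH_nonneg _)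
  · push Not at h0
    have hpos : ∀ i, 0 < normH H (u i) := fun i => normH_pos hH (h0 i)
    have hone : ∀ i, normH H ((normH H (u i))⁻¹ • u i) = 1 := fun i => by
      rw [normH_smul hH, abs_of_pos (inv_pos.2 (hpos i)), inv_mul_cancel₀ (hpos i).ne']
    have hmain : ∀ v : Fin k → Vec d, (∀ i, normH H (v i) = 1) → |T v| ≤ tensorNormH H T := by
      intro v hv
      rw [abs_le']
      refine ⟨le_csSup hb ⟨v, hv, rfl⟩, le_csSup hb ?_⟩
      obtain ⟨i⟩ : Nonempty (Fin k) := Fin.pos_iff_nonempty.1 (Nat.pos_of_ne_zero hk)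
      refine ⟨Function.update v i (-v i), fun j => ?_, ?_⟩
      · by_cases hj : j = i
        · subst hj; simp [normH, Matrix.mulVec_neg, ← hv j]
        · simp [hj, hv]
      · have := T.map_update_smul v i (-1) (v i)
        simpa using this.symm
    have e : T u = (∏ i, normH H (u i)) * T fun i => (normH H (u i))⁻¹ • u i := by
      rw [T.map_smul_univ, smul_eq_mul, ← mul_assoc, ← Finset.prod_mul_distrib]
      simp [mul_inv_cancel₀ (hpos _).ne']
    have hP : 0 ≤ ∏ i, normH H (u i) := Finset.prod_nonneg fun i _ => normH_nonneg _
    rw [e, abs_mul, abs_of_nonneg hP, mul_comm]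
    gcongr
    exact hmain _ hone

end TensorNorm

section Taylor

variable {d : ℕ} {H : Matrix (Fin d) (Fin d) ℝ} {f : Vec d → ℝ} {a : ℝ} {x : Vec d}

/-- The chain rule for a linear map computes derivatives within the full preimage of the ball. That
preimage is convex and contains `[0, 1]`, so restricting to `[0, 1]` does not change them. The point
`x` may lie on the boundary of the ball, so all derivatives are one-sided. -/
lemma iteratedDerivWithin_ray (hH : H.PosDef) (ha : 0 < a) {n : ℕ} (hf : ContDiffOn ℝ n f (UH H a))
    (hx : x ∈ UH H a) {k : ℕ} (hk : k ≤ n) {t : ℝ} (ht : t ∈ Icc (0:ℝ) 1) :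
    iteratedDerivWithin k (fun t : ℝ => f (t • x)) (Icc 0 1) t
      = iteratedFDerivWithin ℝ k f (UH H a) (t • x) fun _ => x := by
  set L : ℝ →L[ℝ] Vec d := ContinuousLinearMap.toSpanSingleton ℝ x with hL
  have hLx : ∀ s, L s = s • x := fun s => by simp [hL]
  have hsub : Icc (0:ℝ) 1 ⊆ L ⁻¹' UH H a := fun s hs => by
    rw [mem_preimage, hLx]; exact smul_mem_UH hH hx hs
  have hconv : Convex ℝ (L ⁻¹' UH H a) := (convex_UH hH a).linear_preimage L.toLinearMap
  have huP : UniqueDiffOn ℝ (L ⁻¹' UH H a) := uniqueDiffOn_convex hconv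
    ⟨1 / 2, interior_mono hsub (by rw [interior_Icc]; constructor <;> norm_num)⟩
  have hfL : ContDiffOn ℝ n (f ∘ L) (L ⁻¹' UH H a) := hf.comp_continuousLinearMap L
  have htP := hsub ht
  rw [iteratedDerivWithin, show (fun t : ℝ => f (t • x)) = f ∘ L by ext s; simp [hLx],
    iteratedFDerivWithin_subset hsub (uniqueDiffOn_Icc zero_lt_one) huP
      (hfL.of_le (by exact_mod_cast hk)) ht,
    L.iteratedFDerivWithin_comp_right hf (uniqueDiffOn_UH hH ha) huP (by exact htP)
      (by exact_mod_cast hk)]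
  simp [hLx]

/-- Taylor's formula along the segment from `0` to `x`. -/
theorem taylor_ray (hH : H.PosDef) (ha : 0 < a) {n : ℕ} (hf : ContDiffOn ℝ (n + 1 : ℕ) f (UH H a))
    (hx : x ∈ UH H a) {C : ℝ}
    (hC : ∀ t ∈ Icc (0:ℝ) 1,
      |iteratedFDerivWithin ℝ (n + 1) f (UH H a) (t • x) fun _ => x| ≤ C) :
    |f x - ∑ k ∈ Finset.range (n + 1), ((k.factorial : ℝ))⁻¹ *
      iteratedFDerivWithin ℝ k f (UH H a) 0 fun _ => x| ≤ C := by
  have hg : ContDiffOn ℝ (n + 1) (fun t : ℝ => f (t • x)) (Icc 0 1) := by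
    have : ContDiffOn ℝ (n + 1 : ℕ) (fun t : ℝ => f (t • x)) (Icc 0 1) :=
      hf.comp (by fun_prop) fun t ht => smul_mem_UH hH hx ht
    exact_mod_cast this
  have hCnn : 0 ≤ C := (abs_nonneg _).trans (hC 0 (by simp))
  have h := taylor_mean_remainder_bound (n := n) (C := C) (x := 1) zero_le_one hg (by simp)
    fun t ht => by
      rw [iteratedDerivWithin_ray hH ha hf hx le_rfl ht]; exact hC t ht
  rw [taylor_within_apply] at h
  have e : ∀ k ∈ Finset.range (n + 1), (((k.factorial : ℝ))⁻¹ * (1 - 0) ^ k) •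
      iteratedDerivWithin k (fun t : ℝ => f (t • x)) (Icc 0 1) 0 = ((k.factorial : ℝ))⁻¹ *
      iteratedFDerivWithin ℝ k f (UH H a) 0 fun _ => x := by
    intro k hk
    rw [iteratedDerivWithin_ray hH ha hf hx (by
      have := Finset.mem_range.1 hk; omega) (by simp)]
    simp
  rw [Finset.sum_congr rfl e, one_smul] at h
  refine h.trans ?_
  simp only [sub_zero, one_pow, mul_one]
  -- The factor `1 / n!` in the remainder is dropped.
  exact div_le_self hCnn (by exact_mod_cast Nat.one_le_iff_ne_zero.2 (Nat.factorial_ne_zero n))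

end Taylor

section Omega

variable {d : ℕ} {H : Matrix (Fin d) (Fin d) ℝ} {w : Vec d × ℝ → ℝ} {a b : ℝ}

lemma derivSize_nonneg (ℓ j : ℕ) (x : Vec d) (y : ℝ) : 0 ≤ derivSize H w a b ℓ j x y := by
  rw [derivSize]
  split_ifs with h
  · exact abs_nonneg _
  · exact tensorNormH_nonneg _ h

lemma omega_nonneg (ℓ j : ℕ) (r r' : ℝ) : 0 ≤ omega H w a b ℓ j r r' := by
  apply Real.sSup_nonneg
  rintro _ ⟨p, -, rfl⟩
  exact derivSize_nonneg _ _ _ _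

lemma derivSize_zero_le_omega (hH : H.PosDef) (ℓ j : ℕ) :
    derivSize H w a b ℓ j 0 0 ≤ omega H w a b ℓ j 0 0 := by
  have hs : UH H 0 ×ˢ Icc (0:ℝ) 0 = {(0 : Vec d × ℝ)} := by
    ext ⟨x, y⟩
    simp only [mem_prod, Icc_self, mem_singleton_iff, Prod.mk_eq_zero]
    refine and_congr_left fun _ => ⟨fun h => ?_, fun h => h ▸ zero_mem_UH le_rfl⟩
    by_contra hx
    exact absurd (normH_pos hH hx) (not_lt.2 h)
  rw [omega, hs, image_singleton, csSup_singleton]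
  rfl

lemma abs_mixedDeriv_zero_le (hH : H.PosDef) {ℓ : ℕ} (hℓ : ℓ ≠ 0) (j : ℕ) (u : Fin ℓ → Vec d) :
    |mixedDeriv H w a b ℓ j 0 0 u| ≤ omega H w a b ℓ j 0 0 * ∏ i, normH H (u i) := by
  refine (abs_apply_le_tensorNormH hH hℓ u).trans ?_
  have := derivSize_zero_le_omega (w := w) (a := a) (b := b) hH ℓ j
  rw [derivSize, if_neg hℓ] at this
  exact mul_le_mul_of_nonneg_right this (Finset.prod_nonneg fun i _ => normH_nonneg _)

/-- A point value lies below `sSup` only if the set is bounded above; this follows from continuity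
of the derivative on the compact ball. -/
lemma abs_mixedDeriv_le (hH : H.PosDef) (ha : 0 < a) {ℓ : ℕ} (hℓ : ℓ ≠ 0) {j : ℕ}
    (hf : ContDiffOn ℝ ℓ (fun x => partialY w b j x 0) (UH H a)) {x : Vec d} (hx : x ∈ UH H a)
    (u : Fin ℓ → Vec d) :
    |mixedDeriv H w a b ℓ j x 0 u| ≤ omega H w a b ℓ j a 0 * ∏ i, normH H (u i) := by
  refine (abs_apply_le_tensorNormH hH hℓ u).trans ?_
  refine mul_le_mul_of_nonneg_right ?_ (Finset.prod_nonneg fun i _ => normH_nonneg _)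
  obtain ⟨K, hK0, hK⟩ := exists_norm_le_normH hH
  have hc : ContinuousOn (iteratedFDerivWithin ℝ ℓ (fun x => partialY w b j x 0) (UH H a)) (UH H a) :=
    hf.continuousOn_iteratedFDerivWithin le_rfl (uniqueDiffOn_UH hH ha)
  obtain ⟨C, hC⟩ := ((isCompact_UH hH a).image_of_continuousOn hc.norm).bddAbove
  have hb : BddAbove ((fun p : Vec d × ℝ => derivSize H w a b ℓ j p.1 p.2) ''
      (UH H a ×ˢ Icc (0:ℝ) 0)) := by
    refine ⟨C * K ^ ℓ, ?_⟩
    rintro _ ⟨⟨x, y⟩, ⟨hx, hy⟩, rfl⟩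
    have hy0 : y = 0 := by simpa using hy
    subst hy0
    simp only [derivSize, if_neg hℓ]
    refine (tensorNormH_le hK0.le hK).trans ?_
    gcongr
    exact hC ⟨x, hx, rfl⟩
  have h : derivSize H w a b ℓ j x 0 ≤ omega H w a b ℓ j a 0 :=
    le_csSup hb ⟨(x, 0), ⟨hx, by simp⟩, rfl⟩
  rwa [derivSize, if_neg hℓ] at h

end Omega

end BoundaryLaplace

/-! ### Vertical derivatives of `w`. -/

namespace BoundaryLaplace

section PartialDerivatives

variable {d : ℕ} {H : Matrix (Fin d) (Fin d) ℝ} {w : Vec d × ℝ → ℝ} {a b c : ℝ}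

lemma partialY_zero (x : Vec d) (y : ℝ) : partialY w b 0 x y = w (x, y) := by
  simp [partialY]

/-- Writing the one-sided vertical derivative as a component of the derivative within the product
set shows that it depends on `x` in a `C³` way. -/
lemma partialY_one_eq (hb : 0 < b)
    (hw : ContDiffOn ℝ 4 w (UH H a ×ˢ Icc 0 b)) {x : Vec d} (hx : x ∈ UH H a) :
    partialY w b 1 x 0 = fderivWithin ℝ w (UH H a ×ˢ Icc 0 b) (x, 0) (0, 1) := by
  have h0 : (0:ℝ) ∈ Icc 0 b := ⟨le_rfl, hb.le⟩
  rw [partialY, iteratedDerivWithin_one]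
  have h1 : HasDerivWithinAt (fun t : ℝ => (x, t)) ((0 : Vec d), (1:ℝ)) (Icc 0 b) 0 :=
    ((hasDerivAt_const (0:ℝ) x).prodMk (hasDerivAt_id (0:ℝ))).hasDerivWithinAt
  have h2 : HasFDerivWithinAt w (fderivWithin ℝ w (UH H a ×ˢ Icc 0 b) (x, 0))
      (UH H a ×ˢ Icc 0 b) (x, 0) :=
    (hw.differentiableOn (by norm_num) (x, 0) ⟨hx, h0⟩).hasFDerivWithinAt
  have h3 := h2.comp_hasDerivWithinAt (0:ℝ) h1 (fun t ht => ⟨hx, ht⟩)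
  exact h3.derivWithin (uniqueDiffOn_Icc hb 0 h0)

lemma contDiffOn_partialY_one (ha : UniqueDiffOn ℝ (UH H a)) (hb : 0 < b)
    (hw : ContDiffOn ℝ 4 w (UH H a ×ˢ Icc 0 b)) :
    ContDiffOn ℝ 3 (fun x => partialY w b 1 x 0) (UH H a) := by
  have h0 : (0:ℝ) ∈ Icc 0 b := ⟨le_rfl, hb.le⟩
  have h1 : ContDiffOn ℝ 3 (fderivWithin ℝ w (UH H a ×ˢ Icc 0 b)) (UH H a ×ˢ Icc 0 b) :=
    hw.fderivWithin (ha.prod (uniqueDiffOn_Icc hb)) (by norm_num)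
  have h2 : ContDiffOn ℝ 3 (fun x : Vec d => fderivWithin ℝ w (UH H a ×ˢ Icc 0 b) (x, 0) (0, 1))
      (UH H a) :=
    (h1.comp (f := fun x : Vec d => (x, (0:ℝ))) (by fun_prop) fun x hx => ⟨hx, h0⟩).clm_apply
      contDiffOn_const
  exact h2.congr fun x hx => partialY_one_eq hb hw hx

lemma contDiffOn_partialY_zero (hb : 0 < b) (hw : ContDiffOn ℝ 4 w (UH H a ×ˢ Icc 0 b)) :
    ContDiffOn ℝ 4 (fun x => partialY w b 0 x 0) (UH H a) := by
  simp only [partialY_zero]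
  exact hw.comp (f := fun x : Vec d => (x, (0:ℝ))) (by fun_prop) fun x hx => ⟨hx, le_rfl, hb.le⟩

/-- The second vertical derivative of a `C²` function, computed without restriction to a set. -/
noncomputable def secondY (w : Vec d × ℝ → ℝ) (u : Vec d × ℝ) : ℝ :=
  fderiv ℝ (fun p => fderiv ℝ w p (0, 1)) u (0, 1)

lemma hasDerivAt_vertical {f : Vec d × ℝ → ℝ} {x : Vec d} {t : ℝ}
    (hf : DifferentiableAt ℝ f (x, t)) :
    HasDerivAt (fun t => f (x, t)) (fderiv ℝ f (x, t) (0, 1)) t := by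
  have h1 : HasDerivAt (fun t : ℝ => (x, t)) ((0 : Vec d), (1:ℝ)) t :=
    (hasDerivAt_const t x).prodMk (hasDerivAt_id t)
  exact hf.hasFDerivAt.comp_hasDerivAt t h1

variable {O : Set (Vec d × ℝ)}

lemma contDiffOn_fderiv_vertical (hO : IsOpen O) (hw : ContDiffOn ℝ 2 w O) :
    ContDiffOn ℝ 1 (fun p => fderiv ℝ w p (0, 1)) O :=
  (hw.fderiv_of_isOpen hO (by norm_num)).clm_apply contDiffOn_const

lemma continuousOn_secondY (hO : IsOpen O) (hw : ContDiffOn ℝ 2 w O) :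
    ContinuousOn (secondY w) O :=
  ((contDiffOn_fderiv_vertical hO hw).continuousOn_fderiv_of_isOpen hO (by norm_num)).clm_apply
    continuousOn_const

/-- The right side does not involve the interval, so second vertical derivatives taken within
different intervals agree. -/
lemma partialY_two_eq (hO : IsOpen O) (hw : ContDiffOn ℝ 2 w O) (hc : 0 < c) {x : Vec d}
    (hx : ∀ t ∈ Icc 0 c, (x, t) ∈ O) {y : ℝ} (hy : y ∈ Icc 0 c) :
    partialY w c 2 x y = secondY w (x, y) := by
  have hu := uniqueDiffOn_Icc hc
  have h1 : ∀ t ∈ Icc 0 c, iteratedDerivWithin 1 (fun t => w (x, t)) (Icc 0 c) t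
      = fderiv ℝ w (x, t) (0, 1) := fun t ht => by
    rw [iteratedDerivWithin_one]
    exact (hasDerivAt_vertical ((hw.contDiffAt (hO.mem_nhds (hx t ht))).differentiableAt
      (by norm_num))).hasDerivWithinAt.derivWithin (hu t ht)
  rw [partialY, iteratedDerivWithin_succ, derivWithin_congr h1 (h1 y hy)]
  exact (hasDerivAt_vertical (((contDiffOn_fderiv_vertical hO hw).contDiffAt
    (hO.mem_nhds (hx y hy))).differentiableAt
      (by norm_num))).hasDerivWithinAt.derivWithin (hu y hy)

lemma derivSize_zero_two_eq (hO : IsOpen O) (hw : ContDiffOn ℝ 2 w O) (hc : 0 < c)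
    {p : Vec d × ℝ} (hx : ∀ t ∈ Icc 0 c, (p.1, t) ∈ O) (hy : p.2 ∈ Icc 0 c) :
    derivSize H w a c 0 2 p.1 p.2 = |secondY w p| := by
  rw [derivSize, if_pos rfl, partialY_two_eq hO hw hc hx hy]

lemma bddAbove_derivSize_zero_two (hH : H.PosDef) (hO : IsOpen O) (hw : ContDiffOn ℝ 2 w O)
    (hc : 0 < c) (hsub : UH H a ×ˢ Icc 0 c ⊆ O) :
    BddAbove ((fun p : Vec d × ℝ => derivSize H w a c 0 2 p.1 p.2) '' (UH H a ×ˢ Icc 0 c)) := by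
  have hcomp : IsCompact (UH H a ×ˢ Icc 0 c) := (isCompact_UH hH a).prod isCompact_Icc
  have := (hcomp.image_of_continuousOn ((continuousOn_secondY hO hw).mono hsub).abs).bddAbove
  rwa [image_congr (g := fun p => derivSize H w a c 0 2 p.1 p.2)] at this
  exact fun p hp => (derivSize_zero_two_eq hO hw hc (fun t ht => hsub ⟨hp.1, ht⟩) hp.2).symm

/-- Serves with `b = a²` and `c = a`: the smallness condition controls the supremum up to height
`a`, and the strip has height `a²`. Only `C²` regularity is available on the taller strip. -/
lemma omega_zero_two_mono (hH : H.PosDef) (ha : 0 ≤ a) (hO : IsOpen O) (hw : ContDiffOn ℝ 2 w O)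
    (hb : 0 < b) (hbc : b ≤ c) (hsub : UH H a ×ˢ Icc 0 c ⊆ O) :
    omega H w a b 0 2 a b ≤ omega H w a c 0 2 a c := by
  have hbd := bddAbove_derivSize_zero_two (H := H) hH hO hw (hb.trans_le hbc) hsub
  have hs : Icc (0:ℝ) b ⊆ Icc 0 c := Icc_subset_Icc_right hbc
  refine csSup_le ⟨_, (0, 0), ⟨zero_mem_UH ha, le_rfl, hb.le⟩, rfl⟩ ?_
  rintro _ ⟨p, hp, rfl⟩
  beta_reduce
  rw [derivSize_zero_two_eq hO hw hb (fun t ht => hsub ⟨hp.1, hs ht⟩) hp.2]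
  refine le_csSup hbd ⟨p, ⟨hp.1, hs hp.2⟩, ?_⟩
  exact derivSize_zero_two_eq hO hw (hb.trans_le hbc) (fun t ht => hsub ⟨hp.1, ht⟩) (hs hp.2)

/-- Second-order expansion in the vertical direction. -/
lemma abs_vertical_taylor_le (hH : H.PosDef) (hO : IsOpen O) (hw : ContDiffOn ℝ 2 w O)
    (hb : 0 < b) (hsub : UH H a ×ˢ Icc 0 b ⊆ O) {x : Vec d} (hx : x ∈ UH H a) {y : ℝ}
    (hy : y ∈ Icc 0 b) :
    |w (x, y) - w (x, 0) - partialY w b 1 x 0 * y| ≤ omega H w a b 0 2 a b * y ^ 2 := by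
  have hbd := bddAbove_derivSize_zero_two (H := H) hH hO hw hb hsub
  have hg : ContDiffOn ℝ (1 + 1) (fun t => w (x, t)) (Icc 0 b) := by
    rw [one_add_one_eq_two]
    exact hw.comp (f := fun t : ℝ => (x, t)) (by fun_prop) fun t ht => hsub ⟨hx, ht⟩
  have h := taylor_mean_remainder_bound (n := 1) (C := omega H w a b 0 2 a b) hb.le
    (by exact_mod_cast hg) hy fun t ht => by
      have : derivSize H w a b 0 2 x t ≤ omega H w a b 0 2 a b :=
        le_csSup hbd ⟨(x, t), ⟨hx, ht⟩, rfl⟩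
      rwa [derivSize, if_pos rfl] at this
  rw [taylorWithinEval_succ, taylor_within_zero_eval] at h
  simp only [Nat.factorial, Nat.cast_one, zero_add, mul_one, Nat.cast_zero, sub_zero, pow_one,
    smul_eq_mul, Real.norm_eq_abs, div_one] at h
  refine le_trans (le_of_eq ?_) h
  congr 1
  rw [partialY]; norm_num; ring

end PartialDerivatives

end BoundaryLaplace

/-! ### Geometry of `D` above the boundary graph, and the Hessian at the minimum. -/

namespace BoundaryLaplace

variable {d : ℕ} {D : Set (Vec d × ℝ)} {z : Vec d × ℝ → ℝ} {Ω : Set (Vec d)} {ψ : Vec d → ℝ}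
  {ρ₀ ρ₁ s : ℝ}

lemma hessH_quad (x : Vec d) : x ⬝ᵥ (hessH z ψ).mulVec x
    = fderiv ℝ (fderiv ℝ z) 0 (x, 0) (x, 0) + fderiv ℝ (fderiv ℝ ψ) 0 x x := by
  have hx : x = ∑ i, x i • (Pi.single i (1:ℝ) : Vec d) := by
    ext j; simp [Finset.sum_apply, Pi.single_apply]
  have hB : ∀ B : Vec d →L[ℝ] Vec d →L[ℝ] ℝ,
      B x x = ∑ i, ∑ j, x i * x j * B (Pi.single i 1) (Pi.single j 1) := by
    intro B
    conv_lhs => rw [hx]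
    simp only [map_sum, map_smul, sum_apply, smul_apply, smul_eq_mul, Finset.mul_sum]
    rw [Finset.sum_comm]
    refine Finset.sum_congr rfl fun i _ => Finset.sum_congr rfl fun j _ => by ring
  -- Composing with the inclusion, flipping and composing again restricts the Hessian of `z` to
  -- horizontal vectors in both slots.
  have h1 := hB (((fderiv ℝ (fderiv ℝ z) 0).comp (ContinuousLinearMap.inl ℝ (Vec d) ℝ)).flip.comp
    (ContinuousLinearMap.inl ℝ (Vec d) ℝ)).flip
  simp only [ContinuousLinearMap.flip_apply, ContinuousLinearMap.comp_apply,
    ContinuousLinearMap.inl_apply] at h1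
  rw [h1, hB, ← Finset.sum_add_distrib]
  simp only [dotProduct, Matrix.mulVec, hessH, Matrix.of_apply, iteratedFDeriv_two_apply,
    Matrix.cons_val_zero, Matrix.cons_val_one]
  refine Finset.sum_congr rfl fun i _ => ?_
  rw [Finset.mul_sum, ← Finset.sum_add_distrib]
  refine Finset.sum_congr rfl fun j _ => by ring

namespace Setting

variable (h : Setting D z Ω ψ ρ₀)
include h

lemma zero_mem_D : (0 : Vec d × ℝ) ∈ D := h.isClosed.frontier_subset h.zero_mem

lemma graph_mem {x : Vec d} (hx : x ∈ Ω) : (x, ψ x) ∈ D := by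
  have : (x, ψ x) ∈ frontier D ∩ Ω ×ˢ univ := by rw [h.boundary]; exact ⟨x, hx, rfl⟩
  exact h.isClosed.frontier_subset this.1

/-- The open vertical half-line above the graph is connected and misses the frontier of `D`, which
over `Ω` is the graph. It meets `D` inside the given strip, hence lies in `D` entirely, with no
bound on the height. -/
lemma above_mem {x : Vec d} (hx : x ∈ UH (hessH z ψ) ρ₀) {t : ℝ} (ht : ψ x ≤ t) : (x, t) ∈ D := by
  rcases ht.eq_or_lt with rfl | ht
  · exact h.graph_mem (h.UH_subset hx)
  by_contra hn
  have hc : IsPreconnected ((fun t : ℝ => (x, t)) '' Ioi (ψ x)) :=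
    isPreconnected_Ioi.image _ (by fun_prop)
  have h1 : (((fun t : ℝ => (x, t)) '' Ioi (ψ x)) ∩ D).Nonempty := by
    have hρ := h.ρ₀_pos
    refine ⟨(x, ψ x + ρ₀ / 2), ⟨_, by simp [hρ], rfl⟩, ?_⟩
    exact (h.strip_subset ⟨(x, ρ₀ / 2), ⟨hx, by constructor <;> simp <;> linarith⟩, rfl⟩).1
  have h2 : ∀ p ∈ (fun t : ℝ => (x, t)) '' Ioi (ψ x), p ∈ D → p ∈ interior D := by
    rintro _ ⟨t', ht', rfl⟩ hp
    by_contra hi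
    have : (x, t') ∈ frontier D ∩ Ω ×ˢ univ :=
      ⟨⟨subset_closure hp, hi⟩, h.UH_subset hx, mem_univ _⟩
    rw [h.boundary] at this
    obtain ⟨x', -, hx'⟩ := this
    rw [Prod.mk.injEq] at hx'
    obtain ⟨rfl, h3⟩ := hx'
    exact absurd ht' (by rw [← h3]; simp)
  obtain ⟨p, hp, hpD⟩ := h1
  obtain ⟨q, -, hq1, hq2⟩ := hc (interior D) Dᶜ isOpen_interior h.isClosed.isOpen_compl
    (fun p hp => (em (p ∈ D)).imp (h2 p hp) id) ⟨p, hp, h2 p hp hpD⟩ ⟨_, ⟨t, ht, rfl⟩, hn⟩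
  exact hq2 (interior_subset hq1)

/-- The preimage under `Theta` of the open domain of `z` is a neighbourhood of the closed
half-cylinder, so `w` is `C²` across `y = 0` as well. -/
lemma exists_open_domain : ∃ O : Set (Vec d × ℝ), IsOpen O ∧
    UH (hessH z ψ) ρ₀ ×ˢ Ici 0 ⊆ O ∧ ContDiffOn ℝ 2 (wFun z ψ) O := by
  obtain ⟨D₁, hD₁, hDD, hz⟩ := h.z_contDiff
  have hΘ : ContDiffOn ℝ 2 (Theta ψ) (Ω ×ˢ univ) := by
    refine ContDiffOn.prodMk contDiff_fst.contDiffOn (ContDiffOn.add ?_ contDiff_snd.contDiffOn)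
    exact h.ψ_contDiff.comp contDiff_fst.contDiffOn fun p hp => hp.1
  have hO : IsOpen (Ω ×ˢ (univ : Set ℝ) ∩ Theta ψ ⁻¹' D₁) :=
    hΘ.continuousOn.isOpen_inter_preimage (h.Ω_open.prod isOpen_univ) hD₁
  refine ⟨_, hO, ?_, hz.comp (hΘ.mono inter_subset_left) fun p hp => hp.2⟩
  rintro ⟨x, y⟩ ⟨hx, hy⟩
  refine ⟨⟨h.UH_subset hx, mem_univ _⟩, hDD ?_⟩
  have hy' : 0 ≤ y := hy
  exact h.above_mem hx (by linarith)

lemma wFun_zero : wFun z ψ (0, 0) = z 0 := by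
  simp [wFun, Theta, h.ψ_zero]; rfl

/-- First and second derivative at `0` of `x ↦ z(x, ψ(x))`. -/
lemma graph_derivatives : ∃ (Φ : Vec d → Vec d →L[ℝ] ℝ) (Φ' : Vec d →L[ℝ] Vec d →L[ℝ] ℝ),
    (∀ᶠ x in nhds 0, HasFDerivAt (fun x => wFun z ψ (x, 0)) (Φ x) x) ∧ Φ 0 = 0 ∧
    HasFDerivAt Φ Φ' 0 ∧ ∀ x, Φ' x x = x ⬝ᵥ (hessH z ψ).mulVec x := by
  obtain ⟨D₁, hD₁, hDD, hz⟩ := h.z_contDiff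
  have e0 : ((0 : Vec d), ψ 0) = 0 := by rw [h.ψ_zero]; rfl
  have hψ0 : ContDiffAt ℝ 2 ψ 0 := h.ψ_contDiff.contDiffAt (h.Ω_open.mem_nhds h.zero_mem_Ω)
  have hz0 : ContDiffAt ℝ 2 z ((0 : Vec d), ψ 0) := by
    rw [e0]; exact hz.contDiffAt (hD₁.mem_nhds (hDD h.zero_mem_D))
  have hψc : ContinuousAt (fun x => (x, ψ x)) (0 : Vec d) := continuousAt_id.prodMk hψ0.continuousAt
  set Φ : Vec d → Vec d →L[ℝ] ℝ := fun x =>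
    (fderiv ℝ z (x, ψ x)).comp (ContinuousLinearMap.inl ℝ (Vec d) ℝ + (ContinuousLinearMap.inr ℝ (Vec d) ℝ).comp (fderiv ℝ ψ x)) with hΦ
  have hz1 : DifferentiableAt ℝ (fderiv ℝ z) ((0 : Vec d), ψ 0) :=
    (hz0.fderiv_right (m := 1) (by norm_num)).differentiableAt (by norm_num)
  have hψ1 : DifferentiableAt ℝ (fderiv ℝ ψ) 0 :=
    (hψ0.fderiv_right (m := 1) (by norm_num)).differentiableAt (by norm_num)
  have hg : HasFDerivAt (fun x => (x, ψ x))
      ((ContinuousLinearMap.id ℝ (Vec d)).prod (fderiv ℝ ψ 0)) (0 : Vec d) :=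
    (hasFDerivAt_id _).prodMk (hψ0.differentiableAt (by norm_num)).hasFDerivAt
  have hA : HasFDerivAt (fun x => fderiv ℝ z (x, ψ x)) _ (0 : Vec d) := hz1.hasFDerivAt.comp 0 hg
  have hB : HasFDerivAt (fun x => ContinuousLinearMap.inl ℝ (Vec d) ℝ +
      (ContinuousLinearMap.inr ℝ (Vec d) ℝ).comp (fderiv ℝ ψ x))
      ((ContinuousLinearMap.compL ℝ (Vec d) ℝ (Vec d × ℝ) (ContinuousLinearMap.inr ℝ (Vec d) ℝ)).comp
        (fderiv ℝ (fderiv ℝ ψ) 0)) (0 : Vec d) :=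
    ((ContinuousLinearMap.hasFDerivAt (ContinuousLinearMap.compL ℝ (Vec d) ℝ (Vec d × ℝ)
      (ContinuousLinearMap.inr ℝ (Vec d) ℝ))).comp 0 hψ1.hasFDerivAt).const_add _
  refine ⟨Φ, _, ?_, ?_, hA.clm_comp hB, fun x => ?_⟩
  · have h1 : ∀ᶠ x in nhds (0 : Vec d), ContDiffAt ℝ 2 z (x, ψ x) :=
      hψc.eventually (hz0.eventually (by norm_num))
    filter_upwards [h1, hψ0.eventually (by norm_num)] with x hx1 hx2
    have h2 : HasFDerivAt (fun x => (x, ψ x))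
        ((ContinuousLinearMap.id ℝ (Vec d)).prod (fderiv ℝ ψ x)) x :=
      (hasFDerivAt_id _).prodMk (hx2.differentiableAt (by norm_num)).hasFDerivAt
    have h3 := (hx1.differentiableAt (by norm_num)).hasFDerivAt.comp x h2
    have h4 : (ContinuousLinearMap.id ℝ (Vec d)).prod (fderiv ℝ ψ x)
        = ContinuousLinearMap.inl ℝ (Vec d) ℝ +
          (ContinuousLinearMap.inr ℝ (Vec d) ℝ).comp (fderiv ℝ ψ x) := by ext v <;> simp
    rw [h4] at h3
    simpa only [wFun, Theta, Function.comp_def, add_zero] using h3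
  · ext x; simp [hΦ, e0, h.z_gradient, h.ψ_gradient]
  -- Since `∇ψ(0) = 0` the mixed terms vanish, and since `∂_t z(0) = 1` the Hessian of `ψ` enters
  -- with coefficient one. This is why `H` is the sum of the two Hessians.
  · rw [hessH_quad]
    simp [e0, h.z_gradient, h.ψ_gradient]
    ring

end Setting

end BoundaryLaplace

/-! ### Growth of `z` on `D`. -/

namespace BoundaryLaplace

variable {d : ℕ} {D : Set (Vec d × ℝ)} {z : Vec d × ℝ → ℝ} {Ω : Set (Vec d)} {ψ : Vec d → ℝ}
  {ρ₀ ρ₁ s : ℝ}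

namespace Setting

variable (h : Setting D z Ω ψ ρ₀)
include h

lemma differentiableAt_of_mem {u : Vec d × ℝ} (hu : u ∈ D) : DifferentiableAt ℝ z u := by
  obtain ⟨D₁, hD₁, hDD, hz⟩ := h.z_contDiff
  exact (hz.contDiffAt (hD₁.mem_nhds (hDD hu))).differentiableAt (by norm_num)

lemma continuousOn_dt : ContinuousOn (dt z) D := by
  obtain ⟨D₁, hD₁, hDD, hz⟩ := h.z_contDiff
  exact ((hz.continuousOn_fderiv_of_isOpen hD₁ (by norm_num)).clm_apply
    continuousOn_const).mono hDD

lemma dt_zero : dt z 0 = 1 := by rw [dt, h.z_gradient]; rfl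

lemma isCompact_UH1 (r : ℝ) : IsCompact (UH1 D (hessH z ψ) r) := by
  have hH := h.H_posDef
  refine Metric.isCompact_of_isClosed_isBounded (h.isClosed.inter ?_) ?_
  · refine isClosed_le ?_ continuous_const
    unfold normH1 dotProduct Matrix.mulVec dotProduct; fun_prop
  · obtain ⟨K, hK0, hK⟩ := exists_norm_le_normH hH
    refine (Metric.isBounded_iff_subset_closedBall 0).2 ⟨max (K * r) r, ?_⟩
    rintro ⟨x, t⟩ ⟨-, hu⟩
    have hu' : normH1 (hessH z ψ) (x, t) ≤ r := hu
    have hq : 0 ≤ x ⬝ᵥ (hessH z ψ).mulVec x := by rw [← normH_sq hH]; positivity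
    have h1 : normH (hessH z ψ) x ≤ r :=
      le_trans (Real.sqrt_le_sqrt (by simp only; nlinarith [sq_nonneg t])) hu'
    have h2 : |t| ≤ r := le_trans (Real.abs_le_sqrt (by simp only; nlinarith)) hu'
    rw [mem_closedBall_zero_iff, Prod.norm_def]
    exact max_le_max ((hK x).trans (by gcongr)) h2

lemma bddBelow_dt {r : ℝ} (hr : r ≤ ρ₀) : BddBelow (dt z '' UH1 D (hessH z ψ) r) := by
  refine ⟨0, ?_⟩
  rintro _ ⟨u, hu, rfl⟩
  exact (h.dt_pos u ⟨hu.1, le_trans hu.2 hr⟩).le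

lemma zero_mem_UH1 {r : ℝ} (hr : 0 ≤ r) : (0 : Vec d × ℝ) ∈ UH1 D (hessH z ψ) r := by
  refine ⟨h.zero_mem_D, ?_⟩
  change normH1 _ _ ≤ r
  simpa [normH1] using hr

lemma graph_pos {x : Vec d} (hx : x ∈ Ω) (hx0 : x ≠ 0) : z 0 < z (x, ψ x) :=
  h.argmin _ (h.graph_mem hx) fun e => hx0 (congrArg Prod.fst e)

lemma bddBelow_ratio {r : ℝ} (hr : r ≤ ρ₀) :
    BddBelow ((fun x => (z (x, ψ x) - z 0) / (normH (hessH z ψ) x ^ 2 / 2)) ''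
      (UH (hessH z ψ) r \ {0})) := by
  refine ⟨0, ?_⟩
  rintro _ ⟨x, hx, rfl⟩
  have := h.graph_pos (h.UH_subset (UH_mono hr hx.1)) hx.2
  exact div_nonneg (by linarith) (by positivity)

/-- Near `0` the function on the boundary grows quadratically. -/
lemma exists_quadratic_growth : ∃ δ > 0, ∀ x : Vec d, ‖x‖ < δ →
    normH (hessH z ψ) x ^ 2 / 4 ≤ z (x, ψ x) - z 0 := by
  have hH := h.H_posDef
  obtain ⟨Φ, Φ', h1, h2, h3, h4⟩ := h.graph_derivatives
  obtain ⟨K, hK0, hK⟩ := exists_norm_le_normH hH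
  -- With this tolerance the deviation from the quadratic model is at most `‖x‖_H² / 4`, half of the
  -- model `‖x‖_H² / 2`.
  have hc : 0 < 1 / (4 * K ^ 2) := by positivity
  have h5 := h3.isLittleO.bound hc
  obtain ⟨δ, hδ, hball⟩ := Metric.eventually_nhds_iff_ball.1 (h1.and h5)
  refine ⟨δ, hδ, fun x hx => ?_⟩
  have hmem : ∀ t ∈ Icc (0:ℝ) 1, t • x ∈ Metric.ball (0 : Vec d) δ := by
    intro t ht
    rw [mem_ball_zero_iff, norm_smul, Real.norm_of_nonneg ht.1]
    nlinarith [norm_nonneg x, ht.1, ht.2]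
  set Q := x ⬝ᵥ (hessH z ψ).mulVec x with hQ
  have hd : ∀ t ∈ Icc (0:ℝ) 1, HasDerivWithinAt
      (fun t : ℝ => wFun z ψ (t • x, 0) - t ^ 2 / 2 * Q) (Φ (t • x) x - t * Q) (Icc 0 1) t := by
    intro t ht
    have e1 : HasDerivAt (fun t : ℝ => t • x) x t := by
      simpa using (hasDerivAt_id t).smul_const x
    have e0 : HasFDerivAt (fun x => wFun z ψ (x, 0)) (Φ (t • x)) (t • x) :=
      (hball _ (hmem t ht)).1
    have e2 : HasDerivAt (fun t : ℝ => wFun z ψ (t • x, 0)) (Φ (t • x) x) t := by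
      have := e0.comp_hasDerivAt t e1
      exact this
    have e3 : HasDerivAt (fun t : ℝ => t ^ 2 / 2 * Q) (t * Q) t := by
      refine ((((hasDerivAt_id t).pow 2).div_const 2).mul_const Q).congr_deriv ?_
      simp
    exact (e2.sub e3).hasDerivWithinAt
  have hb : ∀ t ∈ Ico (0:ℝ) 1, ‖Φ (t • x) x - t * Q‖ ≤ 1 / (4 * K ^ 2) * ‖x‖ ^ 2 := by
    intro t ht
    have e := (hball _ (hmem t ⟨ht.1, ht.2.le⟩)).2
    rw [h2, sub_zero, sub_zero, norm_smul, Real.norm_of_nonneg ht.1] at e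
    have e2 : Φ (t • x) x - t * Q = (Φ (t • x) - Φ' (t • x)) x := by
      rw [hQ, ← h4]; simp
    rw [e2]
    refine (ContinuousLinearMap.le_opNorm _ _).trans ?_
    calc _ ≤ 1 / (4 * K ^ 2) * (t * ‖x‖) * ‖x‖ := by gcongr
      _ ≤ 1 / (4 * K ^ 2) * (1 * ‖x‖) * ‖x‖ := by gcongr; exact ht.2.le
      _ = _ := by ring
  have key := norm_image_sub_le_of_norm_deriv_le_segment_01' hd hb
  have e6 : wFun z ψ (x, 0) = z (x, ψ x) := by simp [wFun, Theta]
  simp only [one_smul, zero_smul, h.wFun_zero, e6] at key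
  have e7 : 1 / (4 * K ^ 2) * ‖x‖ ^ 2 ≤ Q / 4 := by
    rw [hQ, ← normH_sq hH]
    calc _ ≤ 1 / (4 * K ^ 2) * (K * normH (hessH z ψ) x) ^ 2 := by gcongr; exact hK x
      _ = _ := by field_simp
  rw [Real.norm_eq_abs, abs_le] at key
  rw [normH_sq hH, ← hQ]
  linarith [key.1]

/-- Compactness settles the slope. The ratio is at least `1/2` near the origin by quadratic growth,
and away from it is bounded below by compactness and uniqueness of the minimizer. The condition `1 ≤
d` excludes an empty infimum, which would be `0` by convention. -/
lemma Cmin_pos (hd : 1 ≤ d) (h0 : 0 < ρ₁) (h1 : ρ₁ ≤ ρ₀) : 0 < Cmin D z ψ ρ₁ := by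
  have hH := h.H_posDef
  refine lt_min ?_ ?_
  · have hne : (UH1 D (hessH z ψ) ρ₁).Nonempty := ⟨0, h.zero_mem_UH1 h0.le⟩
    obtain ⟨u, hu, hmin⟩ := (h.isCompact_UH1 ρ₁).exists_isMinOn hne
      (h.continuousOn_dt.mono fun u hu => hu.1)
    refine (h.dt_pos u ⟨hu.1, le_trans hu.2 h1⟩).trans_le (le_csInf (hne.image _) ?_)
    rintro _ ⟨v, hv, rfl⟩
    exact hmin hv
  · obtain ⟨δ, hδ, hq⟩ := h.exists_quadratic_growth
    have hne : (UH (hessH z ψ) ρ₁ \ {0}).Nonempty := by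
      set e : Vec d := fun _ => 1
      have he : e ≠ 0 := fun he => one_ne_zero (congrFun he ⟨0, hd⟩)
      have hp := normH_pos hH he
      refine ⟨(ρ₁ / normH (hessH z ψ) e) • e, ?_, ?_⟩
      · change normH _ _ ≤ ρ₁
        rw [normH_smul hH, abs_of_pos (by positivity), div_mul_cancel₀ _ hp.ne']
      · simp only [mem_singleton_iff, smul_eq_zero, not_or]
        exact ⟨by positivity, he⟩
    have hcont : ContinuousOn (fun x => z (x, ψ x) - z 0) (UH (hessH z ψ) ρ₁ \ Metric.ball 0 δ) := by
      obtain ⟨D₁, hD₁, hDD, hz⟩ := h.z_contDiff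
      have hsub : UH (hessH z ψ) ρ₁ \ Metric.ball 0 δ ⊆ Ω := fun x hx =>
        h.UH_subset (UH_mono h1 hx.1)
      exact (hz.continuousOn.comp (continuousOn_id.prodMk (h.ψ_contDiff.continuousOn.mono hsub))
        fun x hx => hDD (h.graph_mem (hsub hx))).sub continuousOn_const
    have hcomp : IsCompact (UH (hessH z ψ) ρ₁ \ Metric.ball 0 δ) :=
      (isCompact_UH hH ρ₁).diff Metric.isOpen_ball
    obtain ⟨m, hm, hmin⟩ : ∃ m > 0, ∀ x ∈ UH (hessH z ψ) ρ₁ \ Metric.ball 0 δ,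
        m ≤ z (x, ψ x) - z 0 := by
      rcases (UH (hessH z ψ) ρ₁ \ Metric.ball 0 δ).eq_empty_or_nonempty with he | hne
      · exact ⟨1, one_pos, fun x hx => by rw [he] at hx; exact hx.elim⟩
      · obtain ⟨x, hx, hmin⟩ := hcomp.exists_isMinOn hne hcont
        refine ⟨_, sub_pos.2 (h.graph_pos (h.UH_subset (UH_mono h1 hx.1)) ?_), fun y hy => hmin hy⟩
        rintro rfl
        exact hx.2 (Metric.mem_ball_self hδ)
    refine (by positivity : 0 < min (1 / 2) (m / (ρ₁ ^ 2 / 2))).trans_le (le_csInf (hne.image _) ?_)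
    rintro _ ⟨x, hx, rfl⟩
    have hp := normH_pos hH hx.2
    have hle : normH (hessH z ψ) x ≤ ρ₁ := hx.1
    by_cases hxδ : ‖x‖ < δ
    · refine (min_le_left _ _).trans ?_
      rw [le_div_iff₀ (by positivity)]
      linarith [hq x hxδ]
    · refine (min_le_right _ _).trans ?_
      have := hmin x ⟨hx.1, by simpa using hxδ⟩
      beta_reduce
      gcongr
      linarith

/-- The slope at the origin is `1`. This is what makes `12 / C_min`, and hence `R`, at least `12`.
-/
lemma Cmin_le_one (h0 : 0 < ρ₁) (h1 : ρ₁ ≤ ρ₀) : Cmin D z ψ ρ₁ ≤ 1 := by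
  refine (min_le_left _ _).trans ?_
  rw [← h.dt_zero]
  exact csInf_le (h.bddBelow_dt h1) ⟨0, h.zero_mem_UH1 h0.le, rfl⟩

lemma Cmin_le_dt (h1 : ρ₁ ≤ ρ₀) {u : Vec d × ℝ} (hu : u ∈ UH1 D (hessH z ψ) ρ₁) :
    Cmin D z ψ ρ₁ ≤ dt z u :=
  (min_le_left _ _).trans (csInf_le (h.bddBelow_dt h1) ⟨u, hu, rfl⟩)

lemma Cmin_mul_le (h1 : ρ₁ ≤ ρ₀) {x : Vec d} (hx : x ∈ UH (hessH z ψ) ρ₁) :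
    Cmin D z ψ ρ₁ * (normH (hessH z ψ) x ^ 2 / 2) ≤ z (x, ψ x) - z 0 := by
  by_cases hx0 : x = 0
  · subst hx0
    rw [normH_zero, h.ψ_zero]
    simp [show ((0 : Vec d), (0:ℝ)) = 0 from rfl]
  · have hp := normH_pos h.H_posDef hx0
    rw [← le_div_iff₀ (by positivity)]
    exact (min_le_right _ _).trans (csInf_le (h.bddBelow_ratio h1) ⟨x, ⟨hx, hx0⟩, rfl⟩)

/-- Growth of `z` on vertical segments inside `U_{H,1}(ρ₁)`. -/
lemma Cmin_mul_sub_le (h1 : ρ₁ ≤ ρ₀) {x : Vec d} {t₁ t₂ : ℝ} (ht : t₁ ≤ t₂)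
    (hseg : ∀ t ∈ Icc t₁ t₂, (x, t) ∈ UH1 D (hessH z ψ) ρ₁) :
    Cmin D z ψ ρ₁ * (t₂ - t₁) ≤ z (x, t₂) - z (x, t₁) := by
  have hd : ∀ t ∈ Icc t₁ t₂, HasDerivAt (fun t => z (x, t)) (dt z (x, t)) t := fun t ht =>
    hasDerivAt_vertical (h.differentiableAt_of_mem (hseg t ht).1)
  refine (convex_Icc t₁ t₂).mul_sub_le_image_sub_of_le_deriv
    (fun t ht => (hd t ht).continuousAt.continuousWithinAt)
    (fun t ht => (hd t (interior_subset ht)).differentiableAt.differentiableWithinAt)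
    (fun t ht => ?_) t₁ (left_mem_Icc.2 ht) t₂ (right_mem_Icc.2 ht) ht
  rw [(hd t (interior_subset ht)).deriv]
  exact h.Cmin_le_dt h1 (hseg t (interior_subset ht))

/-- Every point of `D` satisfies one of two growth bounds. -/
theorem growth_dichotomy (hd : 1 ≤ d) (hg : GlobalGrowth D z ψ ρ₀ ρ₁ s) {u : Vec d × ℝ}
    (hu : u ∈ D) :
    (s * ρ₁ ≤ z u - z 0 ∧ s * normH1 (hessH z ψ) u ≤ z u - z 0) ∨
    (u.1 ∈ UH (hessH z ψ) ρ₁ ∧ ψ u.1 ≤ u.2 ∧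
      Cmin D z ψ ρ₁ * (u.2 - ψ u.1) + Cmin D z ψ ρ₁ * (normH (hessH z ψ) u.1 ^ 2 / 2)
        ≤ z u - z 0) := by
  have hH := h.H_posDef
  have hρ := hg.ρ₁_lt.le
  by_cases hu1 : u ∈ UH1 D (hessH z ψ) ρ₁
  swap
  · left
    have h1 := hg.growth u ⟨hu, hu1⟩
    have h2 : ρ₁ < normH1 (hessH z ψ) u := not_le.1 fun h2 => hu1 ⟨hu, h2⟩
    exact ⟨le_trans (mul_le_mul_of_nonneg_left h2.le hg.s_pos.le) h1, h1⟩
  obtain ⟨x, t⟩ := u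
  have hn : normH1 (hessH z ψ) (x, t) ≤ ρ₁ := hu1.2
  set q := x ⬝ᵥ (hessH z ψ).mulVec x with hq
  have hq0 : 0 ≤ q := by rw [hq, ← normH_sq hH]; positivity
  have hin : ∀ τ : ℝ, normH1 (hessH z ψ) (x, τ) ≤ ρ₁ ↔ τ ^ 2 ≤ ρ₁ ^ 2 - q := by
    intro τ
    rw [normH1, Real.sqrt_le_left hg.ρ₁_pos.le]
    simp only [← hq]
    constructor <;> intro h <;> linarith
  have ht2 := (hin t).1 hn
  have hx : x ∈ UH (hessH z ψ) ρ₁ := by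
    change Real.sqrt _ ≤ ρ₁
    rw [Real.sqrt_le_left hg.ρ₁_pos.le]
    nlinarith [sq_nonneg t]
  have hx0 := UH_mono hρ hx
  have hψt : ψ x ≤ t := by
    obtain ⟨⟨x', y⟩, ⟨-, hy⟩, he⟩ := h.subset_above ⟨hu, hx0, mem_univ t⟩
    simp only [Theta, Prod.mk.injEq] at he
    obtain ⟨rfl, rfl⟩ := he
    have : 0 ≤ y := hy
    linarith
  have hCpos := h.Cmin_pos hd hg.ρ₁_pos hρ
  -- The vertical line over `x` meets the ball of radius `ρ₁` in heights `[-τ, τ]`. What matters is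
  -- whether the boundary graph at `x` lies below this range.
  set τ := Real.sqrt (ρ₁ ^ 2 - q) with hτ
  have hτ2 : τ ^ 2 = ρ₁ ^ 2 - q := Real.sq_sqrt (le_trans (sq_nonneg t) ht2)
  have hτ0 : 0 ≤ τ := Real.sqrt_nonneg _
  have htτ : |t| ≤ τ := Real.abs_le_sqrt ht2
  have hseg : ∀ r, -τ ≤ r → ψ x ≤ r → r ≤ t → (x, r) ∈ UH1 D (hessH z ψ) ρ₁ := by
    intro r hr1 hr2 hr3
    refine ⟨h.above_mem hx0 hr2, (hin r).2 ?_⟩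
    rw [← hτ2]
    exact sq_le_sq' hr1 (hr3.trans ((le_abs_self t).trans htτ))
  -- If it does not, the whole segment from the boundary up to the point stays in the ball and the
  -- slope bound applies along it. If it does, the segment starts instead at the exit point `(x,
  -- -τ)`, which lies in `D`.
  by_cases hcase : -τ ≤ ψ x
  · right
    refine ⟨hx, hψt, ?_⟩
    have e1 := h.Cmin_mul_sub_le hρ hψt fun r hr => hseg r (hcase.trans hr.1) hr.1 hr.2
    have e2 := h.Cmin_mul_le hρ hx
    simp only
    linarith
  · left
    push Not at hcase
    have hτt : -τ ≤ t := by linarith [neg_abs_le t]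
    have e1 := h.Cmin_mul_sub_le hρ hτt fun r hr => hseg r hr.1 (hcase.le.trans hr.1) hr.2
    have hmemτ : (x, -τ) ∈ D := h.above_mem hx0 hcase.le
    -- Points of `D` just below the exit point are outside the ball, where global growth holds; the
    -- bound passes to the limit. The slope bound then carries it up to height `t`.
    have e2 : s * ρ₁ ≤ z (x, -τ) - z 0 := by
      have hc : ContinuousAt (fun r => z (x, r) - z 0) (-τ) :=
        (hasDerivAt_vertical (h.differentiableAt_of_mem hmemτ)).continuousAt.sub continuousAt_const
      refine ge_of_tendsto (hc.tendsto.mono_left (nhdsWithin_le_nhds (s := Iio (-τ)))) ?_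
      filter_upwards [Ioo_mem_nhdsLT hcase] with r hr
      have hrD : (x, r) ∈ D := h.above_mem hx0 hr.1.le
      have hr2 : ¬ normH1 (hessH z ψ) (x, r) ≤ ρ₁ := by
        rw [hin, ← hτ2, not_le]
        nlinarith [hr.2]
      have e3 := hg.growth (x, r) ⟨hrD, fun h => hr2 h.2⟩
      exact le_trans (mul_le_mul_of_nonneg_left (not_le.1 hr2).le hg.s_pos.le) e3
    have e4 : 0 ≤ Cmin D z ψ ρ₁ * (t - -τ) := mul_nonneg hCpos.le (by linarith)
    have e5 : s * ρ₁ ≤ z (x, t) - z 0 := by linarith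
    exact ⟨e5, le_trans (mul_le_mul_of_nonneg_left hn hg.s_pos.le) e5⟩

end Setting

end BoundaryLaplace

/-! ### Taylor expansions of `w(x, 0)` and of `∂_y w(x, 0)`. -/

namespace BoundaryLaplace

variable {d : ℕ} {D : Set (Vec d × ℝ)} {z : Vec d × ℝ → ℝ} {Ω : Set (Vec d)} {ψ : Vec d → ℝ}
  {ρ₀ ρ₁ s a b : ℝ}

lemma zero_mem_interior_UH {H : Matrix (Fin d) (Fin d) ℝ} (ha : 0 < a) : UH H a ∈ nhds (0 : Vec d) := by
  have : {x : Vec d | normH H x < a} ∈ nhds (0 : Vec d) :=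
    (isOpen_lt continuous_normH continuous_const).mem_nhds (by simpa [normH_zero] using ha)
  exact Filter.mem_of_superset this fun x (hx : normH H x < a) => hx.le

namespace Setting

variable (h : Setting D z Ω ψ ρ₀)
include h

lemma iteratedFDerivWithin_graph_one (ha : 0 < a) (x : Vec d) :
    iteratedFDerivWithin ℝ 1 (fun x => wFun z ψ (x, 0)) (UH (hessH z ψ) a) 0 (fun _ => x) = 0 := by
  obtain ⟨Φ, Φ', h1, h2, -, -⟩ := h.graph_derivatives
  have hu := uniqueDiffOn_UH h.H_posDef ha 0 (zero_mem_UH ha.le)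
  rw [iteratedFDerivWithin_one_apply hu, h1.self_of_nhds.hasFDerivWithinAt.fderivWithin hu, h2]
  simp

lemma iteratedFDerivWithin_graph_two (ha : 0 < a)
    (hw : ContDiffOn ℝ 4 (fun x => wFun z ψ (x, 0)) (UH (hessH z ψ) a)) (x : Vec d) :
    iteratedFDerivWithin ℝ 2 (fun x => wFun z ψ (x, 0)) (UH (hessH z ψ) a) 0 (fun _ => x)
      = normH (hessH z ψ) x ^ 2 := by
  obtain ⟨Φ, Φ', h1, -, h3, h4⟩ := h.graph_derivatives
  have hc : ContDiffAt ℝ 2 (fun x => wFun z ψ (x, 0)) 0 :=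
    (hw.contDiffAt (zero_mem_interior_UH ha)).of_le (by norm_num)
  rw [iteratedFDerivWithin_eq_iteratedFDeriv (uniqueDiffOn_UH h.H_posDef ha) hc
    (zero_mem_UH ha.le), iteratedFDeriv_two_apply]
  have e : fderiv ℝ (fun x => wFun z ψ (x, 0)) =ᶠ[nhds 0] Φ := by
    filter_upwards [h1] with x hx using hx.fderiv
  rw [e.fderiv_eq, h3.fderiv, h4, normH_sq h.H_posDef]

/-- Fourth-order expansion of `x ↦ z(x, ψ(x))`. -/
theorem graph_expansion (ha : 0 < a) (hb : 0 < b)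
    (hw : ContDiffOn ℝ 4 (wFun z ψ) (UH (hessH z ψ) a ×ˢ Icc 0 b)) {x : Vec d}
    (hx : x ∈ UH (hessH z ψ) a) :
    |wFun z ψ (x, 0) - z 0 - normH (hessH z ψ) x ^ 2 / 2
        - mixedDeriv (hessH z ψ) (wFun z ψ) a b 3 0 0 0 (fun _ => x) / 6|
      ≤ omega (hessH z ψ) (wFun z ψ) a b 4 0 a 0 * normH (hessH z ψ) x ^ 4 := by
  have hH := h.H_posDef
  have hf := contDiffOn_partialY_zero hb hw
  have key := taylor_ray (n := 3) hH ha hf hx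
    (C := omega (hessH z ψ) (wFun z ψ) a b 4 0 a 0 * normH (hessH z ψ) x ^ 4) fun t ht => by
      have := abs_mixedDeriv_le (ℓ := 4) (j := 0) hH ha (by norm_num) hf (smul_mem_UH hH hx ht)
        (fun _ => x)
      simpa [mixedDeriv] using this
  simp only [partialY_zero] at hf
  refine le_trans (le_of_eq ?_) key
  have e1 := h.iteratedFDerivWithin_graph_one ha x
  have e2 := h.iteratedFDerivWithin_graph_two ha hf x
  simp only [Finset.sum_range_succ, Finset.sum_range_zero, mixedDeriv, partialY_zero, e1, e2,
    iteratedFDerivWithin_zero_apply, h.wFun_zero]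
  congr 1
  norm_num [Nat.factorial]
  ring

/-- First-order expansion of `x ↦ ∂_y w(x, 0)`. -/
theorem slope_expansion (ha : 0 < a) (hb : 0 < b)
    (hw : ContDiffOn ℝ 4 (wFun z ψ) (UH (hessH z ψ) a ×ˢ Icc 0 b)) :
    ∃ ℓ : Vec d →L[ℝ] ℝ,
      (∀ x, |ℓ x| ≤ omega (hessH z ψ) (wFun z ψ) a b 1 1 0 0 * normH (hessH z ψ) x) ∧
      ∀ x ∈ UH (hessH z ψ) a, |partialY (wFun z ψ) b 1 x 0 - 1 - ℓ x|
        ≤ omega (hessH z ψ) (wFun z ψ) a b 2 1 a 0 * normH (hessH z ψ) x ^ 2 := by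
  have hH := h.H_posDef
  have hu := uniqueDiffOn_UH h.H_posDef ha 0 (zero_mem_UH ha.le)
  have hf := contDiffOn_partialY_one (uniqueDiffOn_UH hH ha) hb hw
  set ℓ := fderivWithin ℝ (fun x => partialY (wFun z ψ) b 1 x 0) (UH (hessH z ψ) a) 0
  have hℓ : ∀ x, mixedDeriv (hessH z ψ) (wFun z ψ) a b 1 1 0 0 (fun _ => x) = ℓ x := fun x => by
    rw [mixedDeriv, iteratedFDerivWithin_one_apply hu]
  refine ⟨ℓ, fun x => ?_, fun x hx => ?_⟩
  · have := abs_mixedDeriv_zero_le (w := wFun z ψ) (a := a) (b := b) (ℓ := 1) hH (by norm_num) 1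
      (fun _ => x)
    rw [hℓ] at this
    simpa using this
  · have hf2 : ContDiffOn ℝ (1 + 1 : ℕ) (fun x => partialY (wFun z ψ) b 1 x 0)
        (UH (hessH z ψ) a) := hf.of_le (by norm_num)
    have key := taylor_ray (n := 1) hH ha hf2 hx
      (C := omega (hessH z ψ) (wFun z ψ) a b 2 1 a 0 * normH (hessH z ψ) x ^ 2) fun t ht => by
        have := abs_mixedDeriv_le (ℓ := 2) (j := 1) hH ha (by norm_num) hf2 (smul_mem_UH hH hx ht)
          (fun _ => x)
        simpa [mixedDeriv] using this
    have e0 : partialY (wFun z ψ) b 1 0 0 = 1 := by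
      rw [partialY, iteratedDerivWithin_one]
      have e1 : HasDerivAt (fun t => z ((0 : Vec d), t)) (fderiv ℝ z ((0 : Vec d), (0:ℝ)) (0, 1)) 0 :=
        hasDerivAt_vertical (h.differentiableAt_of_mem h.zero_mem_D)
      have e2 : (fun t : ℝ => wFun z ψ ((0 : Vec d), t)) = fun t => z ((0 : Vec d), t) := by
        ext t; simp [wFun, Theta, h.ψ_zero]
      rw [e2, e1.hasDerivWithinAt.derivWithin (uniqueDiffOn_Icc hb 0 ⟨le_rfl, hb.le⟩)]
      exact h.dt_zero
    have e3 := hℓ x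
    rw [mixedDeriv] at e3
    simpa [Finset.sum_range_succ, e0, e3, sub_sub] using key

end Setting

end BoundaryLaplace

/-! ### The shear and the contribution away from the boundary strip. -/

namespace BoundaryLaplace

section Shear

variable {d : ℕ}

/-- The shear `(x, y) ↦ (x, g(x) + y)`. -/
noncomputable def shear (g : Vec d → ℝ) (hg : Measurable g) : Vec d × ℝ ≃ᵐ Vec d × ℝ where
  toFun p := (p.1, g p.1 + p.2)
  invFun p := (p.1, p.2 - g p.1)
  left_inv p := by simp
  right_inv p := by simp
  measurable_toFun := measurable_fst.prodMk ((hg.comp measurable_fst).add measurable_snd)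
  measurable_invFun := measurable_fst.prodMk (measurable_snd.sub (hg.comp measurable_fst))

/-- On each vertical fibre the map is a translation, so measurability of `g` suffices and no
Jacobian appears. -/
lemma measurePreserving_shear (g : Vec d → ℝ) (hg : Measurable g) :
    MeasurePreserving (shear g hg) := by
  refine MeasurePreserving.skew_product (g := fun x y => g x + y) (MeasurePreserving.id volume)
    ((hg.comp measurable_fst).add measurable_snd) (Filter.Eventually.of_forall fun x => ?_)
  exact (measurePreserving_add_left volume (g x)).map_eq

end Shear

section FarIntegrals

variable {d : ℕ} {H : Matrix (Fin d) (Fin d) ℝ} {lam : ℝ}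

/-- An integrable majorant for points satisfying the global growth condition. -/
noncomputable def linearTail (H : Matrix (Fin d) (Fin d) ℝ) (lam A : ℝ) (u : Vec d × ℝ) : ℝ :=
  A * (Real.exp (-(Real.sqrt (d * lam) / 4) * normH H u.1) *
    Real.exp (-(Real.sqrt (d * lam) / 4) * |u.2|))

/-- An integrable majorant, in sheared coordinates, for points near the boundary. -/
noncomputable def gaussTail (H : Matrix (Fin d) (Fin d) ℝ) (lam c A : ℝ) (u : Vec d × ℝ) : ℝ :=
  A * (Real.exp (-(c / 2 * lam / 2) * normH H u.1 ^ 2) * Real.exp (-(lam * c / 2) * |u.2|))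

lemma integrable_linearTail (hH : H.PosDef) (hlam : 0 < lam) (hd : 1 ≤ d) (A : ℝ) :
    Integrable (linearTail H lam A) := by
  have hdl : 0 < (d:ℝ) * lam := by have : (0:ℝ) < d := by exact_mod_cast hd
                                   positivity
  have := Real.sqrt_pos.2 hdl
  exact ((integrable_exp_neg_normH hH hlam hd).mul_prod
    (integrable_exp_neg_mul_abs (by positivity))).const_mul A

lemma integral_linearTail_le (hH : H.PosDef) (hlam : 0 < lam) (hd : 1 ≤ d) {A : ℝ} (hA : 0 ≤ A) :
    ∫ u, linearTail H lam A u
      ≤ A * ((2 * Real.pi / lam) ^ ((d:ℝ) / 2) / Real.sqrt H.det * 4 ^ d * (8 / Real.sqrt lam)) := by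
  have hd' : (1:ℝ) ≤ d := by exact_mod_cast hd
  have hdl : 0 < (d:ℝ) * lam := by positivity
  have h1 := Real.sqrt_pos.2 hdl
  have h2 := Real.sqrt_pos.2 hlam
  have hpi := Real.pi_pos
  have h3 : Real.sqrt lam ≤ Real.sqrt (d * lam) := Real.sqrt_le_sqrt (by nlinarith)
  unfold linearTail
  rw [integral_const_mul]
  gcongr
  have := integral_prod_mul (μ := (volume : Measure (Vec d))) (ν := (volume : Measure ℝ))
    (fun x : Vec d => Real.exp (-(Real.sqrt (d * lam) / 4) * normH H x))
    (fun t : ℝ => Real.exp (-(Real.sqrt (d * lam) / 4) * |t|))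
  rw [Measure.volume_eq_prod, this, integral_exp_neg_mul_abs (by positivity)]
  have h4 : 2 / (Real.sqrt (d * lam) / 4) ≤ 8 / Real.sqrt lam := by
    rw [div_div_eq_mul_div, show (2:ℝ) * 4 = 8 by norm_num]
    gcongr
  gcongr
  exact integral_exp_neg_normH_le hH hlam hd

lemma integrable_gaussTail (hH : H.PosDef) (hlam : 0 < lam) {c : ℝ} (hc : 0 < c) (A : ℝ) :
    Integrable (gaussTail H lam c A) :=
  ((integrable_exp_normH_sq hH hlam (half_pos hc)).mul_prod
    (integrable_exp_neg_mul_abs (by positivity))).const_mul A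

lemma integral_gaussTail (hH : H.PosDef) (hlam : 0 < lam) {c : ℝ} (hc : 0 < c) (A : ℝ) :
    ∫ u, gaussTail H lam c A u = A * ((2 * Real.pi / lam) ^ ((d:ℝ) / 2) / Real.sqrt H.det *
      (2 / c) ^ ((d:ℝ) / 2) * (4 / (lam * c))) := by
  unfold gaussTail
  rw [integral_const_mul]
  have := integral_prod_mul (μ := (volume : Measure (Vec d))) (ν := (volume : Measure ℝ))
    (fun x : Vec d => Real.exp (-(c / 2 * lam / 2) * normH H x ^ 2))
    (fun t : ℝ => Real.exp (-(lam * c / 2) * |t|))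
  rw [Measure.volume_eq_prod, this, integral_exp_neg_mul_abs (by positivity),
    integral_exp_normH_sq hH hlam (half_pos hc)]
  congr 2
  · rw [one_div_div]
  · field_simp; norm_num

end FarIntegrals

section Far

variable {d : ℕ} {D : Set (Vec d × ℝ)} {z : Vec d × ℝ → ℝ} {Ω : Set (Vec d)} {ψ : Vec d → ℝ}
  {ρ₀ ρ₁ s lam R ε : ℝ}

lemma normH_add_abs_le_normH1 {H : Matrix (Fin d) (Fin d) ℝ} (hH : H.PosDef) (u : Vec d × ℝ) :
    (normH H u.1 + |u.2|) / 2 ≤ normH1 H u := by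
  apply Real.le_sqrt_of_sq_le
  rw [← normH_sq hH, ← sq_abs u.2]
  nlinarith [sq_nonneg (normH H u.1 - |u.2|), sq_nonneg (normH H u.1), sq_nonneg |u.2|]

/-- Pointwise majorant of `e^{-λ(z - z(0))}` away from the boundary strip. -/
lemma Setting.exp_le_tails (h : Setting D z Ω ψ ρ₀) (hg : GlobalGrowth D z ψ ρ₀ ρ₁ s)
    (hd : 1 ≤ d) (hlam : 0 < lam) (hε : ε = Real.sqrt (d / lam)) (hR : 0 < R) (hεs : ε ≤ s)
    (hRρ : R * ε ≤ 2 * ρ₁) {ψ' : Vec d → ℝ} (hψ' : ∀ x ∈ UH (hessH z ψ) ρ₀, ψ' x = ψ x)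
    {u : Vec d × ℝ} (hu : u ∈ D)
    (huN : u ∉ Theta ψ '' (UH (hessH z ψ) (R * ε) ×ˢ Icc 0 ((R * ε) ^ 2))) :
    Real.exp (-lam * (z u - z 0))
      ≤ linearTail (hessH z ψ) lam (Real.exp (-(R * d / 4))) u
        + gaussTail (hessH z ψ) lam (Cmin D z ψ ρ₁)
          (Real.exp (-(Cmin D z ψ ρ₁ * (R ^ 2 * d) / 4))) (u.1, u.2 - ψ' u.1) := by
  have hH := h.H_posDef
  have hc := h.Cmin_pos hd hg.ρ₁_pos hg.ρ₁_lt.le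
  have hd0 : (0:ℝ) < d := by exact_mod_cast hd
  have hε0 : 0 < ε := by rw [hε]; exact Real.sqrt_pos.2 (by positivity)
  have hε2 : lam * ε ^ 2 = d := by rw [hε, Real.sq_sqrt (by positivity)]; field_simp
  have hsq : Real.sqrt (d * lam) = lam * ε := by
    rw [← hε2, show lam * ε ^ 2 * lam = (lam * ε) ^ 2 by ring, Real.sqrt_sq (by positivity)]
  set n := normH (hessH z ψ) u.1 with hn
  have hn0 : 0 ≤ n := normH_nonneg _
  rcases h.growth_dichotomy hd hg hu with ⟨h1, h2⟩ | ⟨h1, h2, h3⟩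
  · refine le_trans ?_ (le_add_of_nonneg_right (by unfold gaussTail; positivity))
    rw [linearTail, ← Real.exp_add, ← Real.exp_add]
    apply Real.exp_le_exp.2
    have h4 := normH_add_abs_le_normH1 hH u
    rw [← hn] at h4 ⊢
    have h0 : 0 ≤ normH1 (hessH z ψ) u := Real.sqrt_nonneg _
    have h5 : ε * ρ₁ ≤ z u - z 0 := le_trans (by gcongr; exact hg.ρ₁_pos.le) h1
    have h6 : ε * normH1 (hessH z ψ) u ≤ z u - z 0 := le_trans (by gcongr) h2
    -- Two lower bounds for one exponent, one constant and one linear in `u`. Their average supplies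
    -- the small prefactor and the integrable decay.
    have h7 : lam * (ε * (R * ε / 2)) ≤ lam * (z u - z 0) := by
      gcongr; exact le_trans (by gcongr; linarith) h5
    have h8 : lam * (ε * ((n + |u.2|) / 2)) ≤ lam * (z u - z 0) := by
      gcongr; exact le_trans (by gcongr) h6
    have h9 : lam * (ε * (R * ε / 2)) = R * d / 2 := by rw [← hε2]; ring
    rw [hsq]
    nlinarith
  · refine le_trans ?_ (le_add_of_nonneg_left (by unfold linearTail; positivity))
    rw [gaussTail, ← Real.exp_add, ← Real.exp_add]
    apply Real.exp_le_exp.2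
    have hx0 := UH_mono hg.ρ₁_lt.le h1
    simp only [hψ' _ hx0]
    rw [← hn] at h3 ⊢
    rw [abs_of_nonneg (by linarith)]
    set y := u.2 - ψ u.1 with hy
    have hy0 : 0 ≤ y := by linarith
    set c := Cmin D z ψ ρ₁
    -- Outside the strip either `n > Rε` or `y > (Rε)²`. The strip has height `(Rε)²` so that both
    -- cases give an excess of the same order.
    have h4 : (R * ε) ^ 2 ≤ n ^ 2 + 2 * y := by
      by_cases hnr : n ≤ R * ε
      · by_cases hyr : y ≤ (R * ε) ^ 2
        · refine absurd ⟨(u.1, y), ⟨hnr, hy0, hyr⟩, ?_⟩ huN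
          simp [Theta, hy]
        · push Not at hyr; nlinarith [sq_nonneg n]
      · push Not at hnr
        have : (R * ε) ^ 2 ≤ n ^ 2 := by gcongr
        linarith
    have h5 : R ^ 2 * d = lam * (R * ε) ^ 2 := by rw [← hε2]; ring
    rw [h5]
    have h6 : lam * c * (R * ε) ^ 2 ≤ lam * c * (n ^ 2 + 2 * y) := by gcongr
    have h7 : lam * (c * y + c * (n ^ 2 / 2)) ≤ lam * (z u - z 0) := by gcongr
    nlinarith

/-- Integrability of `e^{-λ(z - z(0))}` over `D` and the tail estimate. -/
theorem Setting.far_estimate (h : Setting D z Ω ψ ρ₀) (hg : GlobalGrowth D z ψ ρ₀ ρ₁ s)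
    (hd : 1 ≤ d) (hlam : 0 < lam) (hε : ε = Real.sqrt (d / lam)) (hR : 0 < R) (hεs : ε ≤ s)
    (hRρ : R * ε ≤ 2 * ρ₁) (hRρ₀ : R * ε ≤ ρ₀) :
    IntegrableOn (fun u => Real.exp (-lam * (z u - z 0))) D ∧
    ∃ E : ℝ, ∫ u in D, Real.exp (-lam * (z u - z 0))
        = (∫ p in UH (hessH z ψ) (R * ε) ×ˢ Icc 0 ((R * ε) ^ 2),
            Real.exp (-lam * (wFun z ψ p - z 0))) + E ∧
      |E| ≤ Real.exp (-(R * d / 4)) * ((2 * Real.pi / lam) ^ ((d:ℝ) / 2) /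
          Real.sqrt (hessH z ψ).det * 4 ^ d * (8 / Real.sqrt lam))
        + Real.exp (-(Cmin D z ψ ρ₁ * (R ^ 2 * d) / 4)) * ((2 * Real.pi / lam) ^ ((d:ℝ) / 2) /
          Real.sqrt (hessH z ψ).det * (2 / Cmin D z ψ ρ₁) ^ ((d:ℝ) / 2) *
            (4 / (lam * Cmin D z ψ ρ₁))) := by
  classical
  have hH := h.H_posDef
  have hc := h.Cmin_pos hd hg.ρ₁_pos hg.ρ₁_lt.le
  have hψc : ContinuousOn ψ (UH (hessH z ψ) ρ₀) := h.ψ_contDiff.continuousOn.mono h.UH_subset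
  -- `ψ` is known only on `Ω`; cutting it off to zero gives a globally measurable function, so that
  -- the shear is defined on the whole space.
  set ψ' : Vec d → ℝ := (UH (hessH z ψ) ρ₀).piecewise ψ 0 with hψ'def
  have hψ'm : Measurable ψ' :=
    hψc.measurable_piecewise continuousOn_const (isClosed_UH ρ₀).measurableSet
  have hψ' : ∀ x ∈ UH (hessH z ψ) ρ₀, ψ' x = ψ x := fun x hx => piecewise_eq_of_mem _ _ _ hx
  set S := UH (hessH z ψ) (R * ε) ×ˢ Icc (0:ℝ) ((R * ε) ^ 2) with hS
  set N := Theta ψ '' S with hN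
  have hSc : IsCompact S := (isCompact_UH hH _).prod isCompact_Icc
  have hΘc : ContinuousOn (Theta ψ) S :=
    continuousOn_fst.prodMk (((hψc.mono (UH_mono hRρ₀)).comp continuousOn_fst fun p hp => hp.1).add
      continuousOn_snd)
  have hNc : IsCompact N := hSc.image_of_continuousOn hΘc
  have hND : N ⊆ D := by
    rintro _ ⟨p, hp, rfl⟩
    exact h.above_mem (UH_mono hRρ₀ hp.1) (by linarith [hp.2.1])
  have hzc : ContinuousOn z D := fun u hu =>
    (h.differentiableAt_of_mem hu).continuousAt.continuousWithinAt
  have hfc : ContinuousOn (fun u => Real.exp (-lam * (z u - z 0))) D :=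
    Real.continuous_exp.comp_continuousOn (continuousOn_const.mul (hzc.sub continuousOn_const))
  have hDm := h.isClosed.measurableSet
  have hNm := hNc.isClosed.measurableSet
  set e := (shear ψ' hψ'm) with he
  have hmp := measurePreserving_shear ψ' hψ'm
  set F := linearTail (hessH z ψ) lam (Real.exp (-(R * d / 4)))
  set G := gaussTail (hessH z ψ) lam (Cmin D z ψ ρ₁)
          (Real.exp (-(Cmin D z ψ ρ₁ * (R ^ 2 * d) / 4)))
  have hF : Integrable F := integrable_linearTail hH hlam hd _
  have hG : Integrable G := integrable_gaussTail hH hlam hc _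
  have hGe : Integrable (fun u => G (e.symm u)) :=
    (hmp.symm.integrable_comp_emb e.symm.measurableEmbedding).2 hG
  have hGi : ∫ u, G (e.symm u) = ∫ u, G u := hmp.symm.integral_comp' G
  have hpt : ∀ u ∈ D \ N, ‖Real.exp (-lam * (z u - z 0))‖ ≤ F u + G (e.symm u) := by
    intro u hu
    rw [Real.norm_of_nonneg (Real.exp_pos _).le]
    exact h.exp_le_tails hg hd hlam hε hR hεs hRρ hψ' hu.1 hu.2
  have hint1 : IntegrableOn (fun u => Real.exp (-lam * (z u - z 0))) (D \ N) := by
    refine Integrable.mono' (hF.add hGe).integrableOn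
      ((hfc.mono sdiff_subset).aestronglyMeasurable (hDm.diff hNm)) ?_
    exact (ae_restrict_iff' (hDm.diff hNm)).2 (Filter.Eventually.of_forall hpt)
  have hint2 : IntegrableOn (fun u => Real.exp (-lam * (z u - z 0))) N :=
    (hfc.mono hND).integrableOn_compact hNc
  have hDN : D = N ∪ (D \ N) := (union_sdiff_cancel hND).symm
  refine ⟨by rw [hDN]; exact hint2.union hint1, ∫ u in D \ N, Real.exp (-lam * (z u - z 0)), ?_, ?_⟩
  · conv_lhs => rw [hDN]
    rw [setIntegral_union disjoint_sdiff_self_right (hDm.diff hNm) hint2 hint1]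
    congr 1
    have hNe : N = e '' S := by
      refine image_congr fun p hp => ?_
      change (p.1, ψ p.1 + p.2) = (p.1, ψ' p.1 + p.2)
      rw [hψ' _ (UH_mono hRρ₀ hp.1)]
    rw [hNe, hmp.setIntegral_image_emb e.measurableEmbedding]
    refine setIntegral_congr_fun hSc.isClosed.measurableSet fun p hp => ?_
    change Real.exp (-lam * (z (p.1, ψ' p.1 + p.2) - z 0)) = _
    rw [hψ' _ (UH_mono hRρ₀ hp.1)]
    rfl
  · have h1 : ‖∫ u in D \ N, Real.exp (-lam * (z u - z 0))‖ ≤ ∫ u in D \ N, (F u + G (e.symm u)) :=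
      norm_integral_le_of_norm_le (hF.add hGe).integrableOn
        ((ae_restrict_iff' (hDm.diff hNm)).2 (Filter.Eventually.of_forall hpt))
    have h2 : ∫ u in D \ N, (F u + G (e.symm u)) ≤ ∫ u, (F u + G (e.symm u)) :=
      setIntegral_le_integral (hF.add hGe) (Filter.Eventually.of_forall fun u => by
        change 0 ≤ F u + G (e.symm u)
        simp only [F, G, linearTail, gaussTail]
        positivity)
    refine h1.trans (h2.trans ?_)
    rw [integral_add hF hGe, hGi]
    exact add_le_add (integral_linearTail_le hH hlam hd (Real.exp_pos _).le)
      (integral_gaussTail hH hlam hc _).le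

end Far

end BoundaryLaplace

/-! ### The one-dimensional integral across the boundary. -/

namespace BoundaryLaplace

lemma integral_Icc_mul_exp {c b : ℝ} (hb : 0 ≤ b) :
    ∫ y in Icc 0 b, c * Real.exp (-c * y) = 1 - Real.exp (-c * b) := by
  rw [integral_Icc_eq_integral_Ioc, ← intervalIntegral.integral_of_le hb]
  have hd : ∀ y ∈ uIcc 0 b, HasDerivAt (fun y => -Real.exp (-c * y)) (c * Real.exp (-c * y)) y := by
    intro y _
    have := (((hasDerivAt_id y).const_mul (-c)).exp).neg
    refine this.congr_deriv ?_
    simp; ring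
  rw [intervalIntegral.integral_eq_sub_of_hasDerivAt hd
    ((by fun_prop : Continuous fun y => c * Real.exp (-c * y)).intervalIntegrable _ _)]
  simp; ring

lemma abs_exp_neg_sub_exp_neg_le {a b m : ℝ} (ha : m ≤ a) (hb : m ≤ b) :
    |Real.exp (-a) - Real.exp (-b)| ≤ |a - b| * Real.exp (-m) := by
  wlog hab : a ≤ b generalizing a b
  · rw [abs_sub_comm, abs_sub_comm a b]
    exact this hb ha (le_of_not_ge hab)
  have h1 : Real.exp (-b) ≤ Real.exp (-a) := Real.exp_le_exp.2 (by linarith)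
  rw [abs_of_nonneg (by linarith), abs_of_nonpos (by linarith)]
  have h2 := Real.add_one_le_exp (a - b)
  have h3 : Real.exp (-b) = Real.exp (-a) * Real.exp (a - b) := by rw [← Real.exp_add]; ring_nf
  have h4 : Real.exp (-a) ≤ Real.exp (-m) := Real.exp_le_exp.2 (by linarith)
  have h5 := Real.exp_pos (-a)
  rw [h3]
  nlinarith

/-- Watson-type estimate for a one-dimensional boundary integral. -/
theorem boundary_integral_estimate {g : ℝ → ℝ} {p ω lam b : ℝ} (hg : ContinuousOn g (Icc 0 b))
    (hlam : 0 < lam) (hb : 0 < b) (hω : 0 ≤ ω) (hp : 1 / 2 ≤ p)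
    (hgp : ∀ y ∈ Icc 0 b, |g y - p * y| ≤ ω * y ^ 2) (hgy : ∀ y ∈ Icc 0 b, y / 2 ≤ g y) :
    |lam * (∫ y in Icc 0 b, Real.exp (-lam * g y)) - 1 / p|
      ≤ 128 * ω / lam + 2 * Real.exp (-(lam * b / 2)) := by
  have hp0 : 0 < p := by linarith
  have i1 : IntegrableOn (fun y => Real.exp (-lam * g y)) (Icc 0 b) :=
    (Real.continuous_exp.comp_continuousOn (continuousOn_const.mul hg)).integrableOn_compact
      isCompact_Icc
  have i2 : IntegrableOn (fun y => Real.exp (-(lam * p) * y)) (Icc 0 b) :=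
    (by fun_prop : Continuous fun y => Real.exp (-(lam * p) * y)).integrableOn_Icc
  have i3 : IntegrableOn (fun y => 128 * ω / lam ^ 2 * (lam / 4 * Real.exp (-(lam / 4) * y)))
      (Icc 0 b) := (by fun_prop : Continuous fun y =>
        128 * ω / lam ^ 2 * (lam / 4 * Real.exp (-(lam / 4) * y))).integrableOn_Icc
  have e2 : ∫ y in Icc 0 b, Real.exp (-(lam * p) * y) = (1 - Real.exp (-(lam * p) * b)) / (lam * p) := by
    rw [← integral_Icc_mul_exp hb.le, integral_const_mul]
    field_simp
  have e3 := integral_Icc_mul_exp (c := lam / 4) hb.le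
  have hpt : ∀ y ∈ Icc 0 b, ‖Real.exp (-lam * g y) - Real.exp (-(lam * p) * y)‖
      ≤ 128 * ω / lam ^ 2 * (lam / 4 * Real.exp (-(lam / 4) * y)) := by
    intro y hy
    have h1 := abs_exp_neg_sub_exp_neg_le (a := lam * g y) (b := lam * p * y) (m := lam * y / 2)
      (by have := hgy y hy; nlinarith) (by
        have : lam * (1 / 2) * y ≤ lam * p * y := by have := hy.1; gcongr
        linarith)
    rw [Real.norm_eq_abs, neg_mul, neg_mul]
    refine h1.trans ?_
    have h2 : |lam * g y - lam * p * y| ≤ lam * (ω * y ^ 2) := by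
      rw [mul_assoc, ← mul_sub, abs_mul, abs_of_pos hlam]
      gcongr; exact hgp y hy
    -- The decay `e^{-λy/2}` is `e^{-2t}`: one factor absorbs `t²` through `t² e^{-t} ≤ 2`, the
    -- other is integrated as an exponential density of rate `λ/4`. This produces `128 = 16 · 2 ·
    -- 4`.
    set t := lam / 4 * y with ht
    have ht0 : 0 ≤ t := by have := hy.1; positivity
    have h3 := Real.quadratic_le_exp_of_nonneg ht0
    have h4 : Real.exp (-(lam * y / 2)) = Real.exp (-t) * Real.exp (-t) := by
      rw [← Real.exp_add]; congr 1; rw [ht]; ring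
    have h5 : t ^ 2 * Real.exp (-t) ≤ 2 := by
      rw [Real.exp_neg, ← div_eq_mul_inv, div_le_iff₀ (Real.exp_pos _)]
      nlinarith
    have h6 : y = 4 * t / lam := by rw [ht]; field_simp
    calc |lam * g y - lam * p * y| * Real.exp (-(lam * y / 2))
        ≤ lam * (ω * y ^ 2) * Real.exp (-(lam * y / 2)) := by gcongr
      _ = 16 * ω / lam * (t ^ 2 * Real.exp (-t)) * Real.exp (-t) := by
        rw [h4, h6]; field_simp; ring
      _ ≤ 16 * ω / lam * 2 * Real.exp (-t) := by gcongr
      _ = _ := by rw [ht, ← neg_mul]; field_simp; ring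
  have h1 : ‖∫ y in Icc 0 b, (Real.exp (-lam * g y) - Real.exp (-(lam * p) * y))‖
      ≤ ∫ y in Icc 0 b, 128 * ω / lam ^ 2 * (lam / 4 * Real.exp (-(lam / 4) * y)) :=
    norm_integral_le_of_norm_le i3
      ((ae_restrict_iff' measurableSet_Icc).2 (Filter.Eventually.of_forall hpt))
  rw [integral_sub i1 i2, integral_const_mul, e3, e2, Real.norm_eq_abs] at h1
  set J := ∫ y in Icc 0 b, Real.exp (-lam * g y)
  have h2 : |J - (1 - Real.exp (-(lam * p) * b)) / (lam * p)| ≤ 128 * ω / lam ^ 2 := by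
    refine h1.trans (mul_le_of_le_one_right (by positivity) ?_)
    linarith [Real.exp_pos (-(lam / 4) * b)]
  have h3 : lam * J - 1 / p = lam * (J - (1 - Real.exp (-(lam * p) * b)) / (lam * p))
      - Real.exp (-(lam * p) * b) / p := by field_simp; ring
  have h4 : Real.exp (-(lam * p) * b) / p ≤ 2 * Real.exp (-(lam * b / 2)) := by
    rw [div_le_iff₀ hp0]
    have : Real.exp (-(lam * p) * b) ≤ Real.exp (-(lam * b / 2)) := by
      apply Real.exp_le_exp.2
      have : lam * (1 / 2) * b ≤ lam * p * b := by gcongr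
      linarith
    nlinarith [Real.exp_pos (-(lam * b / 2))]
  rw [h3]
  calc _ ≤ |lam * (J - (1 - Real.exp (-(lam * p) * b)) / (lam * p))|
          + |Real.exp (-(lam * p) * b) / p| := abs_sub _ _
    _ ≤ lam * (128 * ω / lam ^ 2) + 2 * Real.exp (-(lam * b / 2)) := by
        rw [abs_mul, abs_of_pos hlam, abs_of_nonneg (by positivity : 0 ≤ Real.exp (-(lam * p) * b) / p)]
        gcongr
    _ = _ := by field_simp

/-- Perturbation of `1/p` around `p = 1`. -/
lemma abs_inv_sub_one_add_le {p ℓ e : ℝ} (hp : 1 / 2 ≤ p) (he : |p - 1 - ℓ| ≤ e) (he1 : e ≤ 1 / 2) :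
    |1 / p - 1 + ℓ| ≤ 4 * ℓ ^ 2 + 3 * e := by
  have hp0 : 0 < p := by linarith
  set f := p - 1 - ℓ with hf
  -- An exact identity: the error of the linear approximation is quadratic in `p - 1` apart from the
  -- error of `p` itself.
  have e1 : 1 / p - 1 + ℓ = (p - 1) ^ 2 / p - f := by rw [hf]; field_simp; ring
  have h0 : 0 ≤ e := (abs_nonneg _).trans he
  have h1 : (p - 1) ^ 2 ≤ 2 * ℓ ^ 2 + 2 * f ^ 2 := by nlinarith [sq_nonneg (ℓ - f)]
  have h2 : f ^ 2 ≤ e / 2 := by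
    rw [← sq_abs]; nlinarith [abs_nonneg f]
  have h3 : (p - 1) ^ 2 / p ≤ 2 * (p - 1) ^ 2 := by
    rw [div_le_iff₀ hp0]; nlinarith [sq_nonneg (p - 1)]
  have h4 : 0 ≤ (p - 1) ^ 2 / p := by positivity
  rw [e1, abs_le]
  have := abs_le.1 he
  constructor <;> nlinarith

end BoundaryLaplace

/-! ### The integral over the boundary strip. -/

namespace BoundaryLaplace

variable {d : ℕ} {D : Set (Vec d × ℝ)} {z : Vec d × ℝ → ℝ} {Ω : Set (Vec d)} {ψ : Vec d → ℝ}
  {ρ₀ ρ₁ s lam a : ℝ}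

set_option maxHeartbeats 1000000 in
/-- The integral over the boundary strip, compared with its leading Gaussian approximation. -/
theorem Setting.near_estimate (h : Setting D z Ω ψ ρ₀) (hlam : 0 < lam) (ha : 0 < a)
    (ha1 : a ≤ 1) (haρ : a ≤ ρ₀) {H : Matrix (Fin d) (Fin d) ℝ} (hHdef : H = hessH z ψ)
    {w : Vec d × ℝ → ℝ} (hwdef : w = wFun z ψ)
    (hw : ContDiffOn ℝ 4 w (UH H a ×ˢ Icc 0 (a ^ 2)))
    {ω₁₁ ω₂₁ ω₃₀ ω₄₀ ω₀₂ : ℝ} (h₁₁ : ω₁₁ = omega H w a (a ^ 2) 1 1 0 0)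
    (h₂₁ : ω₂₁ = omega H w a (a ^ 2) 2 1 a 0) (h₃₀ : ω₃₀ = omega H w a (a ^ 2) 3 0 0 0)
    (h₄₀ : ω₄₀ = omega H w a (a ^ 2) 4 0 a 0) (h₀₂ : ω₀₂ = omega H w a (a ^ 2) 0 2 a (a ^ 2))
    (hsmall : a * (ω₁₁ + omega H w a a 0 2 a a) + a ^ 2 * ω₂₁ ≤ 1 / 2)
    {m κ τ β η : ℝ} (hm : m = lam * a ^ 2) (hκ : κ = lam * (ω₄₀ * a ^ 4))
    (hτ : τ = ω₃₀ / (6 * Real.sqrt lam)) (hβ : β = ω₁₁ * a)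
    (hη : η = (4 * ω₁₁ ^ 2 + 3 * ω₂₁) * a ^ 2
      + (128 * ω₀₂ / lam + 2 * Real.exp (-(lam * a ^ 2 / 2)))) :
    ∃ J : ℝ, ∫ p in UH H a ×ˢ Icc 0 (a ^ 2), Real.exp (-lam * (w p - z 0))
        = (2 * Real.pi / lam) ^ ((d:ℝ) / 2) / (lam * Real.sqrt H.det) * J ∧
      |J - 1| ≤ (gauss d).real (eball d m)ᶜ + (2 * η + κ + β ^ 2 + (1 + η) *
        (2 * Real.exp (2 * κ) * ((1 + κ ^ 2) * (4 * (28 * τ * m) ^ 2 *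
          Real.exp (Real.pi ^ 2 * (2 * (28 * τ * m) + 1) ^ 2 / 8)) + 8 * κ ^ 2))) := by
  have hH : H.PosDef := hHdef ▸ h.H_posDef
  have hb : 0 < a ^ 2 := by positivity
  have hba : a ^ 2 ≤ a := by nlinarith
  have hsl := Real.sqrt_pos.2 hlam
  have hmpos : 0 < m := by rw [hm]; positivity
  have p₁₁ : 0 ≤ ω₁₁ := h₁₁ ▸ omega_nonneg _ _ _ _
  have p₂₁ : 0 ≤ ω₂₁ := h₂₁ ▸ omega_nonneg _ _ _ _
  have p₃₀ : 0 ≤ ω₃₀ := h₃₀ ▸ omega_nonneg _ _ _ _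
  have p₄₀ : 0 ≤ ω₄₀ := h₄₀ ▸ omega_nonneg _ _ _ _
  have p₀₂ : 0 ≤ ω₀₂ := h₀₂ ▸ omega_nonneg _ _ _ _
  -- regularity of `w` up to and across the boundary
  obtain ⟨O, hO, hsubO, hwO⟩ := h.exists_open_domain
  rw [← hwdef] at hwO
  rw [← hHdef] at hsubO
  have hsuba : UH H a ×ˢ Icc 0 a ⊆ O := fun p hp => hsubO ⟨UH_mono haρ hp.1, hp.2.1⟩
  have hsubb : UH H a ×ˢ Icc 0 (a ^ 2) ⊆ O := fun p hp => hsubO ⟨UH_mono haρ hp.1, hp.2.1⟩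
  have hmono : ω₀₂ ≤ omega H w a a 0 2 a a :=
    h₀₂ ▸ omega_zero_two_mono hH ha.le hO hwO hb hba hsuba
  have hvert := fun (x : Vec d) (hx : x ∈ UH H a) (y : ℝ) (hy : y ∈ Icc 0 (a ^ 2)) =>
    abs_vertical_taylor_le hH hO hwO hb hsubb hx hy
  rw [← h₀₂] at hvert
  -- horizontal expansions
  have hgraph := fun (x : Vec d) (hx : x ∈ UH H a) =>
    h.graph_expansion ha hb (hHdef ▸ hwdef ▸ hw) (x := x) (hHdef ▸ hx)
  obtain ⟨ℓ, hℓ, hslope⟩ := h.slope_expansion ha hb (hHdef ▸ hwdef ▸ hw)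
  rw [← hHdef, ← hwdef] at hgraph hslope hℓ
  rw [← h₄₀] at hgraph
  rw [← h₂₁] at hslope
  rw [← h₁₁] at hℓ
  set T := mixedDeriv H w a (a ^ 2) 3 0 0 0 with hT
  have hTle : ∀ u, |T u| ≤ ω₃₀ * ∏ i, normH H (u i) := fun u => by
    rw [h₃₀]; exact abs_mixedDeriv_zero_le hH (by norm_num) 0 u
  obtain ⟨p, hp⟩ : ∃ p : Vec d → ℝ, ∀ x, partialY w (a ^ 2) 1 x 0 = p x := ⟨_, fun _ => rfl⟩
  simp_rw [hp] at hvert hslope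
  -- quantitative consequences of the smallness condition
  have hn : ∀ x ∈ UH H a, normH H x ≤ a := fun x hx => hx
  have hslope2 : ∀ x ∈ UH H a, ω₂₁ * normH H x ^ 2 ≤ ω₂₁ * a ^ 2 := fun x hx => by
    have := hn x hx; have := normH_nonneg (H := H) x; gcongr
  have hℓ2 : ∀ x ∈ UH H a, |ℓ x| ≤ ω₁₁ * a := fun x hx =>
    (hℓ x).trans (by have := hn x hx; gcongr)
  have hω₀₂a : ω₀₂ * a ^ 2 ≤ a * omega H w a a 0 2 a a := by nlinarith
  -- The reserve `ω₀₂ a²` beyond `1/2` pays for the quadratic vertical error in `hrise`, since `y ≤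
  -- a²` on the strip.
  have hplow : ∀ x ∈ UH H a, 1 / 2 + ω₀₂ * a ^ 2 ≤ p x := fun x hx => by
    have h1 := (abs_le.1 (hslope x hx)).1
    have h2 := (abs_le.1 (hℓ2 x hx)).1
    have h3 := hslope2 x hx
    nlinarith
  have hphalf : ∀ x ∈ UH H a, 1 / 2 ≤ p x := fun x hx => by
    have := hplow x hx
    have : 0 ≤ ω₀₂ * a ^ 2 := by positivity
    linarith
  have hrise : ∀ x ∈ UH H a, ∀ y ∈ Icc 0 (a ^ 2), y / 2 ≤ w (x, y) - w (x, 0) := fun x hx y hy => by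
    have h1 := (abs_le.1 (hvert x hx y hy)).1
    have h2 := hplow x hx
    have h3 : ω₀₂ * y ^ 2 ≤ ω₀₂ * a ^ 2 * y := by
      have := mul_le_mul_of_nonneg_left hy.2 hy.1
      nlinarith
    have h4 := mul_le_mul_of_nonneg_right h2 hy.1
    nlinarith
  -- the inner integral
  obtain ⟨q, hq⟩ : ∃ q : Vec d → ℝ, ∀ x, q x = lam * ∫ y in Icc 0 (a ^ 2),
      Real.exp (-lam * (w (x, y) - w (x, 0))) := ⟨_, fun _ => rfl⟩
  have hwc : ContinuousOn w (UH H a ×ˢ Icc 0 (a ^ 2)) := hw.continuousOn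
  have hwc0 : ContinuousOn (fun x : Vec d => w (x, 0)) (UH H a) :=
    hwc.comp (f := fun x : Vec d => (x, (0:ℝ))) (by fun_prop) fun x hx => ⟨hx, le_rfl, hb.le⟩
  have hqest : ∀ x ∈ UH H a, |q x - 1 + ℓ x| ≤ η := by
    intro x hx
    have hgc : ContinuousOn (fun y => w (x, y) - w (x, 0)) (Icc 0 (a ^ 2)) :=
      (hwc.comp (f := fun y : ℝ => (x, y)) (by fun_prop) fun y hy => ⟨hx, hy⟩).sub continuousOn_const
    have h1 := boundary_integral_estimate hgc hlam hb p₀₂ (hphalf x hx)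
      (fun y hy => hvert x hx y hy) (hrise x hx)
    rw [← hq] at h1
    have h2 := abs_inv_sub_one_add_le (hphalf x hx) (hslope x hx)
      ((hslope2 x hx).trans (by
        have : 0 ≤ a * (ω₁₁ + omega H w a a 0 2 a a) := by
          have := p₀₂.trans hmono; positivity
        nlinarith))
    have h3 : ℓ x ^ 2 ≤ ω₁₁ ^ 2 * a ^ 2 := by
      rw [← sq_abs, ← mul_pow]; have := hℓ2 x hx; gcongr
    have h4 := hslope2 x hx
    rw [hη]
    have e : q x - 1 + ℓ x = (q x - 1 / p x) + (1 / p x - 1 + ℓ x) := by ring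
    rw [e]
    refine (abs_add_le _ _).trans ?_
    linarith
  have hqc : ContinuousOn q (UH H a) := by
    rw [funext hq]
    refine continuousOn_const.mul (continuousOn_of_dominated (bound := fun _ => 1) ?_ ?_ ?_ ?_)
    · intro x hx
      have hgc : ContinuousOn (fun y => w (x, y) - w (x, 0)) (Icc 0 (a ^ 2)) :=
        (hwc.comp (f := fun y : ℝ => (x, y)) (by fun_prop) fun y hy => ⟨hx, hy⟩).sub
          continuousOn_const
      exact (Real.continuous_exp.comp_continuousOn (continuousOn_const.mul hgc)).aestronglyMeasurable
        measurableSet_Icc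
    · intro x hx
      refine (ae_restrict_iff' measurableSet_Icc).2 (Filter.Eventually.of_forall fun y hy => ?_)
      rw [Real.norm_of_nonneg (Real.exp_pos _).le]
      apply Real.exp_le_one_iff.2
      have := hrise x hx y hy
      have := hy.1
      nlinarith
    · exact integrable_const _
    · refine (ae_restrict_iff' measurableSet_Icc).2 (Filter.Eventually.of_forall fun y hy => ?_)
      have h1 : ContinuousOn (fun x : Vec d => w (x, y)) (UH H a) :=
        hwc.comp (f := fun x : Vec d => (x, y)) (by fun_prop) fun x hx => ⟨hx, hy⟩
      exact Real.continuous_exp.comp_continuousOn (continuousOn_const.mul (h1.sub hwc0))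
  -- passage to normalized coordinates
  obtain ⟨A, hA, hAint⟩ := exists_gauss_coordinates hH hlam
  have hAmem : ∀ v ∈ eball d m, A v ∈ UH H a := by
    intro v hv
    change normH H (A v) ≤ a
    rw [hA, div_le_iff₀ hsl]
    apply Real.sqrt_le_iff.2
    refine ⟨by positivity, ?_⟩
    rw [mul_pow, Real.sq_sqrt hlam.le, mul_comm, ← hm]
    exact hv
  obtain ⟨V, hV⟩ : ∃ V : Vec d → ℝ, ∀ x, V x = lam * (w (x, 0) - z 0) - lam / 2 * normH H x ^ 2 :=
    ⟨_, fun _ => rfl⟩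
  -- The cubic Taylor term of `λ w(x, 0)` in normalized coordinates. Each slot contributes `1/√λ`,
  -- so its size is `λ · λ^{-3/2} ω₃₀ / 6 = τ`.
  set T' : ContinuousMultilinearMap ℝ (fun _ : Fin 3 => Vec d) ℝ :=
    (lam / 6) • T.compContinuousLinearMap (fun _ => (A : Vec d →L[ℝ] Vec d)) with hT'
  have hT'v : ∀ u, T' u = lam / 6 * T fun i => A (u i) := fun u => rfl
  have hT'le : ∀ u, |T' u| ≤ τ * ∏ i, euc (u i) := by
    intro u
    rw [hT'v, abs_mul, abs_of_pos (by positivity)]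
    calc lam / 6 * |T fun i => A (u i)| ≤ lam / 6 * (ω₃₀ * ∏ i, normH H (A (u i))) := by
          gcongr; exact hTle _
      _ = τ * ∏ i, euc (u i) := by
          simp only [hA, Fin.prod_univ_three, hτ]
          have e : ∀ r > 0, ∀ x y t : ℝ, r ^ 2 / 6 * (ω₃₀ * (x / r * (y / r) * (t / r)))
              = ω₃₀ / (6 * r) * (x * y * t) := fun r hr x y t => by field_simp
          rw [← e _ hsl, Real.sq_sqrt hlam.le]
  have hVc : ContinuousOn V (UH H a) := by
    rw [funext hV]
    exact
    (continuousOn_const.mul (hwc0.sub continuousOn_const)).sub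
      (continuousOn_const.mul (continuous_normH.continuousOn.pow 2))
  have hfin := gauss_expansion (T := T') (V := fun v => V (A v)) (q := fun v => q (A v))
    (ℓ := ℓ.comp (A : Vec d →L[ℝ] Vec d)) (κ := κ) (β := β) (η := η) hmpos hT'le
    (by rw [hτ]; positivity) (by rw [hη]; positivity)
    (fun v hv => by
      have h1 := hgraph _ (hAmem v hv)
      have h2 : V (A v) - T' (fun _ => v) = lam * (w (A v, 0) - z 0 - normH H (A v) ^ 2 / 2
          - T (fun _ => A v) / 6) := by rw [hT'v]; simp only [hV]; ring
      rw [h2, abs_mul, abs_of_pos hlam, hκ]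
      have h3 := hn _ (hAmem v hv)
      have h4 := normH_nonneg (H := H) (A v)
      gcongr
      exact h1.trans (by gcongr))
    (fun v hv => hqest _ (hAmem v hv))
    (fun v hv => by rw [hβ]; exact hℓ2 _ (hAmem v hv))
    (ContinuousOn.integrableOn_compact (isCompact_eball d m) (by
      have hAc : ContinuousOn A (eball d m) := A.continuous.continuousOn
      exact (Real.continuous_exp.comp_continuousOn (hVc.comp hAc hAmem).neg).mul
        (hqc.comp hAc hAmem)))
  refine ⟨_, ?_, hfin⟩
  have hi : IntegrableOn (fun p => Real.exp (-lam * (w p - z 0))) (UH H a ×ˢ Icc 0 (a ^ 2)) :=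
    ContinuousOn.integrableOn_compact ((isCompact_UH hH a).prod isCompact_Icc)
      (Real.continuous_exp.comp_continuousOn (continuousOn_const.mul (hwc.sub continuousOn_const)))
  rw [Measure.volume_eq_prod] at hi ⊢
  rw [setIntegral_prod _ hi]
  -- The exponent splits into the Gaussian weight, the non-quadratic horizontal phase `V`, and the
  -- vertical rise, whose integral is `q / λ`.
  have e1 : ∀ x, ∫ y in Icc 0 (a ^ 2), Real.exp (-lam * (w (x, y) - z 0))
      = (Real.exp (-V x) * q x / lam) * Real.exp (-(lam / 2) * normH H x ^ 2) := by
    intro x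
    have e2 : ∀ y, Real.exp (-lam * (w (x, y) - z 0))
        = Real.exp (-V x) * Real.exp (-(lam / 2) * normH H x ^ 2)
          * Real.exp (-lam * (w (x, y) - w (x, 0))) := by
      intro y
      rw [← Real.exp_add, ← Real.exp_add]; congr 1; simp only [hV]; ring
    simp_rw [e2]
    rw [integral_const_mul]
    simp only [hq]
    field_simp
  simp_rw [e1]
  rw [hAint a _ ha.le, ← hm]
  simp_rw [integral_div]
  field_simp

end BoundaryLaplace

/-! ### Numerical bounds and the constant. -/

namespace BoundaryLaplace

/-- Bounds for the exponentially small contributions. -/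
lemma exp_tails_le {d : ℕ} (hd : 1 ≤ d) {lam M R c : ℝ} (hlam : 1 ≤ lam) (hM : 1 ≤ M)
    (hc : 0 < c) (hc1 : c ≤ 1) (hR : 12 / c + 2 * (1 + 2 * M) * Real.log lam / d ≤ R) :
    12 ≤ R ∧
    Real.exp (-(R * d / 4)) * 4 ^ d * (8 * Real.sqrt lam) ≤ 8 * lam ^ (-M) ∧
    Real.exp (-(c * (R ^ 2 * d) / 4)) * (2 / c) ^ ((d:ℝ) / 2) * (4 / c) ≤ R / 3 * lam ^ (-M) ∧
    Real.exp (-(R ^ 2 * d) / 4) * 2 ^ ((d:ℝ) / 2) ≤ lam ^ (-M) ∧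
    Real.exp (-(R ^ 2 * d / 2)) ≤ lam ^ (-M) := by
  have hl0 : 0 < lam := by linarith
  have hd1 : (1:ℝ) ≤ d := by exact_mod_cast hd
  have hd0 : (0:ℝ) < d := by linarith
  set Λ := Real.log lam with hΛ
  have hΛ0 : 0 ≤ Λ := Real.log_nonneg hlam
  have hMΛ : Λ ≤ M * Λ := by nlinarith
  have hlog : 0 ≤ 2 * (1 + 2 * M) * Λ / d := by positivity
  have h12 : 12 ≤ 12 / c := by rw [le_div_iff₀ hc]; nlinarith
  have hR12 : 12 ≤ R := by linarith
  have hcinv : 12 / c ≤ R := by linarith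
  have hcR : 12 ≤ c * R := by rw [div_le_iff₀ hc] at hcinv; linarith
  -- A quarter of this is `3d + Λ/2 + MΛ`: the first part beats `4^d ≤ e^{3d}`, the second the
  -- factor `√λ`, and the third leaves `λ^{-M}`.
  have hRd : 12 * d + 2 * (1 + 2 * M) * Λ ≤ R * d := by
    have h1 : 12 + 2 * (1 + 2 * M) * Λ / d ≤ R := by linarith
    have h2 := mul_le_mul_of_nonneg_right h1 hd0.le
    rwa [add_mul, div_mul_cancel₀ _ hd0.ne'] at h2
  have hpow : lam ^ (-M) = Real.exp (-(M * Λ)) := by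
    rw [Real.rpow_def_of_pos hl0]; congr 1; ring
  have hR2d : 12 * (R * d) ≤ R ^ 2 * d := by nlinarith
  have hRd0 : 0 < R * d := by positivity
  refine ⟨hR12, ?_, ?_, ?_, ?_⟩
  · have h4 : (4:ℝ) ^ d ≤ Real.exp (3 * d) := by
      rw [mul_comm, Real.exp_nat_mul]
      have : (4:ℝ) ≤ Real.exp 3 := by linarith [Real.add_one_le_exp (3:ℝ)]
      gcongr
    have hs : Real.sqrt lam = Real.exp (Λ / 2) := by
      rw [Real.exp_half, hΛ, Real.exp_log hl0]
    calc Real.exp (-(R * d / 4)) * 4 ^ d * (8 * Real.sqrt lam)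
        ≤ Real.exp (-(R * d / 4)) * Real.exp (3 * d) * (8 * Real.exp (Λ / 2)) := by
          rw [hs]; gcongr
      _ = 8 * Real.exp (-(R * d / 4) + 3 * d + Λ / 2) := by
          rw [Real.exp_add, Real.exp_add]; ring
      _ ≤ 8 * lam ^ (-M) := by
          rw [hpow]; gcongr; nlinarith
  · have h2 : 2 / c ≤ Real.exp R := by
      have : 2 / c ≤ 12 / c := by gcongr; norm_num
      linarith [Real.add_one_le_exp R]
    have h3 : (2 / c) ^ ((d:ℝ) / 2) ≤ Real.exp (R * d / 2) := by
      calc (2 / c) ^ ((d:ℝ) / 2) ≤ Real.exp R ^ ((d:ℝ) / 2) := by gcongr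
        _ = Real.exp (R * d / 2) := by rw [← Real.exp_mul]; congr 1; ring
    have h4 : 4 / c ≤ R / 3 := by
      have : 4 / c = 12 / c / 3 := by ring
      rw [this]; gcongr
    have h5 : 12 * (R * d) ≤ c * (R ^ 2 * d) := by nlinarith
    calc Real.exp (-(c * (R ^ 2 * d) / 4)) * (2 / c) ^ ((d:ℝ) / 2) * (4 / c)
        ≤ Real.exp (-(c * (R ^ 2 * d) / 4)) * Real.exp (R * d / 2) * (R / 3) := by gcongr
      _ = R / 3 * Real.exp (-(c * (R ^ 2 * d) / 4) + R * d / 2) := by rw [Real.exp_add]; ring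
      _ ≤ R / 3 * lam ^ (-M) := by
          rw [hpow]; gcongr; nlinarith
  · have h2 : (2:ℝ) ^ ((d:ℝ) / 2) ≤ Real.exp (d / 2) := by
      calc (2:ℝ) ^ ((d:ℝ) / 2) ≤ Real.exp 1 ^ ((d:ℝ) / 2) := by
            have : (2:ℝ) ≤ Real.exp 1 := by linarith [Real.add_one_le_exp (1:ℝ)]
            gcongr
        _ = Real.exp (d / 2) := by rw [← Real.exp_mul]; congr 1; ring
    calc Real.exp (-(R ^ 2 * d) / 4) * 2 ^ ((d:ℝ) / 2)
        ≤ Real.exp (-(R ^ 2 * d) / 4) * Real.exp (d / 2) := by gcongr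
      _ = Real.exp (-(R ^ 2 * d) / 4 + d / 2) := by rw [Real.exp_add]
      _ ≤ lam ^ (-M) := by rw [hpow]; gcongr; nlinarith
  · rw [hpow]; gcongr; nlinarith

/-- The coefficient of the third and fourth order terms in the remainder estimate. -/
noncomputable def cubicConst (r k : ℝ) : ℝ :=
  r ^ 4 + 140 * Real.exp (2 * (r ^ 4 * k)) * ((1 + (r ^ 4 * k) ^ 2) *
    (88 * r ^ 4 * Real.exp (352 * (r ^ 4 * k) + 4)) + 8 * r ^ 4 * (r ^ 4 * k))

/-- The constant in the remainder estimate. -/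
noncomputable def remainderConst (R c : ℝ) : ℝ :=
  cubicConst (max R 1) (max c 0) + 9 * max R 1 ^ 2 + 256 + (13 + max R 1 / 3)

lemma cubicConst_nonneg {r k : ℝ} (hk : 0 ≤ k) : 0 ≤ cubicConst r k := by
  unfold cubicConst; positivity

lemma cubicConst_mono {r r' k k' : ℝ} (hr : 0 ≤ r) (hk : 0 ≤ k) (hrr : r ≤ r') (hkk : k ≤ k') :
    cubicConst r k ≤ cubicConst r' k' := by
  have hr' : 0 ≤ r' := hr.trans hrr
  have hk' : 0 ≤ k' := hk.trans hkk
  unfold cubicConst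
  gcongr

/-- The truncations by `max` give positivity and monotonicity for all real arguments. -/
lemma remainderConst_pos (R c : ℝ) : 0 < remainderConst R c := by
  have h1 : 0 ≤ max R 1 := zero_le_one.trans (le_max_right _ _)
  have := cubicConst_nonneg (r := max R 1) (le_max_right c 0)
  unfold remainderConst
  positivity

lemma remainderConst_mono {R R' c c' : ℝ} (hR : R ≤ R') (hc : c ≤ c') :
    remainderConst R c ≤ remainderConst R' c' := by
  have h1 : 0 ≤ max R 1 := zero_le_one.trans (le_max_right _ _)
  have h2 : max R 1 ≤ max R' 1 := max_le_max_right _ hR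
  have h3 : max c 0 ≤ max c' 0 := max_le_max_right _ hc
  have := cubicConst_mono h1 (le_max_right c 0) h2 h3
  unfold remainderConst
  gcongr

/-- The interior error in terms of `Q`, which bounds the squared third and the fourth
derivatives. -/
lemma cubic_error_le {r k Q κ L η : ℝ} (hQ : 0 ≤ Q) (hQk : Q ≤ k) (hκ0 : 0 ≤ κ)
    (hκ : κ ≤ r ^ 4 * Q) (hL0 : 0 ≤ L) (hL : L ^ 2 ≤ 22 * (r ^ 4 * Q)) (hη : η ≤ 69) :
    κ + (1 + η) * (2 * Real.exp (2 * κ) * ((1 + κ ^ 2) * (4 * L ^ 2 *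
      Real.exp (Real.pi ^ 2 * (2 * L + 1) ^ 2 / 8)) + 8 * κ ^ 2)) ≤ cubicConst r k * Q := by
  have hk : 0 ≤ k := hQ.trans hQk
  have hP : r ^ 4 * Q ≤ r ^ 4 * k := by gcongr
  have hκk := hκ.trans hP
  have hexp : Real.pi ^ 2 * (2 * L + 1) ^ 2 / 8 ≤ 352 * (r ^ 4 * k) + 4 := by
    have h1 : Real.pi ^ 2 ≤ 10 := by nlinarith [Real.pi_lt_d2, Real.pi_pos]
    have h2 : (2 * L + 1) ^ 2 ≤ 8 * L ^ 2 + 2 := by nlinarith [sq_nonneg (2 * L - 1)]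
    have h3 : Real.pi ^ 2 * (2 * L + 1) ^ 2 ≤ 10 * (8 * L ^ 2 + 2) := by gcongr
    linarith
  -- One factor keeps `Q` and the other is bounded by the a priori constant `k`, so that the error
  -- stays linear in `Q`.
  have hκ2 : κ ^ 2 ≤ r ^ 4 * Q * (r ^ 4 * k) := by rw [sq]; gcongr
  calc κ + (1 + η) * (2 * Real.exp (2 * κ) * ((1 + κ ^ 2) * (4 * L ^ 2 *
        Real.exp (Real.pi ^ 2 * (2 * L + 1) ^ 2 / 8)) + 8 * κ ^ 2))
      ≤ r ^ 4 * Q + (1 + 69) * (2 * Real.exp (2 * (r ^ 4 * k)) * ((1 + (r ^ 4 * k) ^ 2) *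
        (4 * (22 * (r ^ 4 * Q)) * Real.exp (352 * (r ^ 4 * k) + 4))
          + 8 * (r ^ 4 * Q * (r ^ 4 * k)))) := by gcongr
    _ = cubicConst r k * Q := by unfold cubicConst; ring

/-- With `λ a² = R² δ`, the quartic error and the squared Lipschitz constant `28 τ m` of the damped
cubic both scale as `δ²/λ`; here `(28/6)² ≤ 22`. -/
lemma scaled_derivatives_le {a lam R δ ω₃₀ ω₄₀ : ℝ} (hlam : 0 < lam) (p₄₀ : 0 ≤ ω₄₀)
    (ha2 : a ^ 2 = R ^ 2 * (δ / lam)) :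
    lam * (ω₄₀ * a ^ 4) ≤ R ^ 4 * ((ω₃₀ ^ 2 + ω₄₀) * (δ ^ 2 / lam)) ∧
    (28 * (ω₃₀ / (6 * Real.sqrt lam)) * (lam * a ^ 2)) ^ 2
      ≤ 22 * (R ^ 4 * ((ω₃₀ ^ 2 + ω₄₀) * (δ ^ 2 / lam))) := by
  have hX : 0 ≤ R ^ 4 * (δ ^ 2 / lam) := by positivity
  have h3 : 0 ≤ ω₃₀ ^ 2 * (R ^ 4 * (δ ^ 2 / lam)) := by positivity
  have h4 : 0 ≤ ω₄₀ * (R ^ 4 * (δ ^ 2 / lam)) := by positivity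
  constructor
  · have e : lam * (ω₄₀ * a ^ 4) = ω₄₀ * (R ^ 4 * (δ ^ 2 / lam)) := by
      rw [show a ^ 4 = (a ^ 2) ^ 2 by ring, ha2]; field_simp
    linarith
  · have e : (28 * (ω₃₀ / (6 * Real.sqrt lam)) * (lam * a ^ 2)) ^ 2
        = 784 / 36 * (ω₃₀ ^ 2 * (R ^ 4 * (δ ^ 2 / lam))) := by
      rw [ha2, mul_pow, mul_pow, div_pow, mul_pow, Real.sq_sqrt hlam.le]; field_simp; ring
    linarith

/-- The boundary error. -/
lemma slope_error_le {a lam ω₁₁ ω₂₁ ω₀₂ ω e Λ : ℝ} (hlam : 1 ≤ lam) (ha : 0 < a)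
    (hla : 1 ≤ lam * a ^ 2) (p₁₁ : 0 ≤ ω₁₁) (p₂₁ : 0 ≤ ω₂₁) (p₀₂ : 0 ≤ ω₀₂) (hω : ω₀₂ ≤ ω)
    (hsmall : a * (ω₁₁ + ω) + a ^ 2 * ω₂₁ ≤ 1 / 2) (he : e ≤ Λ) (hΛ : Λ ≤ 1) :
    (4 * ω₁₁ ^ 2 + 3 * ω₂₁) * a ^ 2 + (128 * ω₀₂ / lam + 2 * e) ≤ 69 ∧
    2 * ((4 * ω₁₁ ^ 2 + 3 * ω₂₁) * a ^ 2 + (128 * ω₀₂ / lam + 2 * e)) + (ω₁₁ * a) ^ 2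
      ≤ 9 * ((ω₁₁ ^ 2 + ω₂₁) * a ^ 2) + 256 * (ω₀₂ * (1 / lam)) + 4 * Λ := by
  have hl0 : 0 < lam := by linarith
  have h1 : 0 ≤ a * ω₁₁ := by positivity
  have h2 : 0 ≤ a ^ 2 * ω₂₁ := by positivity
  have h3 : a * ω₀₂ ≤ a * ω := by gcongr
  have h4 : 0 ≤ a * ω₀₂ := by positivity
  -- `(aλ)² = λ · λa² ≥ 1`, so `1/λ ≤ a`. The smallness condition then gives `128 ω₀₂/λ ≤ 64`, the
  -- main part of the bound `69`.
  have h5 : ω₀₂ / lam ≤ a * ω₀₂ := by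
    rw [div_le_iff₀ hl0]
    have : 1 ≤ a * lam := by nlinarith
    nlinarith
  have h6 : a * ω₁₁ ≤ 1 / 2 := by nlinarith
  have h7 : (a * ω₁₁) ^ 2 ≤ 1 / 4 := by nlinarith
  have h8 : a * ω₀₂ ≤ 1 / 2 := by nlinarith
  have h9 : a ^ 2 * ω₂₁ ≤ 1 / 2 := by nlinarith
  have h10 : 128 * ω₀₂ / lam = 128 * (ω₀₂ / lam) := by ring
  have h11 : ω₀₂ * (1 / lam) = ω₀₂ / lam := by ring
  rw [h10, h11]
  constructor <;> nlinarith

end BoundaryLaplace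

/-! ### Assembly of the estimate. -/

set_option maxHeartbeats 1000000 in
theorem proposition3p3 :
    ∃ C : ℝ → ℝ → ℝ,
      (∀ R c : ℝ, 0 < C R c) ∧
      (∀ R R' c c' : ℝ, R ≤ R' → c ≤ c' → C R c ≤ C R' c') ∧
      ∀ (d : ℕ) (D : Set (Vec d × ℝ)) (z : Vec d × ℝ → ℝ) (Ω : Set (Vec d)) (ψ : Vec d → ℝ)
        (ρ₀ ρ₁ s lam M R C₃₄ ε : ℝ) (H : Matrix (Fin d) (Fin d) ℝ) (w : Vec d × ℝ → ℝ),
        1 ≤ d → 1 ≤ lam → 1 ≤ M →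
        Setting D z Ω ψ ρ₀ →
        GlobalGrowth D z ψ ρ₀ ρ₁ s →
        H = hessH z ψ →
        w = wFun z ψ →
        ε = Real.sqrt (d / lam) →
        12 / Cmin D z ψ ρ₁ + 2 * (1 + 2 * M) * Real.log lam / d ≤ R →
        ContDiffOn ℝ 4 w (UH H (R * ε) ×ˢ Set.Icc 0 ((R * ε) ^ 2)) →
        ε ≤ s →
        R * ε ≤ 1 → R * ε ≤ ρ₀ → R * ε ≤ 2 * ρ₁ → R * ε * delta H ψ 2 ρ₁ ≤ 2 →
        R * ε * (omega H w (R * ε) ((R * ε) ^ 2) 1 1 0 0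
              + omega H w (R * ε) (R * ε) 0 2 (R * ε) (R * ε))
            + (R * ε) ^ 2 * omega H w (R * ε) ((R * ε) ^ 2) 2 1 (R * ε) 0 ≤ 1 / 2 →
        (omega H w (R * ε) ((R * ε) ^ 2) 3 0 0 0 ^ 2
              + omega H w (R * ε) ((R * ε) ^ 2) 4 0 (R * ε) 0) * ((d : ℝ) ^ 2 / lam) ≤ C₃₄ →
        MeasureTheory.IntegrableOn (fun u => Real.exp (-lam * z u)) D ∧
        ∃ Rem₁ : ℝ,
          ∫ u in D, Real.exp (-lam * z u)
            = (2 * Real.pi / lam) ^ ((d : ℝ) / 2) * Real.exp (-lam * z 0)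
                / (lam * Real.sqrt H.det) * (1 + Rem₁) ∧
          |Rem₁| ≤ C R C₃₄ *
            ((omega H w (R * ε) ((R * ε) ^ 2) 3 0 0 0 ^ 2
                  + omega H w (R * ε) ((R * ε) ^ 2) 4 0 (R * ε) 0) * ((d : ℝ) ^ 2 / lam)
              + (omega H w (R * ε) ((R * ε) ^ 2) 1 1 0 0 ^ 2
                  + omega H w (R * ε) ((R * ε) ^ 2) 2 1 (R * ε) 0) * ((d : ℝ) / lam)
              + omega H w (R * ε) ((R * ε) ^ 2) 0 2 (R * ε) ((R * ε) ^ 2) * (1 / lam)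
              + lam ^ (-M)) := by
  refine ⟨remainderConst, remainderConst_pos, fun _ _ _ _ => remainderConst_mono, ?_⟩
  intro d D z Ω ψ ρ₀ ρ₁ s lam M R C₃₄ ε H w hd hlam hM h hg hHdef hwdef hε hR hw hεs ha1 haρ haρ₁ _
    hsmall hC
  have hl0 : 0 < lam := by linarith
  have hd1 : (1:ℝ) ≤ d := by exact_mod_cast hd
  have hH : H.PosDef := hHdef ▸ h.H_posDef
  have hc := h.Cmin_pos hd hg.ρ₁_pos hg.ρ₁_lt.le
  obtain ⟨hR12, hF, hG, hK, hE⟩ := exp_tails_le hd hlam hM hc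
    (h.Cmin_le_one hg.ρ₁_pos hg.ρ₁_lt.le) hR
  have hR0 : 0 < R := by linarith
  have hε0 : 0 < ε := by rw [hε]; positivity
  have hε2 : ε ^ 2 = d / lam := by rw [hε, Real.sq_sqrt (by positivity)]
  obtain ⟨hint, E, hED, hEle⟩ := h.far_estimate hg hd hl0 hε hR0 hεs haρ₁ haρ
  rw [← hHdef, ← hwdef] at hED
  rw [← hHdef] at hEle
  obtain ⟨a, haR⟩ : ∃ a, a = R * ε := ⟨_, rfl⟩
  have ha : 0 < a := by rw [haR]; positivity
  have ha2 : a ^ 2 = R ^ 2 * (d / lam) := by rw [haR, mul_pow, hε2]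
  have hla : lam * a ^ 2 = R ^ 2 * d := by rw [ha2]; field_simp
  rw [← haR] at hw ha1 haρ hsmall hC hED ⊢
  obtain ⟨ω₁₁, h₁₁⟩ : ∃ x, x = omega H w a (a ^ 2) 1 1 0 0 := ⟨_, rfl⟩
  obtain ⟨ω₂₁, h₂₁⟩ : ∃ x, x = omega H w a (a ^ 2) 2 1 a 0 := ⟨_, rfl⟩
  obtain ⟨ω₃₀, h₃₀⟩ : ∃ x, x = omega H w a (a ^ 2) 3 0 0 0 := ⟨_, rfl⟩
  obtain ⟨ω₄₀, h₄₀⟩ : ∃ x, x = omega H w a (a ^ 2) 4 0 a 0 := ⟨_, rfl⟩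
  obtain ⟨ω₀₂, h₀₂⟩ : ∃ x, x = omega H w a (a ^ 2) 0 2 a (a ^ 2) := ⟨_, rfl⟩
  have p₁₁ : 0 ≤ ω₁₁ := h₁₁ ▸ omega_nonneg _ _ _ _
  have p₂₁ : 0 ≤ ω₂₁ := h₂₁ ▸ omega_nonneg _ _ _ _
  have p₃₀ : 0 ≤ ω₃₀ := h₃₀ ▸ omega_nonneg _ _ _ _
  have p₄₀ : 0 ≤ ω₄₀ := h₄₀ ▸ omega_nonneg _ _ _ _
  have p₀₂ : 0 ≤ ω₀₂ := h₀₂ ▸ omega_nonneg _ _ _ _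
  have hmono : ω₀₂ ≤ omega H w a a 0 2 a a := by
    obtain ⟨O, hO, hsubO, hwO⟩ := h.exists_open_domain
    rw [← hwdef] at hwO
    rw [← hHdef] at hsubO
    exact h₀₂ ▸ omega_zero_two_mono hH ha.le hO hwO (by positivity) (by nlinarith)
      fun p hp => hsubO ⟨UH_mono haρ hp.1, hp.2.1⟩
  rw [← h₁₁, ← h₂₁] at hsmall
  rw [← h₃₀, ← h₄₀] at hC
  rw [← h₁₁, ← h₂₁, ← h₃₀, ← h₄₀, ← h₀₂]
  obtain ⟨J, hJ, hJle⟩ := h.near_estimate hl0 ha ha1 haρ hHdef hwdef hw h₁₁ h₂₁ h₃₀ h₄₀ h₀₂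
    hsmall rfl rfl rfl rfl rfl
  have hdet : 0 < Real.sqrt H.det := Real.sqrt_pos.2 hH.det_pos
  obtain ⟨Z, hZ⟩ : ∃ Z, Z = (2 * Real.pi / lam) ^ ((d:ℝ) / 2) / Real.sqrt H.det := ⟨_, rfl⟩
  have hZ0 : 0 < Z := by rw [hZ]; positivity
  rw [← hZ] at hEle
  have hfac : ∀ u, Real.exp (-lam * z u) = Real.exp (-lam * z 0) * Real.exp (-lam * (z u - z 0)) :=
    fun u => by rw [← Real.exp_add]; congr 1; ring
  rw [funext hfac]
  -- The strip contributes `J` and the rest `E`, both relative to the leading term `Z / λ`, after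
  -- `e^{-λ z(0)}` is factored out.
  refine ⟨hint.const_mul _, J - 1 + E * lam / Z, ?_, ?_⟩
  · rw [integral_const_mul, hED, hJ, hZ]
    have : (2 * Real.pi / lam) ^ ((d:ℝ) / 2) ≠ 0 := by positivity
    field_simp
    ring
  have hΛ0 : 0 < lam ^ (-M) := by positivity
  have hΛ1 : lam ^ (-M) ≤ 1 := Real.rpow_le_one_of_one_le_of_nonpos hlam (by linarith)
  obtain ⟨Λ, hΛ⟩ : ∃ Λ, Λ = lam ^ (-M) := ⟨_, rfl⟩
  rw [← hΛ] at hF hG hK hE hΛ0 hΛ1 ⊢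
  -- the contribution of the complement of the boundary strip
  have hfar : |E * lam / Z| ≤ (8 + R / 3) * Λ := by
    rw [abs_div, abs_mul, abs_of_pos hl0, abs_of_pos hZ0, div_le_iff₀ hZ0]
    have e : (Real.exp (-(R * d / 4)) * (Z * 4 ^ d * (8 / Real.sqrt lam))
        + Real.exp (-(Cmin D z ψ ρ₁ * (R ^ 2 * d) / 4)) * (Z * (2 / Cmin D z ψ ρ₁) ^ ((d:ℝ) / 2) *
            (4 / (lam * Cmin D z ψ ρ₁)))) * lam
        = (Real.exp (-(R * d / 4)) * 4 ^ d * (8 * Real.sqrt lam)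
          + Real.exp (-(Cmin D z ψ ρ₁ * (R ^ 2 * d) / 4)) * (2 / Cmin D z ψ ρ₁) ^ ((d:ℝ) / 2)
            * (4 / Cmin D z ψ ρ₁)) * Z := by
      have e1 : 8 / Real.sqrt lam * lam = 8 * Real.sqrt lam := by
        rw [div_mul_eq_mul_div, mul_div_assoc, Real.div_sqrt]
      have e2 : 4 / (lam * Cmin D z ψ ρ₁) * lam = 4 / Cmin D z ψ ρ₁ := by field_simp
      rw [← e1, ← e2]; ring
    calc |E| * lam ≤ _ := by gcongr
      _ = _ := e
      _ ≤ (8 + R / 3) * Λ * Z := by gcongr; linarith only [hF, hG]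
  -- the boundary strip
  have hQ0 : 0 ≤ (ω₃₀ ^ 2 + ω₄₀) * ((d:ℝ) ^ 2 / lam) := by positivity
  obtain ⟨Q, hQ⟩ : ∃ Q, Q = (ω₃₀ ^ 2 + ω₄₀) * ((d:ℝ) ^ 2 / lam) := ⟨_, rfl⟩
  rw [← hQ] at hQ0 hC ⊢
  have hγ : (gauss d).real (eball d (lam * a ^ 2))ᶜ ≤ Λ :=
    (gauss_real_compl_eball_le d _).trans (by rw [hla]; exact hK)
  have hE' : Real.exp (-(lam * a ^ 2 / 2)) ≤ Λ := by rw [hla]; exact hE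
  have hla1 : 1 ≤ lam * a ^ 2 := by
    rw [hla]; exact one_le_mul_of_one_le_of_one_le (one_le_pow₀ (by linarith only [hR12])) hd1
  obtain ⟨hη, hηβ⟩ := slope_error_le hlam ha hla1 p₁₁ p₂₁ p₀₂ hmono hsmall
    hE' hΛ1
  obtain ⟨hκ, hL⟩ := scaled_derivatives_le hl0 (ω₃₀ := ω₃₀) p₄₀ ha2
  rw [← hQ] at hκ hL
  have hnear := cubic_error_le hQ0 (hC.trans (le_max_left _ 0)) (by positivity) hκ
    (by positivity) hL hη
  have hmax : max R 1 = R := max_eq_left (by linarith)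
  have hcc := cubicConst_nonneg (r := R) (le_max_right C₃₄ 0)
  have ha2' : (ω₁₁ ^ 2 + ω₂₁) * a ^ 2 = R ^ 2 * ((ω₁₁ ^ 2 + ω₂₁) * (d / lam)) := by rw [ha2]; ring
  obtain ⟨P, hP⟩ : ∃ P, P = (ω₁₁ ^ 2 + ω₂₁) * (d / lam) := ⟨_, rfl⟩
  have hP0 : 0 ≤ P := by rw [hP]; positivity
  obtain ⟨S, hS⟩ : ∃ S, S = ω₀₂ * (1 / lam) := ⟨_, rfl⟩
  have hS0 : 0 ≤ S := by rw [hS]; positivity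
  rw [ha2', ← hP, ← hS] at hηβ
  rw [← hP, ← hS]
  have htot : |J - 1 + E * lam / Z| ≤ cubicConst R (max C₃₄ 0) * Q + 9 * R ^ 2 * P + 256 * S
      + (13 + R / 3) * Λ := by
    refine (abs_add_le _ _).trans ?_
    linarith only [hJle, hγ, hηβ, hnear, hfar]
  refine htot.trans ?_
  unfold remainderConst
  rw [hmax]
  -- The constant is the sum of the four coefficients; the cross terms that it adds are nonnegative.
  have hQ' : 0 ≤ (9 * R ^ 2 + 256 + (13 + R / 3)) * Q := by positivity
  have hP' : 0 ≤ (cubicConst R (max C₃₄ 0) + 256 + (13 + R / 3)) * P := by positivity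
  have hS' : 0 ≤ (cubicConst R (max C₃₄ 0) + 9 * R ^ 2 + (13 + R / 3)) * S := by positivity
  have hΛ' : 0 ≤ (cubicConst R (max C₃₄ 0) + 9 * R ^ 2 + 256) * Λ := by positivity
  linarith only [hQ', hP', hS', hΛ']
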